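/- **Histories.** Let rows have primary keys from a finite set $\mathsf{Keys}$. A history $h=\langle T,\mathsf{so},\mathsf{wr}\rangle$ consists of a finite set $T$ of transactions, each with an isolation level and a finite set of events (begin, commit, abort, $\mathtt{SELECT}(p)$, $\mathtt{INSERT}(R)$, $\mathtt{DELETE}(p)$, $\mathtt{UPDATE}(p,U)$, where $p$ is a predicate on rows, $R$ a set of rows with distinct keys, $U:\mathsf{Keys}\to\mathsf{Rows}$) strictly totally ordered by the program order $\mathsf{po}$. The first event is a begin, and a commit or abort can only be last. Reads are the $\mathtt{SELECT}$, $\mathtt{DELETE}$ and $\mathtt{UPDATE}$ events, writes the $\mathtt{INSERT}$, $\mathtt{DELETE}$ and $\mathtt{UPDATE}$ events. Further, $\mathsf{so}$ is a strict partial order on $T$ (session order), and for every key $x$ the relation $\mathsf{wr}_x$ relates writes of non-aborted transactions to reads. A transaction $\mathtt{init}$ that is not aborted precedes all others in $\mathsf{so}$ and inserts at every key, and only $\mathtt{init}$ may insert the mark $\dagger_x$ ("no row with key $x$"). The value of a write $w$ at $x$ is: the row (or $\dagger_x$) inserted at $x$ if $w$ is an $\mathtt{INSERT}$; $\dagger_x$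 for a $\mathtt{DELETE}(p)$, resp. $U(x)$ for an $\mathtt{UPDATE}(p,U)$, if $w$ reads $x$ from an event whose value at $x$ is a row satisfying $p$; and undefined otherwise. It is required that $\mathsf{wr}_x^{-1}$ is a partial function, that $w$ has a value at $x$ if $(w,r)\in\mathsf{wr}_x$, that no two events of a transaction have a value at the same key, and that $\mathsf{so}\cup\mathsf{wr}$ is acyclic on $T$, where $\mathsf{wr}$ and $\mathsf{wr}_x$ are extended to pairs of distinct transactions, and to pairs of a transaction and a read of another transaction, by existence of related events. An event of a non-aborted transaction writes $x$ if it has a value at $x$; a transaction writes $x$ if one of its events does. The history is *full* if for every read $r$ and key $x$ either $\mathsf{wr}_x^{-1}(r)$ is defined or $r$ is preceded in its transaction by an event that writes $x$. **Isolation levels.** An isolation level is a finite conjunction of axioms $$a(r):\ \forall x,t_1,t_2.\ t_1\ne t_2\wedge (t_1,r)\in\mathsf{wr}_x\wedge t_2\text{ writes }x\wedge \mathsf{vis}_a(t_2,r,x)\Rightarrow (t_2,t_1)\in\mathsf{co},$$ where $\mathsf{vis}_a(\tau_0,r,x)$ says that there are transactions or events $\tau_1,\dots,\tau_m$ and keys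 $y_1,\dots,y_q$ with $(\tau_{i},\tau_{i+1})\in\mathsf{Rel}_{i}$ for $0\le i\le m$, $\tau_{m+1}$ being $r$ or the transaction of $r$, and such that a given Boolean combination of the conditions "$\tau_i$ writes $y_j$", "the transaction of $\tau_i$ writes $y_j$", "$y_i=y_j$" (with $y_0=x$) holds. Each $\mathsf{Rel}_i$ is built from $\mathsf{po},\mathsf{so},\mathsf{wr},\mathsf{co}$ by union, composition, transitive closure and reflexive transitive closure. The level is *saturable* if no $\mathsf{Rel}_i$ uses $\mathsf{co}$ (e.g. Read Committed, Read Atomic), and *$k$-bounded* if it has at most $k$ axioms, each with at most $k$ quantifiers (that is, $3+m+q\le k$). The isolation configuration of $h$ is saturable, resp. $k$-bounded, if the level of every transaction is. A full history is *consistent* if there is a strict total order $\mathsf{co}\supseteq\mathsf{so}\cup\mathsf{wr}$ on $T$ such that for every read $r$ all axioms $a$ of the level of the transaction of $r$ satisfy $a(r)$. **Theorem.** (1) Let $h$ be a full history with a saturable isolation configuration. Let $\mathsf{pco}$ be the union of $(\mathsf{so}\cup\mathsf{wr})^+$ with all pairs $(t_2,t_1)$, $t_1\neq t_2$, for which there are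 a key $x$, a read $r$ and an axiom $a$ of the level of the transaction of $r$ such that $(t_1,r)\in\mathsf{wr}_x$, $t_2$ writes $x$ and $\mathsf{vis}_a(t_2,r,x)$ holds (evaluated with $(\mathsf{so}\cup\mathsf{wr})^+$ in place of $\mathsf{co}$). Then $h$ is consistent if and only if $\mathsf{so}\cup\mathsf{wr}$ and $\mathsf{pco}$ are both acyclic. (2) Consistency of full histories with bounded saturable isolation configurations can be decided in polynomial time: there is a program that, for every $k$, decides the consistency of every full history $h$ with a $k$-bounded saturable isolation configuration in a number of steps bounded by a polynomial, depending only on $k$, in the size $|h|$ (the number of transactions, events and keys plus the length of the axioms). Programs are random access programs over natural numbers with unit cost addition, subtraction, comparison, memory access, and access to the entries of the history, and evaluating a $\mathtt{WHERE}$ predicate on a single row counts as one step. -/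

import Mathlib

universe u

namespace SqlIso

/-! ## Events, values and histories -/

/-- What a write can leave at a key: a row, or the mark `†ₓ` for "there is no row with key `x`". -/
inductive Cell (Row : Type u) (K : Type) : Type u
  | row (r : Row)
  | absent (x : K)

/-- The key of a cell. -/
def Cell.key {Row : Type u} {K : Type} (keyOf : Row → K) : Cell Row K → K
  | .row r => keyOf r
  | .absent x => x

/-- The types of events, with their parameters: the `WHERE` predicate `p` of a `SELECT`, `DELETE`
or `UPDATE`, the map `U` of an `UPDATE`, the set `R` of an `INSERT`. -/
inductive Op (Row : Type u) (K : Type) : Type u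
  | beginT
  | commitT
  | abortT
  | select (p : Row → Bool)
  | insert (R : Set (Cell Row K))
  | delete (p : Row → Bool)
  | update (p : Row → Bool) (U : K → Row)

namespace Op

variable {Row : Type u} {K : Type}

/-- Read events: those that inspect the database. -/
def IsRead : Op Row K → Prop
  | select _ => True
  | delete _ => True
  | update _ _ => True
  | _ => False

/-- Write events: those that modify the database. -/
def IsWrite : Op Row K → Prop
  | insert _ => True
  | delete _ => True
  | update _ _ => True
  | _ => False

/-- Numerical code of the type of an event (parameters dropped). -/
def code : Op Row K → ℕ
  | beginT => 0
  | commitT => 1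
  | abortT => 2
  | select _ => 3
  | insert _ => 4
  | delete _ => 5
  | update _ _ => 6

end Op

/-! ## Isolation levels (syntax) -/

/-- Relation expressions of visibility relations. -/
inductive Rel : Type
  | po
  | so
  | wr
  | co
  | union (a b : Rel)
  | comp (a b : Rel)
  | plus (a : Rel)
  | star (a : Rel)

/-- The expression does not mention the commit order. -/
def Rel.CoFree : Rel → Prop
  | .po => True
  | .so => True
  | .wr => True
  | .co => False
  | .union a b => a.CoFree ∧ b.CoFree
  | .comp a b => a.CoFree ∧ b.CoFree
  | .plus a => a.CoFree
  | .star a => a.CoFree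

/-- Postfix code of a relation expression. -/
def Rel.code : Rel → List ℕ
  | .po => [0]
  | .so => [1]
  | .wr => [2]
  | .co => [3]
  | .union a b => a.code ++ b.code ++ [4]
  | .comp a b => a.code ++ b.code ++ [5]
  | .plus a => a.code ++ [6]
  | .star a => a.code ++ [7]

/-- Quantifier-free constraints on what `n` events or transactions `τ` write, over `q` keys `y`:
Boolean combinations of "`τ i` writes `y j`", "the transaction of `τ i` writes `y j`" and
"`y j = y j'`". -/
inductive WrCons (n q : ℕ) : Type
  | tt
  | writes (i : Fin n) (j : Fin q)
  | transWrites (i : Fin n) (j : Fin q)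
  | keyEq (j j' : Fin q)
  | not (a : WrCons n q)
  | and (a b : WrCons n q)
  | or (a b : WrCons n q)

/-- Postfix code of a constraint; each instruction has an opcode and two arguments. -/
def WrCons.code {n q : ℕ} : WrCons n q → List (ℕ × ℕ × ℕ)
  | .tt => [(0, 0, 0)]
  | .writes i j => [(1, i, j)]
  | .transWrites i j => [(2, i, j)]
  | .keyEq j j' => [(3, j, j')]
  | .not a => a.code ++ [(4, 0, 0)]
  | .and a b => a.code ++ b.code ++ [(5, 0, 0)]
  | .or a b => a.code ++ b.code ++ [(6, 0, 0)]

/-- The visibility relation of one axiom, describing when a transaction `τ₀` is visible to a read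
event `r` at a key `x = y₀`:
`∃ τ₁ … τₘ, ∃ y₁ … y_q, ⋀ᵢ (τᵢ, τᵢ₊₁) ∈ relᵢ ∧ cons(τ₀, …, τₘ₊₁, y₀, …, y_q)`.
The last point `τₘ₊₁` of the path is the event `r`, or the transaction of `r`
if `toTrans` is set (as in Read Atomic). -/
structure Vis : Type where
  /-- number of intermediate events or transactions -/
  m : ℕ
  /-- number of quantified keys besides `x` -/
  q : ℕ
  toTrans : Bool
  rel : Fin (m + 1) → Rel
  cons : WrCons (m + 2) (q + 1)

/-- Number of quantifiers of the axiom with this visibility relation: those of `∀ x t₁ t₂` and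
those inside the visibility relation. -/
def Vis.quantifiers (v : Vis) : ℕ := 3 + v.m + v.q

/-- Length of the formula. -/
def Vis.size (v : Vis) : ℕ :=
  1 + v.m + v.q + (∑ j, (v.rel j).code.length) + v.cons.code.length

/-- An isolation level is a conjunction of axioms, given by their visibility relations. -/
abbrev IsoLevel : Type := List Vis

/-- An isolation level is saturable if its visibility relations do not use the commit order. -/
def IsoLevel.Saturable (l : IsoLevel) : Prop :=
  ∀ v ∈ l, ∀ j, (v.rel j).CoFree

/-- At most `k` axioms, each with at most `k` quantifiers. -/
def IsoLevel.Bounded (k : ℕ) (l : IsoLevel) : Prop :=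
  l.length ≤ k ∧ ∀ v ∈ l, v.quantifiers ≤ k

/-! ## Histories -/

/-- The data of a history: finitely many transactions, events and keys (all numbered), together
with an isolation level for every transaction. The laws are in `IsHistory`. -/
structure PreHistory : Type (u + 1) where
  nT : ℕ
  nE : ℕ
  nK : ℕ
  Row : Type u
  keyOf : Row → Fin nK
  op : Fin nE → Op Row (Fin nK)
  /-- the transaction that contains an event -/
  tr : Fin nE → Fin nT
  /-- program order -/
  po : Fin nE → Fin nE → Prop
  /-- session order -/
  so : Fin nT → Fin nT → Prop
  /-- `wr x w r`: the read `r` reads key `x` from the write `w` -/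
  wr : Fin nK → Fin nE → Fin nE → Prop
  /-- the transaction that writes the initial state -/
  init : Fin nT
  /-- the isolation configuration -/
  iso : Fin nT → IsoLevel

/-- A relation without cycles. -/
def Acyclic {α : Type} (R : α → α → Prop) : Prop :=
  ∀ a, ¬ Relation.TransGen R a a

namespace PreHistory

variable (h : PreHistory.{u})

/-- The transaction contains an abort. -/
def Aborted (t : Fin h.nT) : Prop :=
  ∃ e, h.tr e = t ∧ h.op e = Op.abortT

/-- `h.HasValue x w c`: the value of the event `w` at the key `x` is defined and equals `c`. (The
value is undefined, `⊥`, when there is no such `c`. The special cell `absent x` satisfies no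
predicate.) -/
inductive HasValue (x : Fin h.nK) : Fin h.nE → Cell h.Row (Fin h.nK) → Prop
  | insert {w : Fin h.nE} {R : Set (Cell h.Row (Fin h.nK))} {c : Cell h.Row (Fin h.nK)}
      (hop : h.op w = Op.insert R) (hc : c ∈ R) (hx : c.key h.keyOf = x) : HasValue x w c
  | delete {w w' : Fin h.nE} {p : h.Row → Bool} {r : h.Row}
      (hop : h.op w = Op.delete p) (hwr : h.wr x w' w)
      (hv : HasValue x w' (Cell.row r)) (hp : p r = true) : HasValue x w (Cell.absent x)
  | update {w w' : Fin h.nE} {p : h.Row → Bool} {U : Fin h.nK → h.Row} {r : h.Row}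
      (hop : h.op w = Op.update p U) (hwr : h.wr x w' w)
      (hv : HasValue x w' (Cell.row r)) (hp : p r = true) : HasValue x w (Cell.row (U x))

/-- The event `w` writes the key `x`. -/
def Writes (w : Fin h.nE) (x : Fin h.nK) : Prop :=
  (∃ c, h.HasValue x w c) ∧ ¬ h.Aborted (h.tr w)

/-- The transaction `t` writes the key `x`. -/
def TransWrites (t : Fin h.nT) (x : Fin h.nK) : Prop :=
  ∃ w, h.tr w = t ∧ h.Writes w x

/-- `wr` between two (different) transactions. -/
def wrTT (t t' : Fin h.nT) : Prop :=
  t ≠ t' ∧ ∃ x w r, h.tr w = t ∧ h.tr r = t' ∧ h.wr x w r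

/-- `wr` at key `x` between a transaction and a read event of another transaction. -/
def wrTE (x : Fin h.nK) (t : Fin h.nT) (r : Fin h.nE) : Prop :=
  t ≠ h.tr r ∧ ∃ w, h.tr w = t ∧ h.wr x w r

/-- `so ∪ wr` on transactions. -/
def soWr (t t' : Fin h.nT) : Prop := h.so t t' ∨ h.wrTT t t'

/-- The laws of histories. -/
structure IsHistory : Prop where
  /-- the program order is a strict total order on each transaction -/
  po_tr : ∀ e f, h.po e f → h.tr e = h.tr f
  po_irrefl : ∀ e, ¬ h.po e e
  po_trans : ∀ e f g, h.po e f → h.po f g → h.po e g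
  po_total : ∀ e f, h.tr e = h.tr f → e ≠ f → h.po e f ∨ h.po f e
  /-- the first event of a transaction is a begin, and only the last one can be a commit or an
  abort -/
  begin_first : ∀ t, ∃ e, h.tr e = t ∧ h.op e = Op.beginT ∧ ∀ f, h.tr f = t → f ≠ e → h.po e f
  end_last : ∀ e, h.op e = Op.commitT ∨ h.op e = Op.abortT →
    ∀ f, h.tr f = h.tr e → f ≠ e → h.po f e
  /-- keys are primary: an `INSERT` inserts at most one row per key -/
  insert_key : ∀ e R, h.op e = Op.insert R → Set.InjOn (Cell.key h.keyOf) R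
  /-- a transaction modifies no key twice -/
  modify_once : ∀ x w w' c c', h.tr w = h.tr w' → h.HasValue x w c → h.HasValue x w' c' → w = w'
  /-- the session order is a strict partial order -/
  so_irrefl : ∀ t, ¬ h.so t t
  so_trans : ∀ t t' t'', h.so t t' → h.so t' t'' → h.so t t''
  /-- `init` comes before all other transactions, takes effect, and inserts at every key; only
  `init` may insert `†` -/
  init_so : ∀ t, t ≠ h.init → h.so h.init t
  init_effective : ¬ h.Aborted h.init
  init_inserts : ∀ x, ∃ w R, h.tr w = h.init ∧ h.op w = Op.insert R ∧ ∃ c ∈ R, c.key h.keyOf = x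
  absent_init : ∀ e R x, h.op e = Op.insert R → Cell.absent x ∈ R → h.tr e = h.init
  /-- `wr x` relates writes of non-aborted transactions to reads, and its inverse is a partial
  function -/
  wr_write : ∀ x w r, h.wr x w r → (h.op w).IsWrite ∧ ¬ h.Aborted (h.tr w)
  wr_read : ∀ x w r, h.wr x w r → (h.op r).IsRead
  wr_unique : ∀ x w w' r, h.wr x w r → h.wr x w' r → w = w'
  /-- a key is only read from an event with a value at that key -/
  wr_value : ∀ x w r, h.wr x w r → ∃ c, h.HasValue x w c
  acyclic : Acyclic h.soWr

/-- The read `r` reads the key `x` locally: it is preceded in its transaction by a write of `x`. -/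
def ReadsLocally (r : Fin h.nE) (x : Fin h.nK) : Prop :=
  ∃ w, h.po w r ∧ h.Writes w x

/-- Full histories: every read reads every key, unless it reads it locally. -/
def IsFull : Prop :=
  ∀ r, (h.op r).IsRead → ∀ x, ¬ h.ReadsLocally r x → ∃ w, h.wr x w r

/-! ## Semantics of isolation levels -/

/-- Paths of visibility relations go through transactions and events. -/
abbrev Node : Type := Fin h.nT ⊕ Fin h.nE

/-- The transaction of a node. -/
def nodeTr : h.Node → Fin h.nT
  | .inl t => t
  | .inr e => h.tr e

/-- `po` relates events only. -/
def poN : h.Node → h.Node → Prop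
  | .inr e, .inr f => h.po e f
  | _, _ => False

/-- `wr` on events, extended to pairs of transactions and to pairs of a transaction and a read. -/
def wrN : h.Node → h.Node → Prop
  | .inr w, .inr r => ∃ x, h.wr x w r
  | .inl t, .inr r => ∃ x, h.wrTE x t r
  | .inl t, .inl t' => h.wrTT t t'
  | .inr _, .inl _ => False

/-- The meaning of a relation expression, for a commit order (or partial commit order) `co`. -/
def evalRel (co : Fin h.nT → Fin h.nT → Prop) : Rel → h.Node → h.Node → Prop
  | .po => h.poN
  | .so => fun a b => h.so (h.nodeTr a) (h.nodeTr b)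
  | .wr => h.wrN
  | .co => fun a b => co (h.nodeTr a) (h.nodeTr b)
  | .union a b => fun n n' => evalRel co a n n' ∨ evalRel co b n n'
  | .comp a b => Relation.Comp (evalRel co a) (evalRel co b)
  | .plus a => Relation.TransGen (evalRel co a)
  | .star a => Relation.ReflTransGen (evalRel co a)

/-- A node writes a key. -/
def NodeWrites : h.Node → Fin h.nK → Prop
  | .inl t, x => h.TransWrites t x
  | .inr e, x => h.Writes e x

/-- The meaning of a constraint. -/
def evalCons {n q : ℕ} (τ : Fin n → h.Node) (y : Fin q → Fin h.nK) : WrCons n q → Prop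
  | .tt => True
  | .writes i j => h.NodeWrites (τ i) (y j)
  | .transWrites i j => h.TransWrites (h.nodeTr (τ i)) (y j)
  | .keyEq j j' => y j = y j'
  | .not a => ¬ evalCons τ y a
  | .and a b => evalCons τ y a ∧ evalCons τ y b
  | .or a b => evalCons τ y a ∨ evalCons τ y b

/-- `t` is visible to the read `r` at the key `x`, for a (partial) commit order `co`. -/
def Visible (co : Fin h.nT → Fin h.nT → Prop) (v : Vis) (t : Fin h.nT) (r : Fin h.nE)
    (x : Fin h.nK) : Prop :=
  ∃ (τ : Fin (v.m + 2) → h.Node) (y : Fin (v.q + 1) → Fin h.nK),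
    τ 0 = Sum.inl t ∧
    τ (Fin.last (v.m + 1)) = (if v.toTrans then Sum.inl (h.tr r) else Sum.inr r) ∧
    y 0 = x ∧
    (∀ i : Fin (v.m + 1), h.evalRel co (v.rel i) (τ i.castSucc) (τ i.succ)) ∧
    h.evalCons τ y v.cons

/-- The axiom with visibility relation `v` holds at the read `r` for the commit order `co`. -/
def HoldsAt (co : Fin h.nT → Fin h.nT → Prop) (v : Vis) (r : Fin h.nE) : Prop :=
  ∀ x t₁ t₂, t₁ ≠ t₂ → h.wrTE x t₁ r → h.TransWrites t₂ x → h.Visible co v t₂ r x → co t₂ t₁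

/-- Commit orders of executions of `h`: strict total orders that contain `so ∪ wr`. -/
structure IsCommitOrder (co : Fin h.nT → Fin h.nT → Prop) : Prop where
  irrefl : ∀ t, ¬ co t t
  trans : ∀ t t' t'', co t t' → co t' t'' → co t t''
  total : ∀ t t', t ≠ t' → co t t' ∨ co t' t
  soWr : ∀ t t', h.soWr t t' → co t t'

/-- Consistency: some execution satisfies, at every read, the axioms of the isolation level of the
transaction of the read. -/
def Consistent : Prop :=
  ∃ co, h.IsCommitOrder co ∧
    ∀ r, (h.op r).IsRead → ∀ v ∈ h.iso (h.tr r), h.HoldsAt co v r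

/-- The isolation configuration is saturable. -/
def Saturable : Prop := ∀ t, (h.iso t).Saturable

/-- The isolation configuration is bounded by `k`. -/
def Bounded (k : ℕ) : Prop := ∀ t, (h.iso t).Bounded k

/-! ## Saturation -/

/-- `pco` together with all pairs `(t₂, t₁)` that the axioms force when visibility is evaluated with
`pco` as partial commit order. -/
def saturate (pco : Fin h.nT → Fin h.nT → Prop) (t₂ t₁ : Fin h.nT) : Prop :=
  pco t₂ t₁ ∨
    ∃ x r, (h.op r).IsRead ∧ t₂ ≠ t₁ ∧ h.wrTE x t₁ r ∧ h.TransWrites t₂ x ∧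
      ∃ v ∈ h.iso (h.tr r), h.Visible pco v t₂ r x

/-- The outcome of the check: `so ∪ wr` is acyclic, and so is the relation obtained by saturating
`(so ∪ wr)⁺`. -/
def CheckSaturable : Prop :=
  Acyclic h.soWr ∧ Acyclic (h.saturate (Relation.TransGen h.soWr))

/-- The size of a history with its isolation configuration: the number of transactions, events and
keys, and the length of the formulas. -/
def size : ℕ :=
  h.nT + h.nE + h.nK + ∑ t, ((h.iso t).map Vis.size).sum

end PreHistory

/-! ## Programs with a step count

Random access programs over natural numbers, with registers and arrays. Arithmetic is limited to
addition, truncated subtraction and comparison (no multiplication), so that a number computed in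
`t` steps has `O(t)` bits and unit costs are polynomially related to Turing machine time. The input
history is accessed by queries at unit cost, among them the evaluation of a `WHERE` predicate on a
single row. -/

/-- The queries to the input; see `PreHistory.query` for their answers. -/
inductive Query : Type
  | numTrans
  | numEvents
  | numKeys
  | kind
  | trans
  | po
  | so
  | wr
  | inserts
  | whereHolds
  | numAxioms
  | toTrans
  | numInter
  | numExtraKeys
  | relLength
  | relToken
  | consLength
  | consOp
  | consArg1
  | consArg2

/-- The input of a program: an answer to every query with numerical arguments. -/
abbrev Input : Type := Query → ℕ → ℕ → ℕ → ℕ → ℕ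

open Classical in
/-- Truth values as numbers. -/
noncomputable def truth (p : Prop) : ℕ := if p then 1 else 0

namespace PreHistory

variable (h : PreHistory.{u})

/-- The `i`-th visibility relation of the isolation level of the `t`-th transaction. -/
def visAt (t i : ℕ) : Option Vis :=
  if ht : t < h.nT then (h.iso ⟨t, ht⟩)[i]? else none

/-- The code of the `j`-th relation expression of a visibility relation. -/
def relCode (t i j : ℕ) : List ℕ :=
  match h.visAt t i with
  | some v => if hj : j < v.m + 1 then (v.rel ⟨j, hj⟩).code else []
  | none => []

/-- The code of the constraint of a visibility relation. -/
def consCode (t i : ℕ) : List (ℕ × ℕ × ℕ) :=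
  match h.visAt t i with
  | some v => v.cons.code
  | none => []

/-- The `WHERE` predicate `p` holds of the row that the write `w` would leave at the key `x`. -/
def predHolds (p : h.Row → Bool) (w : Fin h.nE) (x : Fin h.nK) : Prop :=
  match h.op w with
  | .insert R => ∃ r, Cell.row r ∈ R ∧ h.keyOf r = x ∧ p r = true
  | .update _ U => p (U x) = true
  | _ => False

/-- The `WHERE` predicate of the event `e` holds of the row that `w` would leave at `x`. -/
def WhereHolds (e w : Fin h.nE) (x : Fin h.nK) : Prop :=
  match h.op e with
  | .select p => h.predHolds p w x
  | .delete p => h.predHolds p w x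
  | .update p _ => h.predHolds p w x
  | _ => False

/-- The history as an input (arguments out of range, and unused ones, give no information). -/
noncomputable def query : Input
  | .numTrans, _, _, _, _ => h.nT
  | .numEvents, _, _, _, _ => h.nE
  | .numKeys, _, _, _, _ => h.nK
  | .kind, a, _, _, _ => if ha : a < h.nE then (h.op ⟨a, ha⟩).code else 0
  | .trans, a, _, _, _ => if ha : a < h.nE then (h.tr ⟨a, ha⟩ : ℕ) else 0
  | .po, a, b, _, _ => truth (∃ e f : Fin h.nE, (e : ℕ) = a ∧ (f : ℕ) = b ∧ h.po e f)
  | .so, a, b, _, _ => truth (∃ s t : Fin h.nT, (s : ℕ) = a ∧ (t : ℕ) = b ∧ h.so s t)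
  | .wr, a, b, c, _ => truth (∃ (x : Fin h.nK) (w r : Fin h.nE),
      (x : ℕ) = a ∧ (w : ℕ) = b ∧ (r : ℕ) = c ∧ h.wr x w r)
  | .inserts, a, b, _, _ => truth (∃ (w : Fin h.nE) (x : Fin h.nK) (R : Set _),
      (w : ℕ) = a ∧ (x : ℕ) = b ∧ h.op w = Op.insert R ∧ ∃ c ∈ R, c.key h.keyOf = x)
  | .whereHolds, a, b, c, _ => truth (∃ (e w : Fin h.nE) (x : Fin h.nK),
      (e : ℕ) = a ∧ (w : ℕ) = b ∧ (x : ℕ) = c ∧ h.WhereHolds e w x)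
  | .numAxioms, t, _, _, _ => if ht : t < h.nT then (h.iso ⟨t, ht⟩).length else 0
  | .toTrans, t, i, _, _ => truth (∃ v, h.visAt t i = some v ∧ v.toTrans = true)
  | .numInter, t, i, _, _ => ((h.visAt t i).map Vis.m).getD 0
  | .numExtraKeys, t, i, _, _ => ((h.visAt t i).map Vis.q).getD 0
  | .relLength, t, i, j, _ => (h.relCode t i j).length
  | .relToken, t, i, j, l => (h.relCode t i j).getD l 0
  | .consLength, t, i, _, _ => (h.consCode t i).length
  | .consOp, t, i, l, _ => ((h.consCode t i).getD l (0, 0, 0)).1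
  | .consArg1, t, i, l, _ => ((h.consCode t i).getD l (0, 0, 0)).2.1
  | .consArg2, t, i, l, _ => ((h.consCode t i).getD l (0, 0, 0)).2.2

end PreHistory

/-- The memory of a program: registers, and arrays with three indices. -/
structure Store : Type where
  reg : ℕ → ℕ
  arr : ℕ → ℕ → ℕ → ℕ → ℕ

/-- The initial memory. -/
def Store.zero : Store := ⟨fun _ => 0, fun _ _ _ _ => 0⟩

/-- Write a register. -/
def Store.setReg (s : Store) (i n : ℕ) : Store :=
  { s with reg := fun i' => if i' = i then n else s.reg i' }

/-- Write an array cell. -/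
def Store.setArr (s : Store) (a i j k n : ℕ) : Store :=
  { s with arr := fun a' i' j' k' =>
      if a' = a ∧ i' = i ∧ j' = j ∧ k' = k then n else s.arr a' i' j' k' }

/-- Expressions. -/
inductive Expr : Type
  | const (n : ℕ)
  | reg (i : ℕ)
  | get (a : ℕ) (i j k : Expr)
  | add (e f : Expr)
  | sub (e f : Expr)
  | lt (e f : Expr)
  | eq (e f : Expr)
  | query (q : Query) (a b c d : Expr)

/-- The value of an expression. -/
def Expr.eval (inp : Input) (s : Store) : Expr → ℕ
  | .const n => n
  | .reg i => s.reg i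
  | .get a i j k => s.arr a (i.eval inp s) (j.eval inp s) (k.eval inp s)
  | .add e f => e.eval inp s + f.eval inp s
  | .sub e f => e.eval inp s - f.eval inp s
  | .lt e f => if e.eval inp s < f.eval inp s then 1 else 0
  | .eq e f => if e.eval inp s = f.eval inp s then 1 else 0
  | .query q a b c d => inp q (a.eval inp s) (b.eval inp s) (c.eval inp s) (d.eval inp s)

/-- The number of steps for evaluating an expression: one per operation. -/
def Expr.cost : Expr → ℕ
  | .const _ => 1
  | .reg _ => 1
  | .get _ i j k => 1 + i.cost + j.cost + k.cost
  | .add e f => 1 + e.cost + f.cost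
  | .sub e f => 1 + e.cost + f.cost
  | .lt e f => 1 + e.cost + f.cost
  | .eq e f => 1 + e.cost + f.cost
  | .query _ a b c d => 1 + a.cost + b.cost + c.cost + d.cost

/-- Programs. -/
inductive Prog : Type
  | skip
  | assign (i : ℕ) (e : Expr)
  | store (a : ℕ) (i j k e : Expr)
  | seq (p q : Prog)
  | ite (e : Expr) (p q : Prog)
  | while (e : Expr) (p : Prog)

/-- `Exec inp p s n s'`: on the input `inp`, the program `p` started in `s` halts in `s'` after
exactly `n` steps. -/
inductive Exec (inp : Input) : Prog → Store → ℕ → Store → Prop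
  | skip (s : Store) : Exec inp .skip s 1 s
  | assign (i : ℕ) (e : Expr) (s : Store) :
      Exec inp (.assign i e) s (1 + e.cost) (s.setReg i (e.eval inp s))
  | store (a : ℕ) (i j k e : Expr) (s : Store) :
      Exec inp (.store a i j k e) s (1 + i.cost + j.cost + k.cost + e.cost)
        (s.setArr a (i.eval inp s) (j.eval inp s) (k.eval inp s) (e.eval inp s))
  | seq {p q : Prog} {s s' s'' : Store} {n n' : ℕ} :
      Exec inp p s n s' → Exec inp q s' n' s'' → Exec inp (.seq p q) s (n + n') s''
  | iteTrue {e : Expr} {p q : Prog} {s s' : Store} {n : ℕ} :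
      e.eval inp s ≠ 0 → Exec inp p s n s' → Exec inp (.ite e p q) s (1 + e.cost + n) s'
  | iteFalse {e : Expr} {p q : Prog} {s s' : Store} {n : ℕ} :
      e.eval inp s = 0 → Exec inp q s n s' → Exec inp (.ite e p q) s (1 + e.cost + n) s'
  | whileStop {e : Expr} {p : Prog} {s : Store} :
      e.eval inp s = 0 → Exec inp (.while e p) s (1 + e.cost) s
  | whileStep {e : Expr} {p : Prog} {s s' s'' : Store} {n n' : ℕ} :
      e.eval inp s ≠ 0 → Exec inp p s n s' → Exec inp (.while e p) s' n' s'' →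
      Exec inp (.while e p) s (1 + e.cost + n + n') s''

end SqlIso

namespace SqlIso

open Relation

/-! ## Runs of programs with a bounded number of steps -/

/-! The first half rests on one observation: a visibility relation that does not mention `co` means
the same for every `co` (`visible_congr`). So the pairs that the axioms force into a commit order
can be computed beforehand from `(so ∪ wr)⁺`, and a single round of saturation finds all of them. A
commit order that satisfies the axioms is then nothing but a strict total order containing the fixed
relation `pco`, and one exists exactly when `pco` is acyclic, because an acyclic relation extends to
a linear order (`Acyclic.exists_linear`). This is `consistent_iff_checkSaturable`.

The second half evaluates this criterion by a program. Instead of one explicit program with one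
explicit analysis there is a calculus of functions `f` that are computable in polynomial time in a
context (`Comp c f`). The program is required for every placement of the variables and arrays and
must leave the memory in use intact, so programs can be nested freely. The values of `f` must be
polynomially bounded as well, since they serve as loop bounds. The central closure property is
recursion along a table (`Comp.tab`): a table is computable if each entry is computable from the
entries with smaller first index. It yields bounded sums, hence products, quantifiers, division and
powers, and by Warshall's algorithm transitive closures (`CompP.transGen`). The criterion is then
rebuilt clause by clause from these operations.

Three ingredients are not just formulas over the queries. First, the value of a write is defined by
recursion along chains of `wr`; but every event that is read from has a value, so one step along
`wr` decides whether a value exists (`PreHistory.exists_hasValue_iff`). Second, relation expressions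
and constraints belong to the input and may be nested to any depth. They are interpreted from their
postfix codes by a table whose first index is a position in the code. The last argument of an
operator at position `l` ends at `l - 1`, and the first argument of a binary one ends at `l - 1`
minus the length of the last (`Rel.sub_spec`, `WrCons.sub_spec`). Third, the quantifiers inside a
visibility relation are eliminated by running through all `(nT + nE) ^ (m + 2)` paths and all `nK ^
(q + 1)` tuples of keys. These numbers are polynomial because `3 + m + q ≤ k`. The bound `k` enters
only there (`CompVis.polyBdd_pow`); it affects the polynomials and never the program, which is why
`PolyBdd` asks for a polynomial for each `k` separately. -/

/-- The program `P` started in `s` halts after at most `t` steps in a state that satisfies `Q`. -/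
def Runs (inp : Input) (P : Prog) (s : Store) (t : ℕ) (Q : Store → Prop) : Prop :=
  ∃ n s', Exec inp P s n s' ∧ n ≤ t ∧ Q s'

namespace Runs

variable {inp : Input} {P P' : Prog} {s : Store} {t t' : ℕ} {Q Q' : Store → Prop}

theorem mono (h : Runs inp P s t Q) (ht : t ≤ t') (hQ : ∀ s', Q s' → Q' s') :
    Runs inp P s t' Q' := by
  obtain ⟨n, s', he, hn, hq⟩ := h
  exact ⟨n, s', he, hn.trans ht, hQ s' hq⟩

theorem seq (h : Runs inp P s t Q) (h' : ∀ s', Q s' → Runs inp P' s' t' Q') :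
    Runs inp (.seq P P') s (t + t') Q' := by
  obtain ⟨n, s', he, hn, hq⟩ := h
  obtain ⟨n', s'', he', hn', hq'⟩ := h' s' hq
  exact ⟨n + n', s'', .seq he he', add_le_add hn hn', hq'⟩

theorem assign {i : ℕ} {e : Expr} (h : Q (s.setReg i (e.eval inp s))) :
    Runs inp (.assign i e) s (1 + e.cost) Q :=
  ⟨_, _, .assign i e s, le_rfl, h⟩

theorem store {a : ℕ} {i j k e : Expr}
    (h : Q (s.setArr a (i.eval inp s) (j.eval inp s) (k.eval inp s) (e.eval inp s))) :
    Runs inp (.store a i j k e) s (1 + i.cost + j.cost + k.cost + e.cost) Q :=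
  ⟨_, _, .store a i j k e s, le_rfl, h⟩

theorem ite {e : Expr} (h : e.eval inp s ≠ 0 → Runs inp P s t Q)
    (h' : e.eval inp s = 0 → Runs inp P' s t' Q) :
    Runs inp (.ite e P P') s (1 + e.cost + t + t') Q := by
  by_cases he : e.eval inp s = 0
  · obtain ⟨n, s', hx, hn, hq⟩ := h' he
    exact ⟨_, s', .iteFalse he hx, by omega, hq⟩
  · obtain ⟨n, s', hx, hn, hq⟩ := h he
    exact ⟨_, s', .iteTrue he hx, by omega, hq⟩

end Runs

/-- `for r < b do P`, where the registers `r` and `b` hold the counter and the bound. -/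
def forLoop (r b : ℕ) (P : Prog) : Prog :=
  .seq (.assign r (.const 0))
    (.while (.lt (.reg r) (.reg b)) (.seq P (.assign r (.add (.reg r) (.const 1)))))

/-- `I i` is the invariant at the head of the loop with counter `i`, and the induction is on the
number `d` of rounds that remain. A round costs 4 for the test and 4 for the increment besides the
body, and the failing test at the end costs 4. -/
theorem Runs.while_lt {inp : Input} {P : Prog} {r b N t : ℕ} (I : ℕ → Store → Prop)
    (hI : ∀ i s, I i s → s.reg r = i ∧ s.reg b = N)
    (hP : ∀ i < N, ∀ s, I i s →
      Runs inp P s t fun s' => s'.reg r = i ∧ I (i + 1) (s'.setReg r (i + 1))) :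
    ∀ d i s, i + d = N → I i s →
      Runs inp (.while (.lt (.reg r) (.reg b)) (.seq P (.assign r (.add (.reg r) (.const 1)))))
        s (d * (t + 8) + 4) (I N) := by
  intro d
  induction d with
  | zero =>
    intro i s hi hs
    obtain ⟨hr, hb⟩ := hI i s hs
    refine ⟨_, s, .whileStop ?_, ?_, ?_⟩
    · simp [Expr.eval, hr, hb]; omega
    · simp [Expr.cost]
    · rwa [← hi]
  | succ d ih =>
    intro i s hi hs
    obtain ⟨hr, hb⟩ := hI i s hs
    obtain ⟨n, s₁, he, hn, hr₁, hs₁⟩ := hP i (by omega) s hs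
    obtain ⟨n', s₂, he', hn', hs₂⟩ := ih (i + 1) _ (by omega) hs₁
    have he₁ : Exec inp (.assign r (.add (.reg r) (.const 1))) s₁ 4 (s₁.setReg r (i + 1)) := by
      have := Exec.assign (inp := inp) r (.add (.reg r) (.const 1)) s₁
      simpa [Expr.eval, Expr.cost, hr₁] using this
    refine ⟨_, s₂, .whileStep ?_ (.seq he he₁) he', ?_, hs₂⟩
    · simp [Expr.eval, hr, hb]; omega
    · simp only [Expr.cost]
      rw [Nat.succ_mul]
      omega

theorem Runs.forLoop {inp : Input} {P : Prog} {s : Store} {r b N t : ℕ} (I : ℕ → Store → Prop)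
    (hI : ∀ i s, I i s → s.reg r = i ∧ s.reg b = N) (h0 : I 0 (s.setReg r 0))
    (hP : ∀ i < N, ∀ s, I i s →
      Runs inp P s t fun s' => s'.reg r = i ∧ I (i + 1) (s'.setReg r (i + 1))) :
    Runs inp (forLoop r b P) s (N * (t + 8) + 6) (I N) := by
  refine (Runs.seq (Q := I 0) (.assign h0)
    fun s' hs' => Runs.while_lt I hI hP N 0 s' (by simp) hs').mono ?_ fun _ h => h
  -- Setting the counter to zero costs 2, which turns the 4 of the bare loop into 6.
  simp only [Expr.cost]; omega

/-- Two memories agree on the registers below `n` and the arrays below `m`. -/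
structure Store.Agree (n m : ℕ) (s s' : Store) : Prop where
  reg : ∀ i < n, s'.reg i = s.reg i
  arr : ∀ a < m, s'.arr a = s.arr a

namespace Store

variable {n n' m m' : ℕ} {s s' s'' : Store}

theorem Agree.refl (n m : ℕ) (s : Store) : Agree n m s s := ⟨fun _ _ => rfl, fun _ _ => rfl⟩

theorem Agree.trans (h : Agree n m s s') (h' : Agree n m s' s'') : Agree n m s s'' :=
  ⟨fun i hi => (h'.reg i hi).trans (h.reg i hi), fun a ha => (h'.arr a ha).trans (h.arr a ha)⟩

theorem Agree.mono (h : Agree n m s s') (hn : n' ≤ n) (hm : m' ≤ m) : Agree n' m' s s' :=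
  ⟨fun i hi => h.reg i (by omega), fun a ha => h.arr a (by omega)⟩

theorem Agree.setReg (h : Agree n m s s') {i : ℕ} (hi : n ≤ i) (v : ℕ) :
    Agree n m s (s'.setReg i v) :=
  ⟨fun j hj => by rw [← h.reg j hj]; exact if_neg (by omega), fun a ha => h.arr a ha⟩

theorem Agree.setArr (h : Agree n m s s') {a : ℕ} (ha : m ≤ a) (i j k v : ℕ) :
    Agree n m s (s'.setArr a i j k v) :=
  ⟨fun j hj => h.reg j hj, fun b hb => by
    rw [← h.arr b hb]; funext i' j' k'; exact if_neg (by omega)⟩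

@[simp] theorem setReg_reg (i v : ℕ) : (s.setReg i v).reg i = v := if_pos rfl

theorem setReg_reg_of_ne {i j : ℕ} (h : j ≠ i) (v : ℕ) : (s.setReg i v).reg j = s.reg j :=
  if_neg h

@[simp] theorem setReg_arr (i v : ℕ) : (s.setReg i v).arr = s.arr := rfl

@[simp] theorem setArr_reg (a i j k v : ℕ) : (s.setArr a i j k v).reg = s.reg := rfl

end Store

/-! ## Contexts -/

/-- A context describes what a program may use: the objects of type `Γ` with `ok` are the possible
situations, `hist` is the input history, `var` lists numbers that are held in registers, and `arr`
describes the contents of arrays. -/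
structure Ctx (Γ : Type (u + 1)) where
  hist : Γ → PreHistory.{u}
  ok : Γ → Prop
  ι : Type
  var : ι → Γ → ℕ
  κ : Type
  arr : κ → Γ → (ℕ → ℕ → ℕ → ℕ) → Prop

/-- The memory holds the variables and arrays of the context in the registers `ρ` and the arrays
`σ`. -/
def Ctx.Rep {Γ : Type (u + 1)} (c : Ctx Γ) (ρ : c.ι → ℕ) (σ : c.κ → ℕ) (γ : Γ) (s : Store) : Prop :=
  (∀ i, s.reg (ρ i) = c.var i γ) ∧ ∀ a, c.arr a γ (s.arr (σ a))

theorem Ctx.Rep.of_agree {Γ : Type (u + 1)} {c : Ctx Γ} {ρ : c.ι → ℕ} {σ : c.κ → ℕ} {γ : Γ}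
    {s s' : Store} {n m : ℕ} (h : c.Rep ρ σ γ s) (hρ : ∀ i, ρ i < n) (hσ : ∀ a, σ a < m)
    (ha : Store.Agree n m s s') : c.Rep ρ σ γ s' :=
  ⟨fun i => (ha.reg _ (hρ i)).trans (h.1 i), fun a => by rw [ha.arr _ (hσ a)]; exact h.2 a⟩

/-- The context in which `p` is known to hold. -/
def Ctx.restrict {Γ : Type (u + 1)} (c : Ctx Γ) (p : Γ → Prop) : Ctx Γ :=
  { c with ok := fun γ => c.ok γ ∧ p γ }

/-- For every `k`, the function is polynomially bounded in the size of the history, for histories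
that are bounded by `k`. -/
def PolyBdd {Γ : Type (u + 1)} (c : Ctx Γ) (f : Γ → ℕ) : Prop :=
  ∀ k, ∃ p : Polynomial ℕ, ∀ γ, c.ok γ → (c.hist γ).Bounded k → f γ ≤ p.eval (c.hist γ).size

namespace PolyBdd

variable {Γ : Type (u + 1)} {c : Ctx Γ} {f g : Γ → ℕ}

theorem mono (hg : PolyBdd c g) (h : ∀ γ, c.ok γ → f γ ≤ g γ) : PolyBdd c f := fun k => by
  obtain ⟨p, hp⟩ := hg k
  exact ⟨p, fun γ h1 h2 => (h γ h1).trans (hp γ h1 h2)⟩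

theorem const (a : ℕ) : PolyBdd c fun _ => a := fun _ =>
  ⟨Polynomial.C a, fun γ _ _ => by simp⟩

theorem size : PolyBdd c fun γ => (c.hist γ).size := fun _ =>
  ⟨Polynomial.X, fun γ _ _ => by simp⟩

theorem add (hf : PolyBdd c f) (hg : PolyBdd c g) : PolyBdd c fun γ => f γ + g γ := fun k => by
  obtain ⟨p, hp⟩ := hf k
  obtain ⟨q, hq⟩ := hg k
  exact ⟨p + q, fun γ h1 h2 => by
    rw [Polynomial.eval_add]; exact add_le_add (hp γ h1 h2) (hq γ h1 h2)⟩

theorem mul (hf : PolyBdd c f) (hg : PolyBdd c g) : PolyBdd c fun γ => f γ * g γ := fun k => by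
  obtain ⟨p, hp⟩ := hf k
  obtain ⟨q, hq⟩ := hg k
  exact ⟨p * q, fun γ h1 h2 => by
    rw [Polynomial.eval_mul]; exact Nat.mul_le_mul (hp γ h1 h2) (hq γ h1 h2)⟩

theorem of_le (hle : ∀ γ, c.ok γ → f γ ≤ (c.hist γ).size) : PolyBdd c f := size.mono hle

theorem of_le_const (a : ℕ) (hle : ∀ γ, c.ok γ → f γ ≤ a) : PolyBdd c f := (const a).mono hle

end PolyBdd

/-! ## Functions computable in polynomial time -/

/-- The function `f` can be computed in polynomial time in the context `c`: wherever the variables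
and arrays are held, there is a program that leaves the value of `f` in the first free register and
does not change the memory that is in use. -/
structure Comp {Γ : Type (u + 1)} (c : Ctx Γ) (f : Γ → ℕ) : Prop where
  bdd : PolyBdd c f
  prog : ∀ (n m : ℕ) (ρ : c.ι → ℕ) (σ : c.κ → ℕ), (∀ i, ρ i < n) → (∀ a, σ a < m) →
    ∃ (P : Prog) (t : Γ → ℕ), PolyBdd c t ∧ ∀ γ s, c.ok γ → c.Rep ρ σ γ s →
      Runs (c.hist γ).query P s (t γ) fun s' => s'.reg n = f γ ∧ Store.Agree n m s s'

/-- The predicate `p` can be decided in polynomial time. -/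
def CompP {Γ : Type (u + 1)} (c : Ctx Γ) (p : Γ → Prop) : Prop := Comp c fun γ => truth (p γ)

theorem truth_le_one (p : Prop) : truth p ≤ 1 := by
  unfold truth; split_ifs <;> simp

@[simp] theorem truth_eq_zero {p : Prop} : truth p = 0 ↔ ¬ p := by
  unfold truth; split_ifs <;> simp_all

@[simp] theorem truth_pos {p : Prop} : 0 < truth p ↔ p := by
  unfold truth; split_ifs <;> simp_all

theorem truth_eq_ite (p : Prop) [Decidable p] : truth p = if p then 1 else 0 := by
  unfold truth; split_ifs <;> rfl

namespace Comp

variable {Γ Γ' : Type (u + 1)} {c : Ctx Γ} {f g f₁ f₂ f₃ f₄ : Γ → ℕ}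

theorem congr (hf : Comp c f) (h : ∀ γ, c.ok γ → g γ = f γ) : Comp c g where
  bdd := hf.bdd.mono fun γ hγ => (h γ hγ).le
  prog n m ρ σ hρ hσ := by
    obtain ⟨P, t, ht, hP⟩ := hf.prog n m ρ σ hρ hσ
    exact ⟨P, t, ht, fun γ s hγ hs => (hP γ s hγ hs).mono le_rfl fun s' h' =>
      ⟨h'.1.trans (h γ hγ).symm, h'.2⟩⟩

theorem of_expr {n m : ℕ} {c : Ctx Γ} {ρ : c.ι → ℕ} {σ : c.κ → ℕ} (e : Expr)
    (he : ∀ γ s, c.ok γ → c.Rep ρ σ γ s → e.eval (c.hist γ).query s = f γ) :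
    ∃ (P : Prog) (t : Γ → ℕ), PolyBdd c t ∧ ∀ γ s, c.ok γ → c.Rep ρ σ γ s →
      Runs (c.hist γ).query P s (t γ) fun s' => s'.reg n = f γ ∧ Store.Agree n m s s' :=
  ⟨.assign n e, fun _ => 1 + e.cost, .const _, fun γ s hγ hs =>
    .assign ⟨by simp [he γ s hγ hs], (Store.Agree.refl n m s).setReg le_rfl _⟩⟩

theorem const (a : ℕ) : Comp c fun _ => a where
  bdd := .const a
  prog _ _ _ _ _ _ := of_expr (.const a) fun _ _ _ _ => rfl

theorem var (i : c.ι) (h : PolyBdd c (c.var i)) : Comp c (c.var i) where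
  bdd := h
  prog _ _ ρ _ _ _ := of_expr (.reg (ρ i)) fun _ _ _ hs => hs.1 i

/-- Computations can be moved to a context that provides more. -/
theorem comap {c' : Ctx Γ'} (π : Γ' → Γ) (hf : Comp c f)
    (hhist : ∀ γ, c.hist (π γ) = c'.hist γ) (hok : ∀ γ, c'.ok γ → c.ok (π γ))
    (e : c.ι → c'.ι) (hvar : ∀ i γ, c'.ok γ → c'.var (e i) γ = c.var i (π γ))
    (d : c.κ → c'.κ) (harr : ∀ a γ A, c'.ok γ → c'.arr (d a) γ A → c.arr a (π γ) A) :
    Comp c' fun γ => f (π γ) := by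
  have hbdd : ∀ g : Γ → ℕ, PolyBdd c g → PolyBdd c' fun γ => g (π γ) := fun g hg k => by
    obtain ⟨p, hp⟩ := hg k
    exact ⟨p, fun γ h1 h2 => by
      have := hp (π γ) (hok γ h1) (by rwa [hhist]); rwa [hhist] at this⟩
  refine ⟨hbdd f hf.bdd, fun n m ρ σ hρ hσ => ?_⟩
  obtain ⟨P, t, ht, hP⟩ := hf.prog n m (fun i => ρ (e i)) (fun a => σ (d a))
    (fun i => hρ _) (fun a => hσ _)
  refine ⟨P, fun γ => t (π γ), hbdd t ht, fun γ s hγ hs => ?_⟩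
  have := hP (π γ) s (hok γ hγ)
    ⟨fun i => (hs.1 (e i)).trans (hvar i γ hγ), fun a => harr a γ _ hγ (hs.2 (d a))⟩
  rwa [hhist] at this

/-- The value of `f` stays in register `n` while `g` is computed with `n + 1` as its first free
register; one instruction then combines the two. -/
theorem binary (op : Expr → Expr → Expr) (φ : ℕ → ℕ → ℕ)
    (heval : ∀ inp s e e', (op e e').eval inp s = φ (e.eval inp s) (e'.eval inp s))
    (hf : Comp c f) (hg : Comp c g) (hφ : PolyBdd c fun γ => φ (f γ) (g γ)) :
    Comp c fun γ => φ (f γ) (g γ) where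
  bdd := hφ
  prog n m ρ σ hρ hσ := by
    obtain ⟨P, t, ht, hP⟩ := hf.prog n m ρ σ hρ hσ
    obtain ⟨P', t', ht', hP'⟩ := hg.prog (n + 1) m ρ σ (fun i => (hρ i).trans (by omega)) hσ
    refine ⟨.seq P (.seq P' (.assign n (op (.reg n) (.reg (n + 1))))),
      fun γ => t γ + (t' γ + (1 + (op (.reg n) (.reg (n + 1))).cost)),
      ht.add (ht'.add (.const _)), fun γ s hγ hs => ?_⟩
    refine (hP γ s hγ hs).seq fun s₁ h₁ => ?_
    refine (hP' γ s₁ hγ (hs.of_agree hρ hσ h₁.2)).seq fun s₂ h₂ => .assign ?_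
    refine ⟨?_, (h₁.2.trans (h₂.2.mono (by omega) le_rfl)).setReg le_rfl _⟩
    simp [heval, Expr.eval, h₂.1, h₂.2.reg n (by omega), h₁.1]

theorem add (hf : Comp c f) (hg : Comp c g) : Comp c fun γ => f γ + g γ :=
  binary .add (· + ·) (fun _ _ _ _ => rfl) hf hg (hf.bdd.add hg.bdd)

theorem sub (hf : Comp c f) (hg : Comp c g) : Comp c fun γ => f γ - g γ :=
  binary .sub (· - ·) (fun _ _ _ _ => rfl) hf hg (hf.bdd.mono fun _ _ => Nat.sub_le _ _)

theorem lt (hf : Comp c f) (hg : Comp c g) : CompP c fun γ => f γ < g γ := by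
  refine (binary .lt (fun a b => if a < b then 1 else 0) (fun _ _ _ _ => rfl) hf hg
    (.of_le_const 1 fun γ _ => ?_)).congr fun γ _ => truth_eq_ite _
  split_ifs <;> simp

theorem eq (hf : Comp c f) (hg : Comp c g) : CompP c fun γ => f γ = g γ := by
  refine (binary .eq (fun a b => if a = b then 1 else 0) (fun _ _ _ _ => rfl) hf hg
    (.of_le_const 1 fun γ _ => ?_)).congr fun γ _ => truth_eq_ite _
  split_ifs <;> simp

theorem query (q : Query) (h₁ : Comp c f₁) (h₂ : Comp c f₂) (h₃ : Comp c f₃) (h₄ : Comp c f₄)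
    (hq : PolyBdd c fun γ => (c.hist γ).query q (f₁ γ) (f₂ γ) (f₃ γ) (f₄ γ)) :
    Comp c fun γ => (c.hist γ).query q (f₁ γ) (f₂ γ) (f₃ γ) (f₄ γ) where
  bdd := hq
  prog n m ρ σ hρ hσ := by
    have hρ' : ∀ d i, ρ i < n + d := fun d i => (hρ i).trans_le (by omega)
    obtain ⟨P₁, t₁, ht₁, hP₁⟩ := h₁.prog n m ρ σ hρ hσ
    obtain ⟨P₂, t₂, ht₂, hP₂⟩ := h₂.prog (n + 1) m ρ σ (hρ' 1) hσ
    obtain ⟨P₃, t₃, ht₃, hP₃⟩ := h₃.prog (n + 2) m ρ σ (hρ' 2) hσ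
    obtain ⟨P₄, t₄, ht₄, hP₄⟩ := h₄.prog (n + 3) m ρ σ (hρ' 3) hσ
    let e : Expr := .query q (.reg n) (.reg (n + 1)) (.reg (n + 2)) (.reg (n + 3))
    refine ⟨.seq P₁ (.seq P₂ (.seq P₃ (.seq P₄ (.assign n e)))),
      fun γ => t₁ γ + (t₂ γ + (t₃ γ + (t₄ γ + (1 + e.cost)))),
      ht₁.add (ht₂.add (ht₃.add (ht₄.add (.const _)))), fun γ s hγ hs => ?_⟩
    refine (hP₁ γ s hγ hs).seq fun s₁ a₁ => ?_
    have hs₁ := hs.of_agree hρ hσ a₁.2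
    refine (hP₂ γ s₁ hγ hs₁).seq fun s₂ a₂ => ?_
    have hs₂ := hs₁.of_agree (hρ' 1) hσ a₂.2
    refine (hP₃ γ s₂ hγ hs₂).seq fun s₃ a₃ => ?_
    have hs₃ := hs₂.of_agree (hρ' 2) hσ a₃.2
    refine (hP₄ γ s₃ hγ hs₃).seq fun s₄ a₄ => .assign ?_
    refine ⟨?_, (((a₁.2.trans (a₂.2.mono (by omega) le_rfl)).trans
      (a₃.2.mono (by omega) le_rfl)).trans (a₄.2.mono (by omega) le_rfl)).setReg le_rfl _⟩
    simp only [e, Store.setReg_reg, Expr.eval]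
    rw [a₄.1, a₄.2.reg (n + 2) (by omega), a₃.1, a₄.2.reg (n + 1) (by omega),
      a₃.2.reg (n + 1) (by omega), a₂.1, a₄.2.reg n (by omega), a₃.2.reg n (by omega),
      a₂.2.reg n (by omega), a₁.1]

/-- A case distinction; each branch may use the case hypothesis. -/
theorem ite_restrict {p : Γ → Prop} [∀ γ, Decidable (p γ)] (hp : CompP c p)
    (hf : Comp (c.restrict p) f) (hg : Comp (c.restrict fun γ => ¬ p γ) g) :
    Comp c fun γ => if p γ then f γ else g γ := by
  have hbdd : ∀ u v : Γ → ℕ, PolyBdd (c.restrict p) u → PolyBdd (c.restrict fun γ => ¬ p γ) v →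
      PolyBdd c fun γ => if p γ then u γ else v γ := fun u v hu hv k => by
    obtain ⟨a, ha⟩ := hu k
    obtain ⟨b, hb⟩ := hv k
    refine ⟨a + b, fun γ h1 h2 => ?_⟩
    rw [Polynomial.eval_add]
    beta_reduce
    split_ifs with h
    · exact (ha γ ⟨h1, h⟩ h2).trans (Nat.le_add_right _ _)
    · exact (hb γ ⟨h1, h⟩ h2).trans (Nat.le_add_left _ _)
  refine ⟨hbdd f g hf.bdd hg.bdd, fun n m ρ σ hρ hσ => ?_⟩
  obtain ⟨P, t, ht, hP⟩ := hp.prog n m ρ σ hρ hσ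
  obtain ⟨P₁, t₁, ht₁, hP₁⟩ := hf.prog n m ρ σ hρ hσ
  obtain ⟨P₂, t₂, ht₂, hP₂⟩ := hg.prog n m ρ σ hρ hσ
  refine ⟨.seq P (.ite (.reg n) P₁ P₂),
    -- The bound on `t₁` is known only where `p` holds, and that on `t₂` only where it fails. As
    -- `Runs.ite` charges for both branches, the branch not taken is given time 0.
    fun γ => t γ + (1 + 1 + (if p γ then t₁ γ else 0) + (if p γ then 0 else t₂ γ)),
    ht.add (((PolyBdd.const _).add (hbdd _ _ ht₁ (.const 0))).add (hbdd _ _ (.const 0) ht₂)),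
    fun γ s hγ hs => ?_⟩
  refine (hP γ s hγ hs).seq fun s₁ h₁ => ?_
  have hs₁ := hs.of_agree hρ hσ h₁.2
  refine Runs.ite (fun he => ?_) fun he => ?_
  · have he' : p γ := by simpa [Expr.eval, h₁.1] using he
    rw [if_pos he', if_pos he']
    exact (hP₁ γ s₁ ⟨hγ, he'⟩ hs₁).mono le_rfl fun s₂ h₂ => ⟨h₂.1, h₁.2.trans h₂.2⟩
  · have he' : ¬ p γ := by simpa [Expr.eval, h₁.1] using he
    rw [if_neg he', if_neg he']
    exact (hP₂ γ s₁ ⟨hγ, he'⟩ hs₁).mono le_rfl fun s₂ h₂ => ⟨h₂.1, h₁.2.trans h₂.2⟩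

theorem restrict (hf : Comp c f) (p : Γ → Prop) : Comp (c.restrict p) f :=
  hf.comap id (fun _ => rfl) (fun _ h => h.1) id (fun _ _ _ => rfl) id fun _ _ _ _ h => h

theorem ite {p : Γ → Prop} [∀ γ, Decidable (p γ)] (hp : CompP c p) (hf : Comp c f)
    (hg : Comp c g) : Comp c fun γ => if p γ then f γ else g γ :=
  ite_restrict hp (hf.restrict _) (hg.restrict _)

/-- Reading an array, with a guard that ensures that the entry has been written. -/
theorem get (a : c.κ) {i j k : Γ → ℕ} {p : Γ → Prop} [∀ γ, Decidable (p γ)] (hp : CompP c p)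
    (hi : Comp c i) (hj : Comp c j) (hk : Comp c k) (hf : PolyBdd (c.restrict p) f)
    (h : ∀ γ X, c.ok γ → p γ → c.arr a γ X → X (i γ) (j γ) (k γ) = f γ) :
    Comp c fun γ => if p γ then f γ else 0 := by
  refine ite_restrict hp ⟨hf, fun n m ρ σ hρ hσ => ?_⟩ (.const 0)
  have hρ' : ∀ d i, ρ i < n + d := fun d i => (hρ i).trans_le (by omega)
  obtain ⟨P₁, t₁, ht₁, hP₁⟩ := (hi.restrict p).prog n m ρ σ hρ hσ
  obtain ⟨P₂, t₂, ht₂, hP₂⟩ := (hj.restrict p).prog (n + 1) m ρ σ (hρ' 1) hσ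
  obtain ⟨P₃, t₃, ht₃, hP₃⟩ := (hk.restrict p).prog (n + 2) m ρ σ (hρ' 2) hσ
  let e : Expr := .get (σ a) (.reg n) (.reg (n + 1)) (.reg (n + 2))
  refine ⟨.seq P₁ (.seq P₂ (.seq P₃ (.assign n e))),
    fun γ => t₁ γ + (t₂ γ + (t₃ γ + (1 + e.cost))),
    ht₁.add (ht₂.add (ht₃.add (.const _))), fun γ s hγ hs => ?_⟩
  refine (hP₁ γ s hγ hs).seq fun s₁ a₁ => ?_
  have hs₁ := hs.of_agree hρ hσ a₁.2
  refine (hP₂ γ s₁ hγ hs₁).seq fun s₂ a₂ => ?_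
  have hs₂ := hs₁.of_agree (hρ' 1) hσ a₂.2
  refine (hP₃ γ s₂ hγ hs₂).seq fun s₃ a₃ => .assign ?_
  have hs₃ := hs₂.of_agree (hρ' 2) hσ a₃.2
  refine ⟨?_, ((a₁.2.trans (a₂.2.mono (by omega) le_rfl)).trans
    (a₃.2.mono (by omega) le_rfl)).setReg le_rfl _⟩
  simp only [e, Store.setReg_reg, Expr.eval]
  rw [a₃.1, a₃.2.reg (n + 1) (by omega), a₂.1, a₃.2.reg n (by omega), a₂.2.reg n (by omega), a₁.1]
  exact h γ _ hγ.1 hγ.2 (hs₃.2 a)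

end Comp

namespace CompP

variable {Γ : Type (u + 1)} {c : Ctx Γ} {p q : Γ → Prop}

theorem congr (hp : CompP c p) (h : ∀ γ, c.ok γ → (q γ ↔ p γ)) : CompP c q :=
  Comp.congr hp fun γ hγ => by rw [propext (h γ hγ)]

theorem not (hp : CompP c p) : CompP c fun γ => ¬ p γ :=
  (Comp.eq hp (.const 0)).congr fun γ _ => by simp

theorem or (hp : CompP c p) (hq : CompP c q) : CompP c fun γ => p γ ∨ q γ :=
  (Comp.lt (.const 0) (Comp.add hp hq)).congr fun γ _ => by
    rw [Nat.add_pos_iff_pos_or_pos]; simp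

theorem and (hp : CompP c p) (hq : CompP c q) : CompP c fun γ => p γ ∧ q γ :=
  (hp.not.or hq.not).not.congr fun γ _ => by tauto

theorem get (a : c.κ) {i j k : Γ → ℕ} (hp : CompP c p) (hi : Comp c i) (hj : Comp c j)
    (hk : Comp c k)
    (h : ∀ γ X, c.ok γ → p γ → c.arr a γ X → X (i γ) (j γ) (k γ) = truth (q γ)) :
    CompP c fun γ => p γ ∧ q γ := by
  classical
  refine (Comp.get a hp hi hj hk (.of_le_const 1 fun γ _ => truth_le_one (q γ)) h).congr
    fun γ _ => ?_
  by_cases h : p γ <;> simp [h]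

end CompP

/-! ## Binding variables and tables -/

section

variable {Γ : Type (u + 1)}

/-- The context extended by a variable below `b`. -/
def Ctx.ext (c : Ctx Γ) (b : Γ → ℕ) : Ctx (Σ γ, Fin (b γ)) where
  hist p := c.hist p.1
  ok p := c.ok p.1
  ι := Option c.ι
  var i p := i.elim (p.2 : ℕ) fun i => c.var i p.1
  κ := c.κ
  arr a p := c.arr a p.1

/-- The context for filling a table `T` of dimensions `A`, `B` and `C`: extended by the indices of
an entry, and by an array that holds the entries with smaller first index. -/
def Ctx.tab (c : Ctx Γ) (A B C : Γ → ℕ) (T : ∀ γ, ℕ → Fin (B γ) → Fin (C γ) → ℕ) :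
    Ctx (Σ γ, Fin (A γ) × Fin (B γ) × Fin (C γ)) where
  hist p := c.hist p.1
  ok p := c.ok p.1
  ι := c.ι ⊕ Fin 3
  var i p := i.elim (fun i => c.var i p.1) ![(p.2.1 : ℕ), p.2.2.1, p.2.2.2]
  κ := Option c.κ
  arr a p X := a.elim
    (∀ i < (p.2.1 : ℕ), ∀ (j : Fin (B p.1)) (k : Fin (C p.1)), X i j k = T p.1 i j k)
    fun a => c.arr a p.1 X

variable {c : Ctx Γ}

/-- The bounding polynomial is evaluated at the size of the history, which does not depend on the
additional data `x`, so it bounds the worst case too. -/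
theorem PolyBdd.sup {X : Γ → Type} [∀ γ, Fintype (X γ)] {c' : Ctx (Σ γ, X γ)}
    {f : (Σ γ, X γ) → ℕ} (hf : PolyBdd c' f) (hhist : ∀ p, c'.hist p = c.hist p.1)
    (hok : ∀ p : Σ γ, X γ, c.ok p.1 → c'.ok p) :
    PolyBdd c fun γ => Finset.univ.sup fun x : X γ => f ⟨γ, x⟩ := fun k => by
  obtain ⟨q, hq⟩ := hf k
  refine ⟨q, fun γ h1 h2 => Finset.sup_le fun x _ => ?_⟩
  have := hq ⟨γ, x⟩ (hok _ h1) (by rwa [hhist])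
  rwa [hhist] at this

/-- The sum is at most `b` times its largest term. -/
theorem PolyBdd.sum {b : Γ → ℕ} {f : (Σ γ, Fin (b γ)) → ℕ} (hb : PolyBdd c b)
    (hf : PolyBdd (c.ext b) f) : PolyBdd c fun γ => ∑ i : Fin (b γ), f ⟨γ, i⟩ := by
  refine (hb.mul (PolyBdd.sup (c := c) hf (fun _ => rfl) fun _ h => h)).mono fun γ _ => ?_
  refine (Finset.sum_le_card_nsmul _ _ (Finset.univ.sup fun i : Fin (b γ) => f ⟨γ, i⟩)
    fun i _ => Finset.le_sup (f := fun i : Fin (b γ) => f ⟨γ, i⟩) (Finset.mem_univ i)).trans ?_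
  simp

theorem PolyBdd.weak {X : Γ → Type} {c' : Ctx (Σ γ, X γ)} {f : Γ → ℕ} (hf : PolyBdd c f)
    (hhist : ∀ p, c'.hist p = c.hist p.1) (hok : ∀ p, c'.ok p → c.ok p.1) :
    PolyBdd c' fun p => f p.1 := fun k => by
  obtain ⟨q, hq⟩ := hf k
  exact ⟨q, fun p h1 h2 => by rw [hhist] at *; exact hq p.1 (hok _ h1) h2⟩

namespace Comp

theorem weak {f : Γ → ℕ} (hf : Comp c f) (b : Γ → ℕ) : Comp (c.ext b) fun p => f p.1 :=
  hf.comap _ (fun _ => rfl) (fun _ h => h) some (fun _ _ _ => rfl) id fun _ _ _ _ h => h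

theorem bound_var {b : Γ → ℕ} (hb : PolyBdd c b) : Comp (c.ext b) fun p => (p.2 : ℕ) :=
  var (c := c.ext b) none
    ((hb.weak (c' := c.ext b) (fun _ => rfl) fun _ h => h).mono fun p _ => p.2.2.le)

/-! ### Tables filled by recursion -/

section tab

variable {A B C : Γ → ℕ} {T : ∀ γ, ℕ → Fin (B γ) → Fin (C γ) → ℕ}

theorem weak_tab {f : Γ → ℕ} (hf : Comp c f) : Comp (c.tab A B C T) fun p => f p.1 :=
  hf.comap _ (fun _ => rfl) (fun _ h => h) .inl (fun _ _ _ => rfl) some fun _ _ _ _ h => h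

theorem tab_fst (hA : PolyBdd c A) : Comp (c.tab A B C T) fun p => (p.2.1 : ℕ) :=
  var (c := c.tab A B C T) (.inr 0)
    ((hA.weak (c' := c.tab A B C T) (fun _ => rfl) fun _ h => h).mono fun p _ => p.2.1.2.le)

theorem tab_snd (hB : PolyBdd c B) : Comp (c.tab A B C T) fun p => (p.2.2.1 : ℕ) :=
  var (c := c.tab A B C T) (.inr 1)
    ((hB.weak (c' := c.tab A B C T) (fun _ => rfl) fun _ h => h).mono fun p _ => p.2.2.1.2.le)

theorem tab_thd (hC : PolyBdd c C) : Comp (c.tab A B C T) fun p => (p.2.2.2 : ℕ) :=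
  var (c := c.tab A B C T) (.inr 2)
    ((hC.weak (c' := c.tab A B C T) (fun _ => rfl) fun _ h => h).mono fun p _ => p.2.2.2.2.le)

/-- The entries of the table before `(i, j, k)` have been filled in. -/
def Filled {B C : ℕ} (T : ℕ → Fin B → Fin C → ℕ) (i j k : ℕ) (X : ℕ → ℕ → ℕ → ℕ) : Prop :=
  ∀ i' (j' : Fin B) (k' : Fin C), (i' < i ∨ i' = i ∧ ((j' : ℕ) < j ∨ (j' : ℕ) = j ∧ (k' : ℕ) < k)) →
    X i' j' k' = T i' j' k'

/-- The program that fills a table: `P` computes an entry. -/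
def fillProg (n m : ℕ) (P : Prog) : Prog :=
  forLoop n (n + 3) (forLoop (n + 1) (n + 4) (forLoop (n + 2) (n + 5)
    (.seq P (.store m (.reg n) (.reg (n + 1)) (.reg (n + 2)) (.reg (n + 6))))))

/-- The entries are filled in lexicographic order, so all entries with smaller first index are
present when `P` computes entry `(i, j, k)`. Registers `n` to `n + 2` hold the indices, `n + 3` to
`n + 5` the dimensions, and `n + 6` receives the entry. In the time bound, 5 is the cost of the
store; each loop adds 8 per round and 6 in all. -/
theorem _root_.SqlIso.Runs.fillProg {inp : Input} {P : Prog} {n m A B C t : ℕ}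
    {T : ℕ → Fin B → Fin C → ℕ} {s₀ : Store}
    (hP : ∀ (i : Fin A) (j : Fin B) (k : Fin C) s, Store.Agree n m s₀ s → s.reg n = i →
      s.reg (n + 1) = j → s.reg (n + 2) = k →
      (∀ i' < (i : ℕ), ∀ (j' : Fin B) (k' : Fin C), s.arr m i' j' k' = T i' j' k') →
      Runs inp P s t fun s' => s'.reg (n + 6) = T i j k ∧ Store.Agree (n + 6) (m + 1) s s')
    (hA : s₀.reg (n + 3) = A) (hB : s₀.reg (n + 4) = B) (hC : s₀.reg (n + 5) = C) :
    Runs inp (fillProg n m P) s₀ (A * (B * (C * (t + 5 + 8) + 6 + 8) + 6 + 8) + 6) fun s' =>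
      Store.Agree n m s₀ s' ∧ s'.reg (n + 3) = A ∧
        ∀ i < A, ∀ (j : Fin B) (k : Fin C), s'.arr m i j k = T i j k := by
  -- The part of the invariant common to the three loops: the memory in use before is intact, and
  -- the dimensions are still in their registers.
  let Base (s : Store) : Prop := Store.Agree n m s₀ s ∧ s.reg (n + 3) = A ∧ s.reg (n + 4) = B ∧
    s.reg (n + 5) = C
  have hset : ∀ s r v, Base s → n ≤ r → r < n + 3 → Base (s.setReg r v) := fun s r v hs h1 h2 =>
    ⟨hs.1.setReg h1 v, by rw [Store.setReg_reg_of_ne (by omega)]; exact hs.2.1,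
      by rw [Store.setReg_reg_of_ne (by omega)]; exact hs.2.2.1,
      by rw [Store.setReg_reg_of_ne (by omega)]; exact hs.2.2.2⟩
  refine (Runs.forLoop
    (fun i s => (s.reg n = i ∧ s.reg (n + 3) = A) ∧ Base s ∧ Filled T i 0 0 (s.arr m))
    (fun i s hs => hs.1) ?_ ?_).mono le_rfl ?_
  · refine ⟨⟨by simp, ?_⟩, hset _ _ _ ⟨Store.Agree.refl _ _ _, hA, hB, hC⟩ le_rfl (by omega), ?_⟩
    · rwa [Store.setReg_reg_of_ne (by omega)]
    · intro i' j' k' h; omega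
  · rintro i hi s ⟨⟨hsi, hsA⟩, hbase, hfill⟩
    refine (Runs.forLoop (fun j s => (s.reg (n + 1) = j ∧ s.reg (n + 4) = B) ∧ s.reg n = i ∧
      Base s ∧ Filled T i j 0 (s.arr m)) (fun j s hs => hs.1) ?_ ?_).mono le_rfl ?_
    · refine ⟨⟨by simp, ?_⟩, ?_, hset _ _ _ hbase (by omega) (by omega), hfill⟩
      · rw [Store.setReg_reg_of_ne (by omega)]; exact hbase.2.2.1
      · rwa [Store.setReg_reg_of_ne (by omega)]
    · rintro j hj s ⟨⟨hsj, hsB⟩, hsi, hbase, hfill⟩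
      refine (Runs.forLoop (fun k s => (s.reg (n + 2) = k ∧ s.reg (n + 5) = C) ∧ s.reg n = i ∧
        s.reg (n + 1) = j ∧ Base s ∧ Filled T i j k (s.arr m)) (fun j s hs => hs.1)
        ?_ ?_).mono le_rfl ?_
      · refine ⟨⟨by simp, ?_⟩, ?_, ?_, hset _ _ _ hbase (by omega) (by omega), hfill⟩
        · rw [Store.setReg_reg_of_ne (by omega)]; exact hbase.2.2.2
        · rwa [Store.setReg_reg_of_ne (by omega)]
        · rwa [Store.setReg_reg_of_ne (by omega)]
      · rintro k hk s ⟨⟨hsk, hsC⟩, hsi, hsj, hbase, hfill⟩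
        refine ((hP ⟨i, hi⟩ ⟨j, hj⟩ ⟨k, hk⟩ s hbase.1 hsi hsj hsk
          fun i' hi' j' k' => hfill i' j' k' (.inl hi')).seq fun s₁ h₁ => Runs.store ?_).mono
          (t := t + 5) (Nat.le_refl _) fun s' h => h
        have r : ∀ d < 6, s₁.reg (n + d) = s.reg (n + d) := fun d hd => h₁.2.reg _ (by omega)
        simp only [Expr.eval, Store.setArr_reg]
        have r0 : s₁.reg n = i := (r 0 (by omega)).trans hsi
        have r1 : s₁.reg (n + 1) = j := (r 1 (by omega)).trans hsj
        have r2 : s₁.reg (n + 2) = k := (r 2 (by omega)).trans hsk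
        rw [r0, r1, r2, h₁.1]
        have hb₁ : Base (s₁.setArr m i j k (T i ⟨j, hj⟩ ⟨k, hk⟩)) :=
          ⟨(hbase.1.trans (h₁.2.mono (by omega) (by omega))).setArr le_rfl _ _ _ _,
            (r 3 (by omega)).trans hbase.2.1, (r 4 (by omega)).trans hbase.2.2.1,
            (r 5 (by omega)).trans hbase.2.2.2⟩
        refine ⟨rfl, ⟨by simp, ?_⟩, ?_, ?_, hset _ _ _ hb₁ (by omega) (by omega), ?_⟩
        · rw [Store.setReg_reg_of_ne (by omega)]; exact hb₁.2.2.2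
        · rwa [Store.setReg_reg_of_ne (by omega)]
        · rwa [Store.setReg_reg_of_ne (by omega)]
        · intro i' j' k' h
          have ham : s₁.arr m = s.arr m := h₁.2.arr m (by omega)
          simp only [Store.setReg_arr, Store.setArr, true_and]
          split_ifs with he
          · obtain ⟨rfl, rfl, rfl⟩ := he; rfl
          · rw [ham]; exact hfill i' j' k' (by omega)
      · rintro s' ⟨⟨h1, h2⟩, h3, h4, hb, hf⟩
        refine ⟨h4, ⟨by simp, ?_⟩, ?_, hset _ _ _ hb (by omega) (by omega), ?_⟩
        · rw [Store.setReg_reg_of_ne (by omega)]; exact hb.2.2.1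
        · rwa [Store.setReg_reg_of_ne (by omega)]
        · intro i' j' k' h
          exact hf i' j' k' (by omega)
    · rintro s' ⟨⟨h1, h2⟩, h3, hb, hf⟩
      refine ⟨h3, ⟨by simp, ?_⟩, hset _ _ _ hb (by omega) (by omega), ?_⟩
      · rw [Store.setReg_reg_of_ne (by omega)]; exact hb.2.1
      · intro i' j' k' h
        exact hf i' j' k' (by omega)
  · rintro s' ⟨-, hb, hf⟩
    exact ⟨hb.1, hb.2.1, fun i hi j k => hf i j k (.inl hi)⟩

/-- Recursion: if every entry of a table can be computed from the entries with smaller first index,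
then the table can be computed. -/
theorem tab (hA : Comp c A) (hB : Comp c B) (hC : Comp c C)
    (hT : Comp (c.tab A B C T) fun p => T p.1 p.2.1 p.2.2.1 p.2.2.2)
    {i : Γ → ℕ} {j : ∀ γ, Fin (B γ)} {k : ∀ γ, Fin (C γ)} (hi : Comp c i)
    (hj : Comp c fun γ => (j γ : ℕ)) (hk : Comp c fun γ => (k γ : ℕ)) :
    Comp c fun γ => if i γ < A γ then T γ (i γ) (j γ) (k γ) else 0 where
  bdd q := by
    obtain ⟨p, hp⟩ := hT.bdd q
    refine ⟨p, fun γ h1 h2 => ?_⟩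
    beta_reduce
    split_ifs with h
    · exact hp ⟨γ, ⟨i γ, h⟩, j γ, k γ⟩ h1 h2
    · exact Nat.zero_le _
  prog n m ρ σ hρ hσ := by
    have hρ' : ∀ d i, ρ i < n + d := fun d i => (hρ i).trans_le (by omega)
    have hσ' : ∀ a, σ a < m + 1 := fun a => (hσ a).trans (by omega)
    obtain ⟨P₁, t₁, ht₁, hP₁⟩ := hA.prog (n + 3) m ρ σ (hρ' 3) hσ
    obtain ⟨P₂, t₂, ht₂, hP₂⟩ := hB.prog (n + 4) m ρ σ (hρ' 4) hσ
    obtain ⟨P₃, t₃, ht₃, hP₃⟩ := hC.prog (n + 5) m ρ σ (hρ' 5) hσ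
    -- Indices and dimensions occupy the registers `n` to `n + 5`, and the table is array `m`. The
    -- program for an entry thus starts at register `n + 6` and array `m + 1`; it finds the three
    -- index variables at `n + x` and the table at `m`.
    obtain ⟨P, t, ht, hP⟩ := hT.prog (n + 6) (m + 1) (Sum.elim ρ fun x => n + x)
      (fun a => a.elim m σ)
      (by rintro (i | x); exacts [hρ' 6 i, by simp only [Sum.elim_inr]; omega])
      (by rintro (_ | a); exacts [Nat.lt_succ_self m, hσ' a])
    obtain ⟨P₄, t₄, ht₄, hP₄⟩ := hi.prog (n + 6) (m + 1) ρ σ (hρ' 6) hσ'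
    obtain ⟨P₅, t₅, ht₅, hP₅⟩ := hj.prog (n + 7) (m + 1) ρ σ (hρ' 7) hσ'
    obtain ⟨P₆, t₆, ht₆, hP₆⟩ := hk.prog (n + 8) (m + 1) ρ σ (hρ' 8) hσ'
    let e : Expr := .get m (.reg (n + 6)) (.reg (n + 7)) (.reg (n + 8))
    -- The loops need one time bound for all entries, so the worst case is taken.
    let tm : Γ → ℕ := fun γ => Finset.univ.sup fun x : Fin (A γ) × Fin (B γ) × Fin (C γ) => t ⟨γ, x⟩
    have htm : PolyBdd c tm := PolyBdd.sup (c := c) ht (fun _ => rfl) fun _ h => h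
    refine ⟨.seq P₁ (.seq P₂ (.seq P₃ (.seq (fillProg n m P) (.seq P₄ (.seq P₅ (.seq P₆
      -- Cells with first index at least `A` have not been filled and may hold anything, so the
      -- answer there is set to 0 explicitly. The other two indices are in range by their types.
      (.ite (.lt (.reg (n + 6)) (.reg (n + 3))) (.assign n e) (.assign n (.const 0))))))))),
      fun γ => t₁ γ + (t₂ γ + (t₃ γ + ((A γ * (B γ * (C γ * (tm γ + 5 + 8) + 6 + 8) + 6 + 8) + 6) +
        (t₄ γ + (t₅ γ + (t₆ γ + (1 + 3 + (1 + 4) + (1 + 4)))))))), ?_, fun γ s hγ hs => ?_⟩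
    · exact ht₁.add (ht₂.add (ht₃.add (((hA.bdd.mul (((hB.bdd.mul (((hC.bdd.mul
        ((htm.add (.const _)).add (.const _))).add (.const _)).add (.const _))).add
        (.const _)).add (.const _))).add (.const _)).add (ht₄.add (ht₅.add (ht₆.add (.const _)))))))
    refine (hP₁ γ s hγ hs).seq fun s₁ a₁ => ?_
    have hs₁ := hs.of_agree (hρ' 3) hσ a₁.2
    refine (hP₂ γ s₁ hγ hs₁).seq fun s₂ a₂ => ?_
    have hs₂ := hs₁.of_agree (hρ' 4) hσ a₂.2
    refine (hP₃ γ s₂ hγ hs₂).seq fun s₃ a₃ => ?_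
    have hs₃ := hs₂.of_agree (hρ' 5) hσ a₃.2
    have g₃ : Store.Agree n m s s₃ := ((a₁.2.mono (by omega) le_rfl).trans
      (a₂.2.mono (by omega) le_rfl)).trans (a₃.2.mono (by omega) le_rfl)
    refine (Runs.fillProg (T := T γ) (t := tm γ) (s₀ := s₃) ?_ ?_ ?_ a₃.1).seq fun s₄ a₄ => ?_
    · intro i j k s' hag hi hj hk harr
      have hs' := hs₃.of_agree hρ hσ hag
      refine (hP ⟨γ, i, j, k⟩ s' hγ ⟨?_, ?_⟩).mono ?_ fun _ h => h
      · rintro (i' | x)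
        · exact hs'.1 i'
        · fin_cases x
          exacts [hi, hj, hk]
      · rintro (_ | a)
        exacts [harr, hs'.2 a]
      · exact Finset.le_sup (f := fun x : Fin (A γ) × Fin (B γ) × Fin (C γ) => t ⟨γ, x⟩)
          (Finset.mem_univ (i, j, k))
    · rw [a₃.2.reg _ (by omega), a₂.2.reg _ (by omega), a₁.1]
    · rw [a₃.2.reg _ (by omega), a₂.1]
    have hs₄ := hs₃.of_agree hρ hσ a₄.1
    refine (hP₄ γ s₄ hγ hs₄).seq fun s₅ a₅ => ?_
    have hs₅ := hs₄.of_agree (hρ' 6) hσ' a₅.2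
    refine (hP₅ γ s₅ hγ hs₅).seq fun s₆ a₆ => ?_
    have hs₆ := hs₅.of_agree (hρ' 7) hσ' a₆.2
    refine (hP₆ γ s₆ hγ hs₆).seq fun s₇ a₇ => ?_
    have g₇ : Store.Agree n m s s₇ := (((g₃.trans a₄.1).trans
      (a₅.2.mono (by omega) (by omega))).trans (a₆.2.mono (by omega) (by omega))).trans
      (a₇.2.mono (by omega) (by omega))
    have r₆ : s₇.reg (n + 6) = i γ := by
      rw [a₇.2.reg _ (by omega), a₆.2.reg _ (by omega), a₅.1]
    have r₇ : s₇.reg (n + 7) = j γ := by rw [a₇.2.reg _ (by omega), a₆.1]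
    have r₃ : s₇.reg (n + 3) = A γ := by
      rw [a₇.2.reg _ (by omega), a₆.2.reg _ (by omega), a₅.2.reg _ (by omega), a₄.2.1]
    refine Runs.ite (fun he => ?_) fun he =>
      (Runs.assign ?_).mono (by simp [Expr.cost]) fun _ h => h
    · have h : i γ < A γ := by simpa [Expr.eval, r₆, r₃] using he
      refine .assign ⟨?_, g₇.setReg le_rfl _⟩
      rw [if_pos h]
      simp only [e, Store.setReg_reg, Expr.eval, r₆, r₇, a₇.1]
      rw [a₇.2.arr m (by omega), a₆.2.arr m (by omega), a₅.2.arr m (by omega)]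
      exact a₄.2.2 _ h _ _
    · have h : ¬ i γ < A γ := by simpa [Expr.eval, r₆, r₃] using he
      refine ⟨?_, g₇.setReg le_rfl _⟩
      rw [if_neg h]
      simp [Expr.eval]

theorem to_tab {f : (Σ γ, Fin (A γ)) → ℕ} (hf : Comp (c.ext A) f) :
    Comp (c.tab A B C T) fun p => f ⟨p.1, p.2.1⟩ :=
  comap (c := c.ext A) (c' := c.tab A B C T) (fun p => ⟨p.1, p.2.1⟩) hf (fun _ => rfl)
    (fun _ h => h) (fun i => i.elim (.inr 0) .inl) (by rintro (_ | i) p _ <;> rfl) some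
    fun _ _ _ _ h => h

theorem to_tab₂ {f : (Σ p : (Σ γ, Fin (B γ)), Fin (C p.1)) → ℕ}
    (hf : Comp ((c.ext B).ext fun p => C p.1) f) :
    Comp (c.tab A B C T) fun p => f ⟨⟨p.1, p.2.2.1⟩, p.2.2.2⟩ :=
  comap (c := (c.ext B).ext fun p => C p.1) (c' := c.tab A B C T)
    (fun p => ⟨⟨p.1, p.2.2.1⟩, p.2.2.2⟩) hf (fun _ => rfl) (fun _ h => h)
    (fun i => i.elim (.inr 2) fun i => i.elim (.inr 1) .inl)
    (by rintro (_ | _ | i) p _ <;> rfl) some fun _ _ _ _ h => h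

/-- The entries with smaller first index, while a table is being filled. -/
theorem tab_prev {i : (Σ γ, Fin (A γ) × Fin (B γ) × Fin (C γ)) → ℕ}
    {j : ∀ p : (Σ γ, Fin (A γ) × Fin (B γ) × Fin (C γ)), Fin (B p.1)}
    {k : ∀ p : (Σ γ, Fin (A γ) × Fin (B γ) × Fin (C γ)), Fin (C p.1)}
    (hA : PolyBdd c A) (hT : PolyBdd (c.tab A B C T) fun p => T p.1 p.2.1 p.2.2.1 p.2.2.2)
    (hi : Comp (c.tab A B C T) i)
    (hj : Comp (c.tab A B C T) fun p => (j p : ℕ)) (hk : Comp (c.tab A B C T) fun p => (k p : ℕ)) :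
    Comp (c.tab A B C T) fun p => if i p < p.2.1 then T p.1 (i p) (j p) (k p) else 0 := by
  refine get (c := c.tab A B C T) none (hi.lt (tab_fst hA)) hi hj hk (fun q => ?_)
    fun p X _ hp hX => hX _ hp _ _
  obtain ⟨r, hr⟩ := hT q
  exact ⟨r, fun p h1 h2 => hr ⟨p.1, ⟨i p, h1.2.trans p.2.1.2⟩, j p, k p⟩ h1.1 h2⟩

end tab

/-! ### Bounded sums and products -/

theorem sum {b : Γ → ℕ} {f : (Σ γ, Fin (b γ)) → ℕ} (hb : Comp c b) (hf : Comp (c.ext b) f) :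
    Comp c fun γ => ∑ i : Fin (b γ), f ⟨γ, i⟩ := by
  -- The partial sums form a table in which each entry is the previous one plus one term; the other
  -- two dimensions are trivial. The full sum is the entry at `b - 1`, and for `b = 0` the guard of
  -- the table returns the empty sum 0.
  let T : ∀ γ, ℕ → Fin 1 → Fin 1 → ℕ := fun γ i _ _ =>
    ∑ i' : Fin (b γ), if (i' : ℕ) ≤ i then f ⟨γ, i'⟩ else 0
  have hT : PolyBdd (c.tab b (fun _ => 1) (fun _ => 1) T) fun p => T p.1 p.2.1 p.2.2.1 p.2.2.2 :=
    ((PolyBdd.sum hb.bdd hf.bdd).weak (c' := c.tab b (fun _ => 1) (fun _ => 1) T)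
      (fun _ => rfl) fun _ h => h).mono fun p _ => Finset.sum_le_sum fun i _ => by
        split_ifs <;> simp
  have h0 : ∀ {Γ' : Type (u + 1)} {c' : Ctx Γ'}, Comp c' fun _ => ((0 : Fin 1) : ℕ) := const 0
  refine (tab (T := T) hb (const 1) (const 1) ?_ (hb.sub (const 1)) (j := fun _ => 0)
    (k := fun _ => 0) h0 h0).congr fun γ _ => ?_
  · have hprev := tab_prev (T := T) (j := fun _ => 0) (k := fun _ => 0) hb.bdd hT
      ((tab_fst hb.bdd).sub (const 1)) h0 h0
    have hcur := hf.to_tab (B := fun _ => 1) (C := fun _ => 1) (T := T)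
    refine (hprev.add hcur).congr fun p _ => ?_
    obtain ⟨γ, ⟨i, hi⟩, j, k⟩ := p
    have hsplit : T γ i j k = (∑ i' : Fin (b γ), if (i' : ℕ) < i then f ⟨γ, i'⟩ else 0) +
        f ⟨γ, ⟨i, hi⟩⟩ := by
      have : f ⟨γ, ⟨i, hi⟩⟩ =
          ∑ i' : Fin (b γ), if i' = ⟨i, hi⟩ then f ⟨γ, i'⟩ else 0 := by simp
      rw [this, ← Finset.sum_add_distrib]
      refine Finset.sum_congr rfl fun i' _ => ?_
      rcases lt_trichotomy (i' : ℕ) i with h | h | h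
      · simp [h, h.le, Fin.ext_iff, h.ne]
      · simp [h, Fin.ext_iff]
      · simp [h.not_gt, h.not_ge, Fin.ext_iff, h.ne']
    simp only [hsplit]
    congr 1
    -- At `i = 0` the truncated index `i - 1` is again 0, which is not smaller than `i`; reading the
    -- table then returns 0, as it should.
    rcases i with _ | i
    · simp
    · simp [T]
  · have : ∀ i : Fin (b γ), (i : ℕ) ≤ b γ - 1 := fun i => by omega
    simp only [T, this, if_true]
    split_ifs with h
    · rfl
    · exact Fintype.sum_eq_zero _ fun i => absurd i.2 (by omega)

/-- The machine cannot multiply, so `g` is added up `f` times. -/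
theorem mul {f g : Γ → ℕ} (hf : Comp c f) (hg : Comp c g) : Comp c fun γ => f γ * g γ :=
  (sum hf (hg.weak f)).congr fun γ _ => by simp

end Comp

/-! ### Bounded quantifiers -/

namespace CompP

variable {p : Γ → Prop}

/-- The number of witnesses is a bounded sum of truth values, which is then compared with 0. -/
theorem ex {b : Γ → ℕ} {p : ∀ γ, Fin (b γ) → Prop} (hb : Comp c b)
    (hp : CompP (c.ext b) fun q => p q.1 q.2) : CompP c fun γ => ∃ i, p γ i :=
  (Comp.lt (.const 0) (Comp.sum (f := fun q => truth (p q.1 q.2)) hb hp)).congr fun γ _ => by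
    simp [Finset.sum_pos_iff]

theorem all {b : Γ → ℕ} {p : ∀ γ, Fin (b γ) → Prop} (hb : Comp c b)
    (hp : CompP (c.ext b) fun q => p q.1 q.2) : CompP c fun γ => ∀ i, p γ i :=
  (ex (p := fun γ i => ¬ p γ i) hb hp.not).not.congr fun γ _ => by simp

theorem tab {A B C : Γ → ℕ} {P : ∀ γ, ℕ → Fin (B γ) → Fin (C γ) → Prop} (hA : Comp c A)
    (hB : Comp c B) (hC : Comp c C)
    (hP : CompP (c.tab A B C fun γ i j k => truth (P γ i j k))
      fun p => P p.1 p.2.1 p.2.2.1 p.2.2.2)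
    {i : Γ → ℕ} {j : ∀ γ, Fin (B γ)} {k : ∀ γ, Fin (C γ)} (hi : Comp c i)
    (hj : Comp c fun γ => (j γ : ℕ)) (hk : Comp c fun γ => (k γ : ℕ)) :
    CompP c fun γ => i γ < A γ ∧ P γ (i γ) (j γ) (k γ) :=
  (Comp.tab hA hB hC hP hi hj hk).congr fun γ _ => by
    by_cases h : i γ < A γ <;> simp [h]

theorem tab_prev {A B C : Γ → ℕ} {P : ∀ γ, ℕ → Fin (B γ) → Fin (C γ) → Prop}
    {i : (Σ γ, Fin (A γ) × Fin (B γ) × Fin (C γ)) → ℕ}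
    {j : ∀ p : (Σ γ, Fin (A γ) × Fin (B γ) × Fin (C γ)), Fin (B p.1)}
    {k : ∀ p : (Σ γ, Fin (A γ) × Fin (B γ) × Fin (C γ)), Fin (C p.1)} (hA : PolyBdd c A)
    (hi : Comp (c.tab A B C fun γ i j k => truth (P γ i j k)) i)
    (hj : Comp (c.tab A B C fun γ i j k => truth (P γ i j k)) fun p => (j p : ℕ))
    (hk : Comp (c.tab A B C fun γ i j k => truth (P γ i j k)) fun p => (k p : ℕ)) :
    CompP (c.tab A B C fun γ i j k => truth (P γ i j k))
      fun p => i p < p.2.1 ∧ P p.1 (i p) (j p) (k p) :=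
  get (c := c.tab A B C fun γ i j k => truth (P γ i j k)) none (hi.lt (Comp.tab_fst hA)) hi hj hk
    fun _ _ _ hp hX => hX _ hp _ _

theorem le {f g : Γ → ℕ} (hf : Comp c f) (hg : Comp c g) : CompP c fun γ => f γ ≤ g γ :=
  (Comp.lt hg hf).not.congr fun _ _ => not_lt.symm

end CompP

/-! ### Division, remainders and powers -/

namespace Comp

variable {f g : Γ → ℕ}

/-- The quotient counts the positive multiples `(i + 1) * g` that do not exceed `f`. The condition
`0 < g` makes the count 0 for `g = 0`, in agreement with `Nat.div`. -/
theorem div (hf : Comp c f) (hg : Comp c g) : Comp c fun γ => f γ / g γ := by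
  refine (sum hf ((lt (const 0) (hg.weak f)).and
    (CompP.le (((bound_var hf.bdd).add (const 1)).mul (hg.weak f)) (hf.weak f)))).congr
    fun γ _ => ?_
  rcases Nat.eq_zero_or_pos (g γ) with h | h
  · simp [h, truth]
  · have : ∀ i : Fin (f γ), truth (0 < g γ ∧ ((i : ℕ) + 1) * g γ ≤ f γ) =
        if (i : ℕ) < f γ / g γ then 1 else 0 := fun i => by
      rw [← truth_eq_ite, ← Nat.le_div_iff_mul_le h]
      simp [h]
    simp only [this]
    rw [← Finset.sum_range fun i => if i < f γ / g γ then 1 else 0, ← Finset.card_filter]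
    have : (Finset.range (f γ)).filter (· < f γ / g γ) = Finset.range (f γ / g γ) := by
      ext i
      simpa using fun hi => lt_of_lt_of_le hi (Nat.div_le_self _ _)
    rw [this, Finset.card_range]

theorem mod (hf : Comp c f) (hg : Comp c g) : Comp c fun γ => f γ % g γ :=
  (hf.sub (hg.mul (hf.div hg))).congr fun γ _ => by
    have := Nat.div_add_mod (f γ) (g γ); omega

/-- The powers `f ^ i` for `i ≤ g` form a table, so all of them must be bounded. A bound on `f ^ g`
would not do when `f = 0`, since `0 ^ 0 = 1`; this is why `f + 1` is the base in the hypothesis. -/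
theorem pow (hf : Comp c f) (hg : Comp c g) (hpow : PolyBdd c fun γ => (f γ + 1) ^ g γ) :
    Comp c fun γ => f γ ^ g γ := by
  let T : ∀ γ, ℕ → Fin 1 → Fin 1 → ℕ := fun γ i _ _ => f γ ^ i
  have h0 : ∀ {Γ' : Type (u + 1)} {c' : Ctx Γ'}, Comp c' fun _ => ((0 : Fin 1) : ℕ) := const 0
  have hA : Comp c fun γ => g γ + 1 := hg.add (const 1)
  have hT : PolyBdd (c.tab (fun γ => g γ + 1) (fun _ => 1) (fun _ => 1) T)
      fun p => T p.1 p.2.1 p.2.2.1 p.2.2.2 :=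
    (hpow.weak (c' := c.tab (fun γ => g γ + 1) (fun _ => 1) (fun _ => 1) T)
      (fun _ => rfl) fun _ h => h).mono fun p _ =>
        (Nat.pow_le_pow_left (Nat.le_succ _) _).trans
          (Nat.pow_le_pow_right (Nat.succ_pos _) (Nat.lt_succ_iff.1 p.2.1.2))
  refine (tab (T := T) hA (const 1) (const 1) ?_ hg (j := fun _ => 0)
    (k := fun _ => 0) h0 h0).congr fun γ _ => by simp [T]
  have hprev := tab_prev (T := T) (j := fun _ => 0) (k := fun _ => 0) hA.bdd hT
    ((tab_fst hA.bdd).sub (const 1)) h0 h0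
  refine (ite (eq (tab_fst hA.bdd) (const 0)) (const 1) (hprev.mul hf.weak_tab)).congr
    fun p _ => ?_
  obtain ⟨γ, ⟨i, hi⟩, j, k⟩ := p
  rcases i with _ | i
  · simp [T]
  · simp [T, pow_succ]

end Comp

end

/-! ## Transitive closures -/

/-- `warshall R i a b`: there is a path from `a` to `b` with intermediate points below `i`. -/
def warshall {N : ℕ} (R : Fin N → Fin N → Prop) : ℕ → Fin N → Fin N → Prop
  | 0, a, b => R a b
  | i + 1, a, b => warshall R i a b ∨
      ∃ d : Fin N, (d : ℕ) = i ∧ warshall R i a d ∧ warshall R i d b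

/-- Induction on `i`. If `d` is the newest intermediate point, a half that passes through it can be
replaced by its piece up to `d` or from `d` on. If `d` is older, the pieces meeting at `d` are
joined by the induction hypothesis; when both halves pass through the newest point, the detour
between the two visits is dropped. -/
theorem warshall_trans {N : ℕ} {R : Fin N → Fin N → Prop} {a b d : Fin N} :
    ∀ {i : ℕ}, (d : ℕ) < i → warshall R i a d → warshall R i d b → warshall R i a b := by
  intro i
  induction i generalizing a b d with
  | zero => intro h; omega
  | succ i ih =>
    intro hd hl hr
    by_cases hdi : (d : ℕ) = i
    · refine .inr ⟨d, hdi, ?_, ?_⟩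
      · obtain h | ⟨e, he, h, -⟩ := hl
        · exact h
        · rwa [Fin.ext (hdi.trans he.symm)]
      · obtain h | ⟨e, he, -, h⟩ := hr
        · exact h
        · rwa [Fin.ext (hdi.trans he.symm)]
    · have hd' : (d : ℕ) < i := by omega
      obtain hl | ⟨e, he, hl, hl'⟩ := hl
      · obtain hr | ⟨f, hf, hr, hr'⟩ := hr
        · exact .inl (ih hd' hl hr)
        · exact .inr ⟨f, hf, ih hd' hl hr, hr'⟩
      · obtain hr | ⟨f, hf, hr, hr'⟩ := hr
        · exact .inr ⟨e, he, hl, ih hd' hl' hr⟩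
        · exact .inr ⟨e, he, hl, by rwa [Fin.ext (he.trans hf.symm)]⟩

/-- At stage `N` every point is allowed as an intermediate one, so `warshall_trans` appends edges
anywhere. -/
theorem warshall_iff_transGen {N : ℕ} {R : Fin N → Fin N → Prop} {a b : Fin N} :
    warshall R N a b ↔ TransGen R a b := by
  constructor
  · suffices ∀ i a b, warshall R i a b → TransGen R a b from this N a b
    intro i
    induction i with
    | zero => exact fun a b h => .single h
    | succ i ih =>
      rintro a b (h | ⟨d, -, h, h'⟩)
      exacts [ih _ _ h, (ih _ _ h).trans (ih _ _ h')]
  · have hR : ∀ i a b, R a b → warshall R i a b := fun i => by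
      induction i with
      | zero => exact fun _ _ h => h
      | succ i ih => exact fun a b h => .inl (ih a b h)
    intro h
    induction h with
    | single h => exact hR _ _ _ h
    | tail _ h ih => exact warshall_trans (Fin.is_lt _) ih (hR _ _ _ h)

/-- Serves to pass from closures over nodes to closures over their numbers, which are what programs
compute. -/
theorem transGen_equiv {α β : Type} (e : α ≃ β) {R : β → β → Prop} {a b : α} :
    TransGen (fun a b => R (e a) (e b)) a b ↔ TransGen R (e a) (e b) := by
  refine ⟨fun h => TransGen.lift e (fun _ _ h => h) _ _ h, fun h => ?_⟩
  have := TransGen.lift (p := fun a b => R (e a) (e b)) e.symm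
    (fun a b h => by simpa [Function.onFun] using h) _ _ h
  simpa [Function.onFun] using this

section

variable {Γ : Type (u + 1)} {c : Ctx Γ}

/-- Warshall's recursion is a table whose first index is the stage, from 0 to `N`, hence of length
`N + 1`. -/
theorem CompP.transGen {N : Γ → ℕ} {R : ∀ γ, Fin (N γ) → Fin (N γ) → Prop} (hN : Comp c N)
    (hR : CompP ((c.ext N).ext fun p => N p.1) fun p => R p.1.1 p.1.2 p.2)
    {a b : ∀ γ, Fin (N γ)} (ha : Comp c fun γ => (a γ : ℕ)) (hb : Comp c fun γ => (b γ : ℕ)) :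
    CompP c fun γ => TransGen (R γ) (a γ) (b γ) := by
  let P : ∀ γ, ℕ → Fin (N γ) → Fin (N γ) → Prop := fun γ => warshall (R γ)
  have hA : Comp c fun γ => N γ + 1 := hN.add (.const 1)
  refine (CompP.tab (P := P) hA hN hN ?_ hN ha hb).congr fun γ _ => by
    simp [P, warshall_iff_transGen]
  let c' := c.tab (fun γ => N γ + 1) N N fun γ i j k => truth (P γ i j k)
  have hi : Comp c' fun p => (p.2.1 : ℕ) - 1 := (Comp.tab_fst hA.bdd).sub (.const 1)
  have hj : Comp c' fun p => (p.2.2.1 : ℕ) := Comp.tab_snd hN.bdd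
  have hk : Comp c' fun p => (p.2.2.2 : ℕ) := Comp.tab_thd hN.bdd
  -- The one intermediate point that becomes available at stage `i` is `i - 1`. At stage 0 this is
  -- the point 0, which exists because the entry has the index `p.2.2.1` below `N`; its value is
  -- irrelevant there.
  let d : ∀ p : (Σ γ, Fin (N γ + 1) × Fin (N γ) × Fin (N γ)), Fin (N p.1) := fun p =>
    ⟨(p.2.1 : ℕ) - 1, by have := p.2.1.2; have := p.2.2.1.2; omega⟩
  have hd : Comp c' fun p => (d p : ℕ) := hi
  refine CompP.congr (p := fun p => ((p.2.1 : ℕ) = 0 ∧ R p.1 p.2.2.1 p.2.2.2) ∨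
      ((p.2.1 : ℕ) - 1 < p.2.1 ∧ P p.1 (p.2.1 - 1) p.2.2.1 p.2.2.2) ∨
      (((p.2.1 : ℕ) - 1 < p.2.1 ∧ P p.1 (p.2.1 - 1) p.2.2.1 (d p)) ∧
      ((p.2.1 : ℕ) - 1 < p.2.1 ∧ P p.1 (p.2.1 - 1) (d p) p.2.2.2))) ?_ ?_
  · exact ((Comp.tab_fst hA.bdd).eq (.const 0)).and (Comp.to_tab₂ hR) |>.or
      ((CompP.tab_prev hA.bdd hi hj hk).or
        ((CompP.tab_prev hA.bdd hi hj hd).and (CompP.tab_prev hA.bdd hi hd hk)))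
  · rintro ⟨γ, ⟨i, hi⟩, j, k⟩ _
    rcases i with _ | i
    · simp [P, warshall]
    · simp only [P, warshall, d]
      simp
      refine or_congr_right ⟨?_, fun h => ⟨_, rfl, h⟩⟩
      rintro ⟨e, rfl, h⟩
      exact h

end

/-! ## Commit orders from saturation -/

theorem evalRel_congr (h : PreHistory.{u}) (co co' : Fin h.nT → Fin h.nT → Prop) :
    ∀ e : Rel, e.CoFree → h.evalRel co e = h.evalRel co' e
  | .po, _ => rfl
  | .so, _ => rfl
  | .wr, _ => rfl
  | .co, he => he.elim
  | .union a b, he => by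
    simp only [PreHistory.evalRel, evalRel_congr h co co' a he.1, evalRel_congr h co co' b he.2]
  | .comp a b, he => by
    simp only [PreHistory.evalRel, evalRel_congr h co co' a he.1, evalRel_congr h co co' b he.2]
  | .plus a, he => by simp only [PreHistory.evalRel, evalRel_congr h co co' a he]
  | .star a, he => by simp only [PreHistory.evalRel, evalRel_congr h co co' a he]

/-- This makes one round of saturation sufficient: what the axioms force is known before any commit
order is chosen. -/
theorem visible_congr (h : PreHistory.{u}) (co co' : Fin h.nT → Fin h.nT → Prop) {v : Vis}
    (hv : ∀ j, (v.rel j).CoFree) (t : Fin h.nT) (r : Fin h.nE) (x : Fin h.nK) :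
    h.Visible co v t r x ↔ h.Visible co' v t r x := by
  simp only [PreHistory.Visible, evalRel_congr h co co' _ (hv _)]

/-- Acyclicity makes the reflexive transitive closure antisymmetric, hence a partial order. It
extends to a linear order, whose strict part contains `R` because `R` has no loops. -/
theorem Acyclic.exists_linear {α : Type} {R : α → α → Prop} (hR : Acyclic R) :
    ∃ S : α → α → Prop, (∀ a, ¬ S a a) ∧ (∀ a b d, S a b → S b d → S a d) ∧
      (∀ a b, a ≠ b → S a b ∨ S b a) ∧ ∀ a b, R a b → S a b := by
  have hpo : IsPartialOrder α (ReflTransGen R) :=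
    { refl := fun _ => .refl
      trans := fun _ _ _ => .trans
      antisymm := fun a b h h' => by
        rcases reflTransGen_iff_eq_or_transGen.1 h with rfl | h
        · rfl
        · exact (hR _ (TransGen.trans_left h h')).elim }
  obtain ⟨S, hS, hle⟩ := extend_partialOrder (ReflTransGen R)
  refine ⟨fun a b => S a b ∧ a ≠ b, fun a h => h.2 rfl, fun a b d h h' => ?_, fun a b hab => ?_,
    fun a b h => ⟨hle _ _ (.single h), ?_⟩⟩
  · refine ⟨hS.trans _ _ _ h.1 h'.1, ?_⟩
    rintro rfl
    exact h.2 (hS.antisymm _ _ h.1 h'.1)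
  · exact (hS.total a b).imp (fun h => ⟨h, hab⟩) fun h => ⟨h, hab.symm⟩
  · rintro rfl
    exact hR a (.single h)

/-- A commit order that satisfies the axioms contains `pco`, since visibility for it and for `(so ∪
wr)⁺` coincide; as it is a strict order, `pco` has no cycle. Conversely, any strict linear extension
of `pco` contains `so ∪ wr` and, by the same coincidence, every pair that the axioms demand. -/
theorem consistent_iff_checkSaturable (h : PreHistory.{u}) (hs : h.Saturable) :
    h.Consistent ↔ h.CheckSaturable := by
  constructor
  · rintro ⟨co, hco, hax⟩
    have htg : ∀ R : Fin h.nT → Fin h.nT → Prop, (∀ a b, R a b → co a b) →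
        ∀ a b, TransGen R a b → co a b := fun R hR a b hab => by
      induction hab with
      | single h => exact hR _ _ h
      | tail _ h ih => exact hco.trans _ _ _ ih (hR _ _ h)
    refine ⟨fun a ha => hco.irrefl a (htg _ hco.soWr _ _ ha), fun a ha =>
      hco.irrefl a (htg _ ?_ _ _ ha)⟩
    rintro t₂ t₁ (hp | ⟨x, r, hr, hne, hwr, htw, v, hv, hvis⟩)
    · exact htg _ hco.soWr _ _ hp
    · exact hax r hr v hv x t₁ t₂ hne.symm hwr htw ((visible_congr h _ _ (hs _ v hv) _ _ _).1 hvis)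
  · rintro ⟨-, hac⟩
    obtain ⟨co, hirr, htr, htot, hle⟩ := hac.exists_linear
    refine ⟨co, ⟨hirr, htr, htot, fun t t' htt => hle _ _ (.inl (.single htt))⟩, ?_⟩
    intro r hr v hv x t₁ t₂ hne hwr htw hvis
    exact hle _ _ (.inr ⟨x, r, hr, hne.symm, hwr, htw, v, hv,
      (visible_congr h _ _ (hs _ v hv) _ _ _).1 hvis⟩)

/-! ## Access to histories -/

section

variable {Γ : Type (u + 1)} {c : Ctx Γ}

/-- All histories of the context satisfy the laws. -/
def Ctx.Lawful (c : Ctx Γ) : Prop := ∀ γ, c.ok γ → (c.hist γ).IsHistory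

theorem Ctx.Lawful.ext (h : c.Lawful) (b : Γ → ℕ) : (c.ext b).Lawful := fun p hp => h p.1 hp

theorem PreHistory.nT_le_size (h : PreHistory.{u}) : h.nT ≤ h.size := by
  unfold PreHistory.size; omega

theorem PreHistory.nE_le_size (h : PreHistory.{u}) : h.nE ≤ h.size := by
  unfold PreHistory.size; omega

theorem PreHistory.nK_le_size (h : PreHistory.{u}) : h.nK ≤ h.size := by
  unfold PreHistory.size; omega

theorem PreHistory.iso_size_le (h : PreHistory.{u}) (t : Fin h.nT) :
    ((h.iso t).map Vis.size).sum ≤ h.size := by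
  have := Finset.single_le_sum (f := fun t => ((h.iso t).map Vis.size).sum)
    (fun _ _ => Nat.zero_le _) (Finset.mem_univ t)
  unfold PreHistory.size; omega

theorem PreHistory.vis_size_le (h : PreHistory.{u}) {t : Fin h.nT} {v : Vis} (hv : v ∈ h.iso t) :
    v.size ≤ h.size :=
  (List.single_le_sum (fun _ _ => Nat.zero_le _) _ (List.mem_map_of_mem hv)).trans (h.iso_size_le t)

theorem PreHistory.iso_length_le (h : PreHistory.{u}) (t : Fin h.nT) :
    (h.iso t).length ≤ h.size := by
  refine le_trans ?_ (h.iso_size_le t)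
  have := List.length_le_sum_of_one_le ((h.iso t).map Vis.size) (by
    intro i hi
    obtain ⟨v, -, rfl⟩ := List.mem_map.1 hi
    unfold Vis.size; omega)
  simpa using this

theorem CompP.fin_eq {N : Γ → ℕ} {x y : ∀ γ, Fin (N γ)} (hx : Comp c fun γ => (x γ : ℕ))
    (hy : Comp c fun γ => (y γ : ℕ)) : CompP c fun γ => x γ = y γ :=
  (hx.eq hy).congr fun _ _ => Fin.ext_iff

/-- Answers to truth queries. -/
theorem CompP.query (q : Query) {f₁ f₂ f₃ f₄ : Γ → ℕ} {p : Γ → Prop} (h₁ : Comp c f₁)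
    (h₂ : Comp c f₂) (h₃ : Comp c f₃) (h₄ : Comp c f₄)
    (h : ∀ γ, c.ok γ → (c.hist γ).query q (f₁ γ) (f₂ γ) (f₃ γ) (f₄ γ) = truth (p γ)) : CompP c p :=
  (Comp.query q h₁ h₂ h₃ h₄ (.of_le_const 1 fun γ hγ => (h γ hγ).trans_le (truth_le_one _))).congr
    fun γ hγ => (h γ hγ).symm

theorem Comp.nT : Comp c fun γ => (c.hist γ).nT :=
  .query .numTrans (.const 0) (.const 0) (.const 0) (.const 0)
    (.of_le fun γ _ => (c.hist γ).nT_le_size)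

theorem Comp.nE : Comp c fun γ => (c.hist γ).nE :=
  .query .numEvents (.const 0) (.const 0) (.const 0) (.const 0)
    (.of_le fun γ _ => (c.hist γ).nE_le_size)

theorem Comp.nK : Comp c fun γ => (c.hist γ).nK :=
  .query .numKeys (.const 0) (.const 0) (.const 0) (.const 0)
    (.of_le fun γ _ => (c.hist γ).nK_le_size)

variable {s t : ∀ γ, Fin (c.hist γ).nT} {e f : ∀ γ, Fin (c.hist γ).nE}
  {x y : ∀ γ, Fin (c.hist γ).nK}

theorem Comp.tr (he : Comp c fun γ => (e γ : ℕ)) :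
    Comp c fun γ => ((c.hist γ).tr (e γ) : ℕ) :=
  (Comp.query .trans he (.const 0) (.const 0) (.const 0) (.of_le fun γ _ => by
    simpa [PreHistory.query] using (Fin.is_lt _).le.trans (c.hist γ).nT_le_size)).congr
    fun γ _ => by simp [PreHistory.query]

theorem Comp.opCode (he : Comp c fun γ => (e γ : ℕ)) :
    Comp c fun γ => ((c.hist γ).op (e γ)).code :=
  (Comp.query .kind he (.const 0) (.const 0) (.const 0) (.of_le_const 6 fun γ _ => by
    simp only [PreHistory.query, Fin.is_lt, dite_true, Fin.eta]
    cases (c.hist γ).op (e γ) <;> simp [Op.code])).congr fun γ _ => by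
      simp [PreHistory.query]

theorem CompP.po (he : Comp c fun γ => (e γ : ℕ)) (hf : Comp c fun γ => (f γ : ℕ)) :
    CompP c fun γ => (c.hist γ).po (e γ) (f γ) :=
  .query .po he hf (.const 0) (.const 0) fun γ _ => by
    simp [PreHistory.query, ← Fin.ext_iff]

theorem CompP.so (hs : Comp c fun γ => (s γ : ℕ)) (ht : Comp c fun γ => (t γ : ℕ)) :
    CompP c fun γ => (c.hist γ).so (s γ) (t γ) :=
  .query .so hs ht (.const 0) (.const 0) fun γ _ => by
    simp [PreHistory.query, ← Fin.ext_iff]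

theorem CompP.wr (hx : Comp c fun γ => (x γ : ℕ)) (he : Comp c fun γ => (e γ : ℕ))
    (hf : Comp c fun γ => (f γ : ℕ)) : CompP c fun γ => (c.hist γ).wr (x γ) (e γ) (f γ) :=
  .query .wr hx he hf (.const 0) fun γ _ => by
    simp [PreHistory.query, ← Fin.ext_iff]

/-- The event `w` inserts at the key `x`. -/
def PreHistory.Inserts (h : PreHistory.{u}) (w : Fin h.nE) (x : Fin h.nK) : Prop :=
  ∃ R, h.op w = Op.insert R ∧ ∃ c ∈ R, c.key h.keyOf = x

theorem CompP.inserts (he : Comp c fun γ => (e γ : ℕ)) (hx : Comp c fun γ => (x γ : ℕ)) :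
    CompP c fun γ => (c.hist γ).Inserts (e γ) (x γ) :=
  .query .inserts he hx (.const 0) (.const 0) fun γ _ => by
    simp only [PreHistory.query]
    refine congrArg truth (propext ⟨?_, fun ⟨R, hR⟩ => ⟨_, _, R, rfl, rfl, hR⟩⟩)
    rintro ⟨w, x, R, hw, hx, hR⟩
    obtain rfl := Fin.ext hw
    obtain rfl := Fin.ext hx
    exact ⟨R, hR⟩

theorem CompP.whereHolds (he : Comp c fun γ => (e γ : ℕ)) (hf : Comp c fun γ => (f γ : ℕ))
    (hx : Comp c fun γ => (x γ : ℕ)) :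
    CompP c fun γ => (c.hist γ).WhereHolds (e γ) (f γ) (x γ) :=
  .query .whereHolds he hf hx (.const 0) fun γ _ => by
    simp [PreHistory.query, ← Fin.ext_iff]

theorem CompP.aborted (ht : Comp c fun γ => (t γ : ℕ)) :
    CompP c fun γ => (c.hist γ).Aborted (t γ) := by
  refine CompP.ex Comp.nE (CompP.and (CompP.fin_eq (Comp.tr ?_) (ht.weak _)) ?_)
  · exact Comp.bound_var Comp.nE.bdd
  · refine ((Comp.opCode (Comp.bound_var Comp.nE.bdd)).eq (.const 2)).congr fun q _ => ?_
    change (c.hist q.1).op q.2 = _ ↔ ((c.hist q.1).op q.2).code = 2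
    cases (c.hist q.1).op q.2 <;> simp [Op.code]

theorem CompP.isRead (he : Comp c fun γ => (e γ : ℕ)) :
    CompP c fun γ => ((c.hist γ).op (e γ)).IsRead := by
  refine ((((Comp.opCode he).eq (.const 3)).or ((Comp.opCode he).eq (.const 5))).or
    ((Comp.opCode he).eq (.const 6))).congr fun γ _ => ?_
  cases (c.hist γ).op (e γ) <;> simp [Op.code, Op.IsRead]

/-- As reads read from events that have a value, the values of deletes and updates can be told from
the `WHERE` predicates. -/
theorem PreHistory.exists_hasValue_iff {h : PreHistory.{u}} (hh : h.IsHistory) (w : Fin h.nE)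
    (x : Fin h.nK) : (∃ c, h.HasValue x w c) ↔ h.Inserts w x ∨
      (((h.op w).code = 5 ∨ (h.op w).code = 6) ∧ ∃ w', h.wr x w' w ∧ h.WhereHolds w w' x) := by
  have hpred : ∀ (p : h.Row → Bool) w' r, h.HasValue x w' (.row r) → p r = true →
      h.predHolds p w' x := by
    intro p w' r hv hp
    cases hv with
    | insert hop hc hx =>
      simp only [PreHistory.predHolds, hop]
      exact ⟨r, hc, hx, hp⟩
    | update hop _ _ _ => simpa only [PreHistory.predHolds, hop] using hp
  constructor
  · rintro ⟨c, hc⟩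
    cases hc with
    | insert hop hc hx => exact .inl ⟨_, hop, c, hc, hx⟩
    | delete hop hwr hv hp =>
      refine .inr ⟨by simp [hop, Op.code], _, hwr, ?_⟩
      simpa only [PreHistory.WhereHolds, hop] using hpred _ _ _ hv hp
    | update hop hwr hv hp =>
      refine .inr ⟨by simp [hop, Op.code], _, hwr, ?_⟩
      simpa only [PreHistory.WhereHolds, hop] using hpred _ _ _ hv hp
  · rintro (⟨R, hop, c, hc, hx⟩ | ⟨hop, w', hwr, hwh⟩)
    · exact ⟨c, .insert hop hc hx⟩
    · have hrow : ∀ p : h.Row → Bool, h.predHolds p w' x →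
          ∃ r, h.HasValue x w' (.row r) ∧ p r = true := by
        intro p hp
        unfold PreHistory.predHolds at hp
        split at hp
        · rename_i R hop'
          obtain ⟨r, hr, hx, hp⟩ := hp
          exact ⟨r, .insert hop' hr hx, hp⟩
        · rename_i p' U hop'
          -- An update leaves a value at `x` only if the row it reads satisfies its own predicate, a
          -- question that would lead further back along `wr`. It need not be pursued: being read
          -- from, `w'` has a value, and this value can only be the row `U x`.
          obtain ⟨c, hc⟩ := hh.wr_value _ _ _ hwr
          cases hc with
          | insert hop'' _ _ => simp [hop'] at hop''
          | delete hop'' _ _ _ => simp [hop'] at hop''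
          | update hop'' hwr' hv' hp' =>
            rw [hop'] at hop''
            injection hop'' with h1 h2
            subst h2
            exact ⟨_, .update hop' hwr' hv' (h1 ▸ hp'), hp⟩
        · exact hp.elim
      cases hw : h.op w with
      | delete p =>
        obtain ⟨r, hv, hp⟩ := hrow p (by simpa only [PreHistory.WhereHolds, hw] using hwh)
        exact ⟨_, .delete hw hwr hv hp⟩
      | update p U =>
        obtain ⟨r, hv, hp⟩ := hrow p (by simpa only [PreHistory.WhereHolds, hw] using hwh)
        exact ⟨_, .update hw hwr hv hp⟩
      | _ => simp [hw, Op.code] at hop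

theorem CompP.writes (hc : c.Lawful) (he : Comp c fun γ => (e γ : ℕ))
    (hx : Comp c fun γ => (x γ : ℕ)) : CompP c fun γ => (c.hist γ).Writes (e γ) (x γ) := by
  refine CompP.and (CompP.congr ?_ fun γ hγ => PreHistory.exists_hasValue_iff (hc γ hγ) _ _)
    (CompP.aborted (Comp.tr he)).not
  refine (CompP.inserts he hx).or (((Comp.opCode he).eq (.const 5)).or
    ((Comp.opCode he).eq (.const 6)) |>.and (CompP.ex Comp.nE ?_))
  have hw := Comp.bound_var (c := c) Comp.nE.bdd
  exact CompP.and (CompP.wr (c := c.ext _) (hx.weak _) hw (he.weak _))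
    (CompP.whereHolds (c := c.ext _) (he.weak _) hw (hx.weak _))

theorem CompP.transWrites (hc : c.Lawful) (ht : Comp c fun γ => (t γ : ℕ))
    (hx : Comp c fun γ => (x γ : ℕ)) : CompP c fun γ => (c.hist γ).TransWrites (t γ) (x γ) := by
  have hw := Comp.bound_var (c := c) Comp.nE.bdd
  exact CompP.ex Comp.nE (CompP.and (CompP.fin_eq (Comp.tr (c := c.ext _) hw) (ht.weak _))
    (CompP.writes (hc.ext _) hw (hx.weak _)))

theorem CompP.wrTT (hs : Comp c fun γ => (s γ : ℕ)) (ht : Comp c fun γ => (t γ : ℕ)) :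
    CompP c fun γ => (c.hist γ).wrTT (s γ) (t γ) := by
  refine (CompP.fin_eq hs ht).not.and (CompP.ex Comp.nK (CompP.ex Comp.nE (CompP.ex Comp.nE ?_)))
  have hx := ((Comp.bound_var (c := c) Comp.nK.bdd).weak fun q => (c.hist q.1).nE).weak
    fun q => (c.hist q.1.1).nE
  have hw := (Comp.bound_var (c := c.ext fun γ => (c.hist γ).nK) Comp.nE.bdd).weak
    fun q => (c.hist q.1.1).nE
  have hr := Comp.bound_var (c := (c.ext fun γ => (c.hist γ).nK).ext fun q => (c.hist q.1).nE)
    Comp.nE.bdd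
  exact (CompP.fin_eq (Comp.tr hw) (((hs.weak _).weak _).weak _)).and
    ((CompP.fin_eq (Comp.tr hr) (((ht.weak _).weak _).weak _)).and (CompP.wr hx hw hr))

theorem CompP.wrTE (hx : Comp c fun γ => (x γ : ℕ)) (ht : Comp c fun γ => (t γ : ℕ))
    (he : Comp c fun γ => (e γ : ℕ)) : CompP c fun γ => (c.hist γ).wrTE (x γ) (t γ) (e γ) := by
  have hw := Comp.bound_var (c := c) Comp.nE.bdd
  exact (CompP.fin_eq ht (Comp.tr he)).not.and (CompP.ex Comp.nE
    ((CompP.fin_eq (Comp.tr (c := c.ext _) hw) (ht.weak _)).and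
      (CompP.wr (c := c.ext _) (hx.weak _) hw (he.weak _))))

theorem CompP.soWr (hs : Comp c fun γ => (s γ : ℕ)) (ht : Comp c fun γ => (t γ : ℕ)) :
    CompP c fun γ => (c.hist γ).soWr (s γ) (t γ) :=
  (CompP.so hs ht).or (CompP.wrTT hs ht)

theorem CompP.transGen_soWr (hs : Comp c fun γ => (s γ : ℕ)) (ht : Comp c fun γ => (t γ : ℕ)) :
    CompP c fun γ => TransGen (c.hist γ).soWr (s γ) (t γ) :=
  CompP.transGen Comp.nT (CompP.soWr (c := (c.ext _).ext _)
    ((Comp.bound_var (c := c) Comp.nT.bdd).weak _)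
    (Comp.bound_var (c := c.ext _) Comp.nT.bdd)) hs ht

/-! ### Nodes -/

/-- The number of a node. -/
def PreHistory.nodeVal (h : PreHistory.{u}) (a : h.Node) : ℕ := (finSumFinEquiv a : Fin _)

theorem PreHistory.nodeVal_inj {h : PreHistory.{u}} {a b : h.Node} :
    h.nodeVal a = h.nodeVal b ↔ a = b := by
  unfold PreHistory.nodeVal
  rw [← Fin.ext_iff, EmbeddingLike.apply_eq_iff_eq]

theorem PreHistory.nodeVal_inl {h : PreHistory.{u}} (t : Fin h.nT) :
    h.nodeVal (.inl t) = t := by simp [PreHistory.nodeVal]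

theorem PreHistory.nodeVal_inr {h : PreHistory.{u}} (e : Fin h.nE) :
    h.nodeVal (.inr e) = h.nT + e := by simp [PreHistory.nodeVal]

theorem Comp.numNodes : Comp c fun γ => (c.hist γ).nT + (c.hist γ).nE := Comp.nT.add Comp.nE

variable {a b : ∀ γ, (c.hist γ).Node}

/-- The function to nodes can be computed. -/
def CompN (c : Ctx Γ) (a : ∀ γ, (c.hist γ).Node) : Prop := Comp c fun γ => (c.hist γ).nodeVal (a γ)

theorem CompN.weak (ha : CompN c a) (b : Γ → ℕ) : CompN (c.ext b) fun q => a q.1 := Comp.weak ha b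

theorem CompN.inl (ht : Comp c fun γ => (t γ : ℕ)) : CompN c fun γ => .inl (t γ) :=
  Comp.congr ht fun _ _ => PreHistory.nodeVal_inl _

theorem CompN.inr (he : Comp c fun γ => (e γ : ℕ)) : CompN c fun γ => .inr (e γ) :=
  (Comp.nT.add he).congr fun _ _ => PreHistory.nodeVal_inr _

theorem CompN.of_fin {i : ∀ γ, Fin ((c.hist γ).nT + (c.hist γ).nE)}
    (hi : Comp c fun γ => (i γ : ℕ)) : CompN c fun γ => finSumFinEquiv.symm (i γ) :=
  Comp.congr hi fun _ _ => by simp [PreHistory.nodeVal]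

theorem CompN.eq (ha : CompN c a) (hb : CompN c b) : CompP c fun γ => a γ = b γ :=
  (Comp.eq ha hb).congr fun _ _ => PreHistory.nodeVal_inj.symm

/-- Transactions are numbered first and events after them, so comparison with `nT` tells the kind of
a node, and subtraction of `nT` recovers the event. -/
theorem CompN.nodeTr (ha : CompN c a) : Comp c fun γ => ((c.hist γ).nodeTr (a γ) : ℕ) := by
  have ha' : Comp c fun γ => (c.hist γ).nodeVal (a γ) - (c.hist γ).nT := Comp.sub ha Comp.nT
  refine (Comp.ite (Comp.lt ha Comp.nT) ha
    (Comp.query .trans ha' (.const 0) (.const 0) (.const 0) (.of_le fun γ _ => ?_))).congr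
    fun γ _ => ?_
  · simp only [PreHistory.query]
    split_ifs
    · exact (Fin.is_lt _).le.trans (c.hist γ).nT_le_size
    · exact Nat.zero_le _
  · cases a γ with
    | inl t => simp [PreHistory.nodeVal_inl, PreHistory.nodeTr]
    | inr e => simp [PreHistory.nodeVal_inr, PreHistory.nodeTr, PreHistory.query]

/-- The kinds of the nodes are determined by searching for events that have these numbers. The same
device is used for `wrN` and `NodeWrites`. -/
theorem CompP.poN (ha : CompN c a) (hb : CompN c b) :
    CompP c fun γ => (c.hist γ).poN (a γ) (b γ) := by
  have he := (Comp.bound_var (c := c) Comp.nE.bdd).weak fun q => (c.hist q.1).nE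
  have hf := Comp.bound_var (c := c.ext fun γ => (c.hist γ).nE) Comp.nE.bdd
  refine (CompP.ex Comp.nE (p := fun γ e => ∃ f : Fin (c.hist γ).nE, a γ = .inr e ∧ b γ = .inr f ∧
    (c.hist γ).po e f) (CompP.ex Comp.nE ?_)).congr fun γ _ => ?_
  · exact (CompN.eq ((ha.weak _).weak _) (CompN.inr he)).and
      ((CompN.eq ((hb.weak _).weak _) (CompN.inr hf)).and (CompP.po he hf))
  · cases a γ <;> cases b γ <;> simp [PreHistory.poN]

theorem CompP.wrN (ha : CompN c a) (hb : CompN c b) :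
    CompP c fun γ => (c.hist γ).wrN (a γ) (b γ) := by
  have h₁ : CompP c fun γ => ∃ e f : Fin (c.hist γ).nE, a γ = .inr e ∧ b γ = .inr f ∧
      ∃ x, (c.hist γ).wr x e f := by
    have he := (Comp.bound_var (c := c) Comp.nE.bdd).weak fun q => (c.hist q.1).nE
    have hf := Comp.bound_var (c := c.ext fun γ => (c.hist γ).nE) Comp.nE.bdd
    refine CompP.ex Comp.nE (CompP.ex Comp.nE ?_)
    refine (CompN.eq ((ha.weak _).weak _) (CompN.inr he)).and
      ((CompN.eq ((hb.weak _).weak _) (CompN.inr hf)).and (CompP.ex Comp.nK ?_))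
    exact CompP.wr (Comp.bound_var Comp.nK.bdd) (he.weak _) (hf.weak _)
  have h₂ : CompP c fun γ => ∃ (t : Fin (c.hist γ).nT) (f : Fin (c.hist γ).nE), a γ = .inl t ∧
      b γ = .inr f ∧ ∃ x, (c.hist γ).wrTE x t f := by
    have he := (Comp.bound_var (c := c) Comp.nT.bdd).weak fun q => (c.hist q.1).nE
    have hf := Comp.bound_var (c := c.ext fun γ => (c.hist γ).nT) Comp.nE.bdd
    refine CompP.ex Comp.nT (CompP.ex Comp.nE ?_)
    refine (CompN.eq ((ha.weak _).weak _) (CompN.inl he)).and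
      ((CompN.eq ((hb.weak _).weak _) (CompN.inr hf)).and (CompP.ex Comp.nK ?_))
    exact CompP.wrTE (Comp.bound_var Comp.nK.bdd) (he.weak _) (hf.weak _)
  have h₃ : CompP c fun γ => ∃ (t : Fin (c.hist γ).nT) (t' : Fin (c.hist γ).nT), a γ = .inl t ∧
      b γ = .inl t' ∧ (c.hist γ).wrTT t t' := by
    have he := (Comp.bound_var (c := c) Comp.nT.bdd).weak fun q => (c.hist q.1).nT
    have hf := Comp.bound_var (c := c.ext fun γ => (c.hist γ).nT) Comp.nT.bdd
    refine CompP.ex Comp.nT (CompP.ex Comp.nT ?_)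
    exact (CompN.eq ((ha.weak _).weak _) (CompN.inl he)).and
      ((CompN.eq ((hb.weak _).weak _) (CompN.inl hf)).and (CompP.wrTT he hf))
  refine (h₁.or (h₂.or h₃)).congr fun γ _ => ?_
  cases a γ <;> cases b γ <;> simp [PreHistory.wrN]

theorem CompP.nodeWrites (hc : c.Lawful) (ha : CompN c a) (hx : Comp c fun γ => (x γ : ℕ)) :
    CompP c fun γ => (c.hist γ).NodeWrites (a γ) (x γ) := by
  have h₁ : CompP c fun γ => ∃ t : Fin (c.hist γ).nT, a γ = .inl t ∧
      (c.hist γ).TransWrites t (x γ) := by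
    have ht := Comp.bound_var (c := c) Comp.nT.bdd
    exact CompP.ex Comp.nT ((CompN.eq (ha.weak _) (CompN.inl ht)).and
      (CompP.transWrites (hc.ext _) ht (hx.weak _)))
  have h₂ : CompP c fun γ => ∃ e : Fin (c.hist γ).nE, a γ = .inr e ∧
      (c.hist γ).Writes e (x γ) := by
    have ht := Comp.bound_var (c := c) Comp.nE.bdd
    exact CompP.ex Comp.nE ((CompN.eq (ha.weak _) (CompN.inr ht)).and
      (CompP.writes (hc.ext _) ht (hx.weak _)))
  refine (h₁.or h₂).congr fun γ _ => ?_
  cases a γ <;> simp [PreHistory.NodeWrites]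

end

/-! ## Subexpressions by position in the postfix code -/

theorem Rel.code_length_pos (e : Rel) : 0 < e.code.length := by
  cases e <;> simp [Rel.code]

/-- The subexpression whose code ends at the position `l` of the code. -/
def Rel.sub : Rel → ℕ → Rel
  | .union a b, l =>
    if l < a.code.length then a.sub l
    else if l < a.code.length + b.code.length then b.sub (l - a.code.length) else .union a b
  | .comp a b, l =>
    if l < a.code.length then a.sub l
    else if l < a.code.length + b.code.length then b.sub (l - a.code.length) else .comp a b
  | .plus a, l => if l < a.code.length then a.sub l else .plus a
  | .star a, l => if l < a.code.length then a.sub l else .star a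
  | e, _ => e

/-- In postfix code the token of the outermost operator comes last. -/
theorem Rel.sub_last (e : Rel) {l : ℕ} (hl : l + 1 = e.code.length) : e.sub l = e := by
  cases e <;> simp only [Rel.code, List.length_append, List.length_singleton] at hl <;>
    simp only [Rel.sub] <;> (try rw [if_neg (by omega)]) <;> (try rw [if_neg (by omega)])

/-- The shape of the subexpression `s` that ends at position `l` of an expression with code `L`
and subexpressions `sub`. -/
def Rel.SubSpec (L : List ℕ) (sub : ℕ → Rel) (l : ℕ) : Rel → Prop
  | .po => L.getD l 0 = 0
  | .so => L.getD l 0 = 1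
  | .wr => L.getD l 0 = 2
  | .co => L.getD l 0 = 3
  | .union a b => L.getD l 0 = 4 ∧ a.code.length + b.code.length ≤ l ∧
      sub (l - 1) = b ∧ sub (l - 1 - b.code.length) = a
  | .comp a b => L.getD l 0 = 5 ∧ a.code.length + b.code.length ≤ l ∧
      sub (l - 1) = b ∧ sub (l - 1 - b.code.length) = a
  | .plus a => L.getD l 0 = 6 ∧ a.code.length ≤ l ∧ sub (l - 1) = a
  | .star a => L.getD l 0 = 7 ∧ a.code.length ≤ l ∧ sub (l - 1) = a

/-- The specification is preserved when the code is embedded into a larger one. -/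
theorem Rel.SubSpec.embed {L L' : List ℕ} {sub sub' : ℕ → Rel} {l d : ℕ} {s : Rel}
    (h : Rel.SubSpec L sub l s) (hL : L'.getD (d + l) 0 = L.getD l 0)
    (hsub : ∀ i ≤ l, sub' (d + i) = sub i) : Rel.SubSpec L' sub' (d + l) s := by
  cases s with
  | union a b =>
    obtain ⟨h1, h2, h3, h4⟩ := h
    have := a.code_length_pos; have := b.code_length_pos
    -- The bound on the code lengths in the specification prevents truncation in `l - 1` and `l - 1
    -- - b.code.length`, so these positions commute with the shift by `d`.
    refine ⟨hL.trans h1, by omega, ?_, ?_⟩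
    · rw [← h3, ← hsub _ (by omega)]; congr 1; omega
    · rw [← h4, ← hsub _ (by omega)]; congr 1; omega
  | comp a b =>
    obtain ⟨h1, h2, h3, h4⟩ := h
    have := a.code_length_pos; have := b.code_length_pos
    refine ⟨hL.trans h1, by omega, ?_, ?_⟩
    · rw [← h3, ← hsub _ (by omega)]; congr 1; omega
    · rw [← h4, ← hsub _ (by omega)]; congr 1; omega
  | plus a =>
    obtain ⟨h1, h2, h3⟩ := h
    have := a.code_length_pos
    refine ⟨hL.trans h1, by omega, ?_⟩
    rw [← h3, ← hsub _ (by omega)]; congr 1; omega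
  | star a =>
    obtain ⟨h1, h2, h3⟩ := h
    have := a.code_length_pos
    refine ⟨hL.trans h1, by omega, ?_⟩
    rw [← h3, ← hsub _ (by omega)]; congr 1; omega
  | _ => exact hL.trans h

theorem getD_append_mid {α : Type} (x y z : List α) (d : α) {l : ℕ} (hl : l < y.length) :
    (x ++ y ++ z).getD (x.length + l) d = y.getD l d := by
  simp only [List.getD_eq_getElem?_getD]
  rw [List.getElem?_append_left (by simp; omega), List.getElem?_append_right (by omega)]
  simp

theorem getD_append_fst {α : Type} (y z : List α) (d : α) {l : ℕ} (hl : l < y.length) :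
    (y ++ z).getD l d = y.getD l d := by
  simp only [List.getD_eq_getElem?_getD]
  rw [List.getElem?_append_left hl]

theorem getD_append_last {α : Type} (y : List α) (a d : α) {l : ℕ} (hl : l = y.length) :
    (y ++ [a]).getD l d = a := by
  subst hl; simp

/-- Induction on `e`. A position inside the code of an argument inherits its specification by
`embed`, with shift 0 or the length of the first argument. At the last position the arguments of `e`
are found at the ends of their own codes, by `sub_last`. -/
theorem Rel.sub_spec : ∀ (e : Rel) {l : ℕ}, l < e.code.length →
    Rel.SubSpec e.code e.sub l (e.sub l) := by
  -- The argument for a binary operator, stated once for `union` and `comp`; `hun` below does the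
  -- same for `plus` and `star`.
  have hbin : ∀ (a b e : Rel) (n : ℕ), e.code = a.code ++ b.code ++ [n] →
      (e.sub = fun l => if l < a.code.length then a.sub l
        else if l < a.code.length + b.code.length then b.sub (l - a.code.length) else e) →
      (∀ {l : ℕ}, l < a.code.length → Rel.SubSpec a.code a.sub l (a.sub l)) →
      (∀ {l : ℕ}, l < b.code.length → Rel.SubSpec b.code b.sub l (b.sub l)) →
      (∀ L sub l, L.getD l 0 = n → a.code.length + b.code.length ≤ l → sub (l - 1) = b →
        sub (l - 1 - b.code.length) = a → Rel.SubSpec L sub l e) →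
      ∀ {l : ℕ}, l < e.code.length → Rel.SubSpec e.code e.sub l (e.sub l) := by
    intro a b e n hcode hsub iha ihb he l hl
    have hl' : l < a.code.length + b.code.length + 1 := by
      rw [hcode] at hl; simpa [add_assoc] using hl
    by_cases h1 : l < a.code.length
    · have := (iha h1).embed (L' := e.code) (sub' := e.sub) (d := 0)
        (by rw [hcode, zero_add, List.append_assoc]; exact getD_append_fst _ _ _ h1)
        (fun i hi => by rw [hsub]; simp [lt_of_le_of_lt hi h1])
      rw [zero_add] at this
      convert this using 1
      rw [hsub]; simp [h1]
    · by_cases h2 : l < a.code.length + b.code.length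
      · obtain ⟨l, rfl⟩ := Nat.exists_eq_add_of_le (not_lt.1 h1)
        have h3 : l < b.code.length := by omega
        have := (ihb h3).embed (L' := e.code) (sub' := e.sub) (d := a.code.length)
          (by rw [hcode]; exact getD_append_mid _ _ _ _ h3)
          (fun i hi => by rw [hsub]; simp [lt_of_le_of_lt hi h3])
        convert this using 1
        rw [hsub]; simp [h3]
      · obtain rfl : l = a.code.length + b.code.length := by omega
        have := a.code_length_pos; have := b.code_length_pos
        have : Rel.SubSpec e.code e.sub (a.code.length + b.code.length) e := by
          refine he _ _ _ (by rw [hcode]; exact getD_append_last _ _ _ (by simp)) le_rfl ?_ ?_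
          · rw [hsub]
            simp only
            rw [if_neg (by omega), if_pos (by omega)]
            exact b.sub_last (by omega)
          · rw [hsub]
            simp only
            rw [if_pos (by omega)]
            exact a.sub_last (by omega)
        convert this using 1
        rw [hsub]; simp
  have hun : ∀ (a e : Rel) (n : ℕ), e.code = a.code ++ [n] →
      (e.sub = fun l => if l < a.code.length then a.sub l else e) →
      (∀ {l : ℕ}, l < a.code.length → Rel.SubSpec a.code a.sub l (a.sub l)) →
      (∀ L sub l, L.getD l 0 = n → a.code.length ≤ l → sub (l - 1) = a → Rel.SubSpec L sub l e) →
      ∀ {l : ℕ}, l < e.code.length → Rel.SubSpec e.code e.sub l (e.sub l) := by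
    intro a e n hcode hsub iha he l hl
    have hl' : l < a.code.length + 1 := by rw [hcode] at hl; simpa using hl
    by_cases h1 : l < a.code.length
    · have := (iha h1).embed (L' := e.code) (sub' := e.sub) (d := 0)
        (by rw [hcode, zero_add]; exact getD_append_fst _ _ _ h1)
        (fun i hi => by rw [hsub]; simp [lt_of_le_of_lt hi h1])
      rw [zero_add] at this
      convert this using 1
      rw [hsub]; simp [h1]
    · obtain rfl : l = a.code.length := by omega
      have := a.code_length_pos
      have : Rel.SubSpec e.code e.sub a.code.length e := by
        refine he _ _ _ (by rw [hcode]; exact getD_append_last _ _ _ rfl) le_rfl ?_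
        rw [hsub]
        simp only
        rw [if_pos (by omega)]
        exact a.sub_last (by omega)
      convert this using 1
      rw [hsub]; simp
  intro e
  induction e with
  | union a b iha ihb =>
    exact hbin a b (.union a b) 4 rfl rfl iha ihb fun L sub l h1 h2 h3 h4 => ⟨h1, h2, h3, h4⟩
  | comp a b iha ihb =>
    exact hbin a b (.comp a b) 5 rfl rfl iha ihb fun L sub l h1 h2 h3 h4 => ⟨h1, h2, h3, h4⟩
  | plus a iha => exact hun a (.plus a) 6 rfl rfl iha fun L sub l h1 h2 h3 => ⟨h1, h2, h3⟩
  | star a iha => exact hun a (.star a) 7 rfl rfl iha fun L sub l h1 h2 h3 => ⟨h1, h2, h3⟩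
  | _ =>
    intro l hl
    simp only [Rel.code, List.length_singleton, Nat.lt_one_iff] at hl
    subst hl
    simp [Rel.sub, Rel.SubSpec, Rel.code]

/-! ### Subexpressions of constraints -/

theorem WrCons.code_length_pos {n q : ℕ} (e : WrCons n q) : 0 < e.code.length := by
  cases e <;> simp [WrCons.code]

/-- The constraint whose code ends at the position `l` of the code. -/
def WrCons.sub {n q : ℕ} : WrCons n q → ℕ → WrCons n q
  | .and a b, l =>
    if l < a.code.length then a.sub l
    else if l < a.code.length + b.code.length then b.sub (l - a.code.length) else .and a b
  | .or a b, l =>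
    if l < a.code.length then a.sub l
    else if l < a.code.length + b.code.length then b.sub (l - a.code.length) else .or a b
  | .not a, l => if l < a.code.length then a.sub l else .not a
  | e, _ => e

theorem WrCons.sub_last {n q : ℕ} (e : WrCons n q) {l : ℕ} (hl : l + 1 = e.code.length) :
    e.sub l = e := by
  cases e <;> simp only [WrCons.code, List.length_append, List.length_singleton] at hl <;>
    simp only [WrCons.sub] <;> (try rw [if_neg (by omega)]) <;> (try rw [if_neg (by omega)])

/-- The shape of the subexpression `s` that ends at position `l` of a constraint with code `L`
and subexpressions `sub`. -/
def WrCons.SubSpec {n q : ℕ} (L : List (ℕ × ℕ × ℕ)) (sub : ℕ → WrCons n q) (l : ℕ) :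
    WrCons n q → Prop
  | .tt => L.getD l (0, 0, 0) = (0, 0, 0)
  | .writes i j => L.getD l (0, 0, 0) = ((1 : ℕ), (i : ℕ), (j : ℕ))
  | .transWrites i j => L.getD l (0, 0, 0) = ((2 : ℕ), (i : ℕ), (j : ℕ))
  | .keyEq j j' => L.getD l (0, 0, 0) = ((3 : ℕ), (j : ℕ), (j' : ℕ))
  | .not a => L.getD l (0, 0, 0) = (4, 0, 0) ∧ a.code.length ≤ l ∧ sub (l - 1) = a
  | .and a b => L.getD l (0, 0, 0) = (5, 0, 0) ∧ a.code.length + b.code.length ≤ l ∧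
      sub (l - 1) = b ∧ sub (l - 1 - b.code.length) = a
  | .or a b => L.getD l (0, 0, 0) = (6, 0, 0) ∧ a.code.length + b.code.length ≤ l ∧
      sub (l - 1) = b ∧ sub (l - 1 - b.code.length) = a

theorem WrCons.SubSpec.embed {n q : ℕ} {L L' : List (ℕ × ℕ × ℕ)} {sub sub' : ℕ → WrCons n q}
    {l d : ℕ} {s : WrCons n q} (h : WrCons.SubSpec L sub l s)
    (hL : L'.getD (d + l) (0, 0, 0) = L.getD l (0, 0, 0)) (hsub : ∀ i ≤ l, sub' (d + i) = sub i) :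
    WrCons.SubSpec L' sub' (d + l) s := by
  cases s with
  | and a b =>
    obtain ⟨h1, h2, h3, h4⟩ := h
    have := a.code_length_pos; have := b.code_length_pos
    refine ⟨hL.trans h1, by omega, ?_, ?_⟩
    · rw [← h3, ← hsub _ (by omega)]; congr 1; omega
    · rw [← h4, ← hsub _ (by omega)]; congr 1; omega
  | or a b =>
    obtain ⟨h1, h2, h3, h4⟩ := h
    have := a.code_length_pos; have := b.code_length_pos
    refine ⟨hL.trans h1, by omega, ?_, ?_⟩
    · rw [← h3, ← hsub _ (by omega)]; congr 1; omega
    · rw [← h4, ← hsub _ (by omega)]; congr 1; omega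
  | not a =>
    obtain ⟨h1, h2, h3⟩ := h
    have := a.code_length_pos
    refine ⟨hL.trans h1, by omega, ?_⟩
    rw [← h3, ← hsub _ (by omega)]; congr 1; omega
  | _ => exact hL.trans h

/-- The same induction as for `Rel.sub_spec`, with tokens that carry arguments. -/
theorem WrCons.sub_spec {n q : ℕ} : ∀ (e : WrCons n q) {l : ℕ}, l < e.code.length →
    WrCons.SubSpec e.code e.sub l (e.sub l) := by
  have hbin : ∀ (a b e : WrCons n q) (n : ℕ × ℕ × ℕ), e.code = a.code ++ b.code ++ [n] →
      (e.sub = fun l => if l < a.code.length then a.sub l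
        else if l < a.code.length + b.code.length then b.sub (l - a.code.length) else e) →
      (∀ {l : ℕ}, l < a.code.length → WrCons.SubSpec a.code a.sub l (a.sub l)) →
      (∀ {l : ℕ}, l < b.code.length → WrCons.SubSpec b.code b.sub l (b.sub l)) →
      (∀ L sub l, L.getD l (0, 0, 0) = n → a.code.length + b.code.length ≤ l → sub (l - 1) = b →
        sub (l - 1 - b.code.length) = a → WrCons.SubSpec L sub l e) →
      ∀ {l : ℕ}, l < e.code.length → WrCons.SubSpec e.code e.sub l (e.sub l) := by
    intro a b e n hcode hsub iha ihb he l hl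
    have hl' : l < a.code.length + b.code.length + 1 := by
      rw [hcode] at hl; simpa [add_assoc] using hl
    by_cases h1 : l < a.code.length
    · have := (iha h1).embed (L' := e.code) (sub' := e.sub) (d := 0)
        (by rw [hcode, zero_add, List.append_assoc]; exact getD_append_fst _ _ _ h1)
        (fun i hi => by rw [hsub]; simp [lt_of_le_of_lt hi h1])
      rw [zero_add] at this
      convert this using 1
      rw [hsub]; simp [h1]
    · by_cases h2 : l < a.code.length + b.code.length
      · obtain ⟨l, rfl⟩ := Nat.exists_eq_add_of_le (not_lt.1 h1)
        have h3 : l < b.code.length := by omega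
        have := (ihb h3).embed (L' := e.code) (sub' := e.sub) (d := a.code.length)
          (by rw [hcode]; exact getD_append_mid _ _ _ _ h3)
          (fun i hi => by rw [hsub]; simp [lt_of_le_of_lt hi h3])
        convert this using 1
        rw [hsub]; simp [h3]
      · obtain rfl : l = a.code.length + b.code.length := by omega
        have := a.code_length_pos; have := b.code_length_pos
        have : WrCons.SubSpec e.code e.sub (a.code.length + b.code.length) e := by
          refine he _ _ _ (by rw [hcode]; exact getD_append_last _ _ _ (by simp)) le_rfl ?_ ?_
          · rw [hsub]
            simp only
            rw [if_neg (by omega), if_pos (by omega)]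
            exact b.sub_last (by omega)
          · rw [hsub]
            simp only
            rw [if_pos (by omega)]
            exact a.sub_last (by omega)
        convert this using 1
        rw [hsub]; simp
  intro e
  induction e with
  | and a b iha ihb =>
    exact hbin a b (.and a b) _ rfl rfl iha ihb fun L sub l h1 h2 h3 h4 => ⟨h1, h2, h3, h4⟩
  | or a b iha ihb =>
    exact hbin a b (.or a b) _ rfl rfl iha ihb fun L sub l h1 h2 h3 h4 => ⟨h1, h2, h3, h4⟩
  | not a iha =>
    intro l hl
    have hl' : l < a.code.length + 1 := by simpa [WrCons.code] using hl
    by_cases h1 : l < a.code.length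
    · have := (iha h1).embed (L' := (WrCons.not a).code) (sub' := (WrCons.not a).sub) (d := 0)
        (by rw [zero_add]; exact getD_append_fst _ _ _ h1)
        (fun i hi => by simp [WrCons.sub, lt_of_le_of_lt hi h1])
      rw [zero_add] at this
      convert this using 1
      simp [WrCons.sub, h1]
    · obtain rfl : l = a.code.length := by omega
      have := a.code_length_pos
      have hsub : (WrCons.not a).sub a.code.length = WrCons.not a := by simp [WrCons.sub]
      rw [hsub]
      refine ⟨getD_append_last _ _ _ rfl, le_rfl, ?_⟩
      simp only [WrCons.sub]
      rw [if_pos (by omega)]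
      exact a.sub_last (by omega)
  | _ =>
    intro l hl
    simp only [WrCons.code, List.length_singleton, Nat.lt_one_iff] at hl
    subst hl
    simp [WrCons.sub, WrCons.SubSpec, WrCons.code]

/-! ## Access to isolation levels -/

theorem Rel.code_le (e : Rel) : ∀ n ∈ e.code, n ≤ 7 := by
  induction e <;> simp_all [Rel.code, or_imp]

theorem Rel.sub_length_le (e : Rel) (l : ℕ) : (e.sub l).code.length ≤ e.code.length := by
  induction e generalizing l with
  | union a b iha ihb =>
    have := iha l; have := ihb (l - a.code.length)
    simp only [Rel.sub]; split_ifs <;> simp [Rel.code] <;> omega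
  | comp a b iha ihb =>
    have := iha l; have := ihb (l - a.code.length)
    simp only [Rel.sub]; split_ifs <;> simp [Rel.code] <;> omega
  | plus a iha => have := iha l; simp only [Rel.sub]; split_ifs <;> simp [Rel.code]; omega
  | star a iha => have := iha l; simp only [Rel.sub]; split_ifs <;> simp [Rel.code]; omega
  | _ => simp [Rel.sub]

theorem WrCons.code_le {n q : ℕ} (e : WrCons n q) :
    ∀ p ∈ e.code, p.1 ≤ 6 ∧ p.2.1 ≤ n + q ∧ p.2.2 ≤ n + q := by
  induction e with
  | not a iha =>
    intro p hp
    simp only [WrCons.code, List.mem_append, List.mem_singleton] at hp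
    obtain hp | rfl := hp
    exacts [iha p hp, by simp]
  | and a b iha ihb =>
    intro p hp
    simp only [WrCons.code, List.mem_append, List.mem_singleton] at hp
    obtain (hp | hp) | rfl := hp
    exacts [iha p hp, ihb p hp, by simp]
  | or a b iha ihb =>
    intro p hp
    simp only [WrCons.code, List.mem_append, List.mem_singleton] at hp
    obtain (hp | hp) | rfl := hp
    exacts [iha p hp, ihb p hp, by simp]
  | tt => simp [WrCons.code]
  | writes i j => simp [WrCons.code]; omega
  | transWrites i j => simp [WrCons.code]; omega
  | keyEq i j => simp [WrCons.code]; omega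

theorem WrCons.sub_length_le {n q : ℕ} (e : WrCons n q) (l : ℕ) :
    (e.sub l).code.length ≤ e.code.length := by
  induction e generalizing l with
  | and a b iha ihb =>
    have := iha l; have := ihb (l - a.code.length)
    simp only [WrCons.sub]; split_ifs <;> simp [WrCons.code] <;> omega
  | or a b iha ihb =>
    have := iha l; have := ihb (l - a.code.length)
    simp only [WrCons.sub]; split_ifs <;> simp [WrCons.code] <;> omega
  | not a iha => have := iha l; simp only [WrCons.sub]; split_ifs <;> simp [WrCons.code]; omega
  | _ => simp [WrCons.sub]

theorem PreHistory.mem_of_visAt {h : PreHistory.{u}} {t i : ℕ} {v : Vis}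
    (hv : h.visAt t i = some v) : ∃ t', v ∈ h.iso t' := by
  unfold PreHistory.visAt at hv
  split_ifs at hv with ht
  exact ⟨_, List.mem_of_getElem? hv⟩

theorem PreHistory.size_le_of_visAt {h : PreHistory.{u}} {t i : ℕ} {v : Vis}
    (hv : h.visAt t i = some v) : v.size ≤ h.size := by
  obtain ⟨t', ht'⟩ := h.mem_of_visAt hv
  exact h.vis_size_le ht'

theorem Vis.rel_length_le (v : Vis) (j : Fin (v.m + 1)) : (v.rel j).code.length ≤ v.size := by
  have := Finset.single_le_sum (f := fun j => (v.rel j).code.length)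
    (fun _ _ => Nat.zero_le _) (Finset.mem_univ j)
  unfold Vis.size; omega

theorem getD_of_forall {α : Type} {L : List α} {d : α} {p : α → Prop} (h : ∀ a ∈ L, p a) (hd : p d)
    (l : ℕ) : p (L.getD l d) := by
  rw [List.getD_eq_getElem?_getD]
  cases hl : L[l]? with
  | none => simpa
  | some a => exact h a (List.mem_of_getElem? hl)

section

variable {Γ : Type (u + 1)} {c : Ctx Γ}

/-- Visibility relations that can be accessed. -/
structure CompVis (c : Ctx Γ) (v : Γ → Vis) : Prop where
  index : ∃ t i : Γ → ℕ, Comp c t ∧ Comp c i ∧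
    ∀ γ, c.ok γ → (c.hist γ).visAt (t γ) (i γ) = some (v γ)

namespace CompVis

variable {v : Γ → Vis}

theorem weak (hv : CompVis c v) (b : Γ → ℕ) : CompVis (c.ext b) fun p => v p.1 := by
  obtain ⟨t, i, ht, hi, h⟩ := hv.index
  exact ⟨_, _, ht.weak b, hi.weak b, fun p hp => h p.1 hp⟩

theorem size_le (hv : CompVis c v) {γ : Γ} (hγ : c.ok γ) : (v γ).size ≤ (c.hist γ).size := by
  obtain ⟨t, i, -, -, h⟩ := hv.index
  exact PreHistory.size_le_of_visAt (h γ hγ)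

theorem quantifiers_le (hv : CompVis c v) {γ : Γ} (hγ : c.ok γ) {k : ℕ}
    (hk : (c.hist γ).Bounded k) : (v γ).quantifiers ≤ k := by
  obtain ⟨t, i, -, -, h⟩ := hv.index
  obtain ⟨t', ht'⟩ := PreHistory.mem_of_visAt (h γ hγ)
  exact (hk t').2 _ ht'

theorem numInter (hv : CompVis c v) : Comp c fun γ => (v γ).m := by
  obtain ⟨t, i, ht, hi, h⟩ := hv.index
  have heq : ∀ γ, c.ok γ → (v γ).m = (c.hist γ).query .numInter (t γ) (i γ) 0 0 := fun γ hγ => by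
    simp [PreHistory.query, h γ hγ]
  refine (Comp.query .numInter ht hi (.const 0) (.const 0) (.of_le fun γ hγ => ?_)).congr heq
  rw [← heq γ hγ]
  refine le_trans ?_ (hv.size_le hγ)
  unfold Vis.size; omega

theorem numExtraKeys (hv : CompVis c v) : Comp c fun γ => (v γ).q := by
  obtain ⟨t, i, ht, hi, h⟩ := hv.index
  have heq : ∀ γ, c.ok γ → (v γ).q = (c.hist γ).query .numExtraKeys (t γ) (i γ) 0 0 :=
    fun γ hγ => by simp [PreHistory.query, h γ hγ]
  refine (Comp.query .numExtraKeys ht hi (.const 0) (.const 0) (.of_le fun γ hγ => ?_)).congr heq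
  rw [← heq γ hγ]
  refine le_trans ?_ (hv.size_le hγ)
  unfold Vis.size; omega

theorem toTrans (hv : CompVis c v) : CompP c fun γ => (v γ).toTrans = true := by
  obtain ⟨t, i, ht, hi, h⟩ := hv.index
  refine CompP.query .toTrans ht hi (.const 0) (.const 0) fun γ hγ => ?_
  simp [PreHistory.query, h γ hγ]

theorem relLength (hv : CompVis c v) {j : ∀ γ, Fin ((v γ).m + 1)}
    (hj : Comp c fun γ => (j γ : ℕ)) : Comp c fun γ => ((v γ).rel (j γ)).code.length := by
  obtain ⟨t, i, ht, hi, h⟩ := hv.index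
  have heq : ∀ γ, c.ok γ → ((v γ).rel (j γ)).code.length =
      (c.hist γ).query .relLength (t γ) (i γ) (j γ) 0 :=
    fun γ hγ => by simp [PreHistory.query, PreHistory.relCode, h γ hγ, (j γ).2]
  refine (Comp.query .relLength ht hi hj (.const 0) (.of_le fun γ hγ => ?_)).congr heq
  rw [← heq γ hγ]
  exact ((v γ).rel_length_le _).trans (hv.size_le hγ)

theorem relToken (hv : CompVis c v) {j : ∀ γ, Fin ((v γ).m + 1)}
    (hj : Comp c fun γ => (j γ : ℕ)) {l : Γ → ℕ} (hl : Comp c l) :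
    Comp c fun γ => ((v γ).rel (j γ)).code.getD (l γ) 0 := by
  obtain ⟨t, i, ht, hi, h⟩ := hv.index
  have heq : ∀ γ, c.ok γ → ((v γ).rel (j γ)).code.getD (l γ) 0 =
      (c.hist γ).query .relToken (t γ) (i γ) (j γ) (l γ) :=
    fun γ hγ => by simp [PreHistory.query, PreHistory.relCode, h γ hγ, (j γ).2]
  refine (Comp.query .relToken ht hi hj hl (.of_le_const 7 fun γ hγ => ?_)).congr heq
  rw [← heq γ hγ]
  exact getD_of_forall (p := (· ≤ 7)) (Rel.code_le _) (Nat.zero_le _) _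

theorem consLength (hv : CompVis c v) : Comp c fun γ => (v γ).cons.code.length := by
  obtain ⟨t, i, ht, hi, h⟩ := hv.index
  have heq : ∀ γ, c.ok γ → (v γ).cons.code.length =
      (c.hist γ).query .consLength (t γ) (i γ) 0 0 :=
    fun γ hγ => by simp [PreHistory.query, PreHistory.consCode, h γ hγ]
  refine (Comp.query .consLength ht hi (.const 0) (.const 0) (.of_le fun γ hγ => ?_)).congr heq
  rw [← heq γ hγ]
  refine le_trans ?_ (hv.size_le hγ)
  unfold Vis.size; omega

theorem consToken (hv : CompVis c v) {l : Γ → ℕ} (hl : Comp c l) :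
    (Comp c fun γ => ((v γ).cons.code.getD (l γ) (0, 0, 0)).1) ∧
    (Comp c fun γ => ((v γ).cons.code.getD (l γ) (0, 0, 0)).2.1) ∧
    Comp c fun γ => ((v γ).cons.code.getD (l γ) (0, 0, 0)).2.2 := by
  obtain ⟨t, i, ht, hi, h⟩ := hv.index
  have hle : ∀ γ, c.ok γ → _ := fun γ _ =>
    getD_of_forall (p := fun p : ℕ × ℕ × ℕ => p.1 ≤ 6 ∧ p.2.1 ≤ _ ∧ p.2.2 ≤ _)
      (WrCons.code_le (v γ).cons) (d := (0, 0, 0)) (by simp) (l γ)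
  -- The arguments of a token are indices of points or of keys, hence at most `(m + 2) + (q + 1)`,
  -- while the size of the formula is at least `1 + m + q`; the difference is 2.
  have hsize : ∀ γ, c.ok γ → (v γ).m + 2 + ((v γ).q + 1) ≤ (c.hist γ).size + 2 := fun γ hγ => by
    have := hv.size_le hγ
    unfold Vis.size at this; omega
  have hbdd : PolyBdd c fun γ => (c.hist γ).size + 2 := PolyBdd.size.add (.const 2)
  have h1 : ∀ γ, c.ok γ → ((v γ).cons.code.getD (l γ) (0, 0, 0)).1 =
      (c.hist γ).query .consOp (t γ) (i γ) (l γ) 0 :=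
    fun γ hγ => by simp [PreHistory.query, PreHistory.consCode, h γ hγ]
  have h2 : ∀ γ, c.ok γ → ((v γ).cons.code.getD (l γ) (0, 0, 0)).2.1 =
      (c.hist γ).query .consArg1 (t γ) (i γ) (l γ) 0 :=
    fun γ hγ => by simp [PreHistory.query, PreHistory.consCode, h γ hγ]
  have h3 : ∀ γ, c.ok γ → ((v γ).cons.code.getD (l γ) (0, 0, 0)).2.2 =
      (c.hist γ).query .consArg2 (t γ) (i γ) (l γ) 0 :=
    fun γ hγ => by simp [PreHistory.query, PreHistory.consCode, h γ hγ]
  refine ⟨(Comp.query .consOp ht hi hl (.const 0) (.of_le_const 6 fun γ hγ => ?_)).congr h1,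
    (Comp.query .consArg1 ht hi hl (.const 0) (hbdd.mono fun γ hγ => ?_)).congr h2,
    (Comp.query .consArg2 ht hi hl (.const 0) (hbdd.mono fun γ hγ => ?_)).congr h3⟩
  · rw [← h1 γ hγ]; exact (hle γ hγ).1
  · rw [← h2 γ hγ]; exact (hle γ hγ).2.1.trans (hsize γ hγ)
  · rw [← h3 γ hγ]; exact (hle γ hγ).2.2.trans (hsize γ hγ)

end CompVis

/-! ### Lengths of subexpressions -/

/-- The lengths of the subexpressions ending at the positions of a postfix code can be computed from
the arities of the tokens. -/
theorem Comp.subLength {n : Γ → ℕ} {S ar : Γ → ℕ → ℕ} (hn : Comp c n)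
    (har : Comp (c.ext n) fun p => ar p.1 p.2) (hS : PolyBdd (c.ext n) fun p => S p.1 p.2)
    (h : ∀ γ, c.ok γ → ∀ l < n γ, (ar γ l = 0 ∧ S γ l = 1) ∨
      (ar γ l = 1 ∧ 1 ≤ l ∧ S γ l = S γ (l - 1) + 1) ∨
      (ar γ l = 2 ∧ 1 ≤ l ∧ S γ l = S γ (l - 1 - S γ (l - 1)) + S γ (l - 1) + 1))
    {l : Γ → ℕ} (hl : Comp c l) (hln : ∀ γ, c.ok γ → l γ < n γ) :
    Comp c fun γ => S γ (l γ) := by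
  let T : ∀ γ, ℕ → Fin 1 → Fin 1 → ℕ := fun γ i _ _ => S γ i
  have h0 : ∀ {Γ' : Type (u + 1)} {c' : Ctx Γ'}, Comp c' fun _ => ((0 : Fin 1) : ℕ) := Comp.const 0
  have hT : PolyBdd (c.tab n (fun _ => 1) (fun _ => 1) T) fun p => T p.1 p.2.1 p.2.2.1 p.2.2.2 :=
    fun k => by
      obtain ⟨q, hq⟩ := hS k
      exact ⟨q, fun p h1 h2 => hq ⟨p.1, p.2.1⟩ h1 h2⟩
  refine (Comp.tab (T := T) hn (.const 1) (.const 1) ?_ hl (j := fun _ => 0)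
    (k := fun _ => 0) h0 h0).congr fun γ hγ => by simp [T, hln γ hγ]
  have hi := (Comp.tab_fst (T := T) hn.bdd).sub (.const 1)
  have hprev := Comp.tab_prev (T := T) (j := fun _ => 0) (k := fun _ => 0) hn.bdd hT hi h0 h0
  -- The last argument ends at `i - 1`. The first argument of a binary operator ends just before the
  -- last one begins, at `i - 1` minus the length just read from the table.
  have hprev' := Comp.tab_prev (T := T) (j := fun _ => 0) (k := fun _ => 0) hn.bdd hT
    (hi.sub hprev) h0 h0
  have har' := har.to_tab (B := fun _ => 1) (C := fun _ => 1) (T := T)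
  refine (Comp.ite (har'.eq (.const 0)) (.const 1) (Comp.ite (har'.eq (.const 1))
    (hprev.add (.const 1)) ((hprev'.add hprev).add (.const 1)))).congr fun p hp => ?_
  obtain ⟨γ, ⟨i, hi⟩, j, k⟩ := p
  obtain ⟨h1, h2⟩ | ⟨h1, h2, h3⟩ | ⟨h1, h2, h3⟩ := h γ hp i hi
  · simp [T, h1, h2]
  · have : i - 1 < i := by omega
    simp [T, h1, h3, this]
  · have : i - 1 < i := by omega
    have h4 : i - 1 - S γ (i - 1) < i := by omega
    simp [T, h1, h3, this, h4]

theorem CompVis.relSubLength {v : Γ → Vis} (hv : CompVis c v) {j : ∀ γ, Fin ((v γ).m + 1)}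
    (hj : Comp c fun γ => (j γ : ℕ)) {l : Γ → ℕ} (hl : Comp c l)
    (hln : ∀ γ, c.ok γ → l γ < ((v γ).rel (j γ)).code.length) :
    Comp c fun γ => (((v γ).rel (j γ)).sub (l γ)).code.length := by
  have hn := hv.relLength hj
  have htok := (hv.weak _).relToken (j := fun p => j p.1) (hj.weak _) (Comp.bound_var hn.bdd)
  -- Tokens below 4 are atoms, 4 and 5 are the binary `union` and `comp`, 6 and 7 the unary `plus`
  -- and `star`.
  refine Comp.subLength (S := fun γ l => (((v γ).rel (j γ)).sub l).code.length)
    (ar := fun γ l => if ((v γ).rel (j γ)).code.getD l 0 < 4 then 0 else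
      if ((v γ).rel (j γ)).code.getD l 0 < 6 then 2 else 1) hn
    (Comp.ite (htok.lt (.const 4)) (.const 0)
      (Comp.ite (htok.lt (.const 6)) (.const 2) (.const 1))) ?_ ?_ hl hln
  · exact (hn.bdd.weak (c' := c.ext _) (fun _ => rfl) fun _ h => h).mono
      fun p _ => Rel.sub_length_le _ _
  · intro γ _ l hl
    have hs := Rel.sub_spec _ hl
    revert hs
    generalize hs' : ((v γ).rel (j γ)).sub l = s
    intro hs
    cases s with
    | union a b =>
      obtain ⟨h1, h2, h3, h4⟩ := hs
      have := a.code_length_pos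
      refine .inr (.inr ⟨by rw [h1]; simp, by omega, ?_⟩)
      simp only [h3, h4]; simp [Rel.code]; omega
    | comp a b =>
      obtain ⟨h1, h2, h3, h4⟩ := hs
      have := a.code_length_pos
      refine .inr (.inr ⟨by rw [h1]; simp, by omega, ?_⟩)
      simp only [h3, h4]; simp [Rel.code]; omega
    | plus a =>
      obtain ⟨h1, h2, h3⟩ := hs
      have := a.code_length_pos
      refine .inr (.inl ⟨by rw [h1]; simp, by omega, ?_⟩)
      simp only [h3]; simp [Rel.code]
    | star a =>
      obtain ⟨h1, h2, h3⟩ := hs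
      have := a.code_length_pos
      refine .inr (.inl ⟨by rw [h1]; simp, by omega, ?_⟩)
      simp only [h3]; simp [Rel.code]
    | _ => exact .inl ⟨by simp only [Rel.SubSpec] at hs; rw [hs]; simp, by simp [Rel.code]⟩

theorem CompVis.consSubLength {v : Γ → Vis} (hv : CompVis c v) {l : Γ → ℕ} (hl : Comp c l)
    (hln : ∀ γ, c.ok γ → l γ < (v γ).cons.code.length) :
    Comp c fun γ => ((v γ).cons.sub (l γ)).code.length := by
  have hn := hv.consLength
  have htok := ((hv.weak _).consToken (Comp.bound_var hn.bdd)).1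
  -- Opcodes below 4 are atoms, 4 is negation, 5 and 6 are the binary connectives.
  refine Comp.subLength (S := fun γ l => ((v γ).cons.sub l).code.length)
    (ar := fun γ l => if ((v γ).cons.code.getD l (0, 0, 0)).1 < 4 then 0 else
      if ((v γ).cons.code.getD l (0, 0, 0)).1 < 5 then 1 else 2) hn
    (Comp.ite (htok.lt (.const 4)) (.const 0)
      (Comp.ite (htok.lt (.const 5)) (.const 1) (.const 2))) ?_ ?_ hl hln
  · exact (hn.bdd.weak (c' := c.ext _) (fun _ => rfl) fun _ h => h).mono
      fun p _ => WrCons.sub_length_le _ _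
  · intro γ _ l hl
    have hs := WrCons.sub_spec _ hl
    revert hs
    generalize hs' : (v γ).cons.sub l = s
    intro hs
    cases s with
    | and a b =>
      obtain ⟨h1, h2, h3, h4⟩ := hs
      have := a.code_length_pos
      refine .inr (.inr ⟨by rw [h1]; simp, by omega, ?_⟩)
      simp only [h3, h4]; simp [WrCons.code]; omega
    | or a b =>
      obtain ⟨h1, h2, h3, h4⟩ := hs
      have := a.code_length_pos
      refine .inr (.inr ⟨by rw [h1]; simp, by omega, ?_⟩)
      simp only [h3, h4]; simp [WrCons.code]; omega
    | not a =>
      obtain ⟨h1, h2, h3⟩ := hs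
      have := a.code_length_pos
      refine .inr (.inl ⟨by rw [h1]; simp, by omega, ?_⟩)
      simp only [h3]; simp [WrCons.code]
    | _ => exact .inl ⟨by simp only [WrCons.SubSpec] at hs; rw [hs]; simp, by simp [WrCons.code]⟩

end

/-! ## Evaluation of visibility relations -/

section

variable {Γ : Type (u + 1)} {c : Ctx Γ} {v : Γ → Vis}

/-- One step of the evaluation of a relation expression: the meaning of the subexpression that ends
at a token `tok`, given the meanings `Q₁` and `Q₂` of its last and its first argument. -/
def relStep (h : PreHistory.{u}) (co : Fin h.nT → Fin h.nT → Prop) (tok : ℕ)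
    (Q₁ Q₂ : Fin (h.nT + h.nE) → Fin (h.nT + h.nE) → Prop) (a b : Fin (h.nT + h.nE)) : Prop :=
  (tok = 0 ∧ h.poN (finSumFinEquiv.symm a) (finSumFinEquiv.symm b)) ∨
  (tok = 1 ∧ h.so (h.nodeTr (finSumFinEquiv.symm a)) (h.nodeTr (finSumFinEquiv.symm b))) ∨
  (tok = 2 ∧ h.wrN (finSumFinEquiv.symm a) (finSumFinEquiv.symm b)) ∨
  (tok = 3 ∧ co (h.nodeTr (finSumFinEquiv.symm a)) (h.nodeTr (finSumFinEquiv.symm b))) ∨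
  (tok = 4 ∧ (Q₂ a b ∨ Q₁ a b)) ∨ (tok = 5 ∧ ∃ d, Q₂ a d ∧ Q₁ d b) ∨
  (tok = 6 ∧ TransGen Q₁ a b) ∨ (tok = 7 ∧ (a = b ∨ TransGen Q₁ a b))

/-- The clauses are those of `Rel.SubSpec`. The guards such as `l - 1 < l` have the form in which a
partially filled table is read; they hold whenever the token at `l` takes the argument in question.
-/
theorem evalRel_sub_iff (h : PreHistory.{u}) (co : Fin h.nT → Fin h.nT → Prop) (e : Rel) {l : ℕ}
    (hl : l < e.code.length) (a b : Fin (h.nT + h.nE)) :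
    h.evalRel co (e.sub l) (finSumFinEquiv.symm a) (finSumFinEquiv.symm b) ↔
      relStep h co (e.code.getD l 0)
        (fun x y => l - 1 < l ∧
          h.evalRel co (e.sub (l - 1)) (finSumFinEquiv.symm x) (finSumFinEquiv.symm y))
        (fun x y => l - 1 - (e.sub (l - 1)).code.length < l ∧
          h.evalRel co (e.sub (l - 1 - (e.sub (l - 1)).code.length)) (finSumFinEquiv.symm x)
            (finSumFinEquiv.symm y)) a b := by
  have hs := Rel.sub_spec _ hl
  revert hs
  generalize e.sub l = s
  intro hs
  unfold relStep
  cases s with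
  | union a' b' =>
    obtain ⟨h1, h2, h3, h4⟩ := hs
    have := a'.code_length_pos
    have h5 : l - 1 < l := by omega
    have h6 : l - 1 - b'.code.length < l := by omega
    simp [h1, h3, h4, h5, h6, PreHistory.evalRel, -List.getD_eq_getElem?_getD]
  | comp a' b' =>
    obtain ⟨h1, h2, h3, h4⟩ := hs
    have := a'.code_length_pos
    have h5 : l - 1 < l := by omega
    have h6 : l - 1 - b'.code.length < l := by omega
    simp only [h1, h3, h4, h5, h6, PreHistory.evalRel, Relation.Comp]
    simp only [true_and, false_and, or_false, false_or,
      Nat.reduceEqDiff, OfNat.ofNat_ne_zero, OfNat.ofNat_ne_one]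
    exact finSumFinEquiv.symm.surjective.exists
  | plus a' =>
    obtain ⟨h1, h2, h3⟩ := hs
    have := a'.code_length_pos
    have h5 : l - 1 < l := by omega
    simp only [h1, h3, h5, PreHistory.evalRel]
    rw [← transGen_equiv finSumFinEquiv.symm]
    simp
  | star a' =>
    obtain ⟨h1, h2, h3⟩ := hs
    have := a'.code_length_pos
    have h5 : l - 1 < l := by omega
    simp only [h1, h3, h5, PreHistory.evalRel]
    rw [reflTransGen_iff_eq_or_transGen, ← transGen_equiv finSumFinEquiv.symm]
    simp [eq_comm]
  | _ =>
    simp only [Rel.SubSpec] at hs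
    rw [hs]
    simp [PreHistory.evalRel]

/-- Dynamic programming over the code: the table is indexed by a position and two numbers of nodes,
and its entry says whether the subexpression ending at the position relates the nodes. `relStep`
computes an entry from earlier positions; a closure operator costs one run of Warshall's algorithm.
-/
theorem CompP.evalRel (hv : CompVis c v) {j : ∀ γ, Fin ((v γ).m + 1)}
    (hj : Comp c fun γ => (j γ : ℕ)) {a b : ∀ γ, (c.hist γ).Node} (ha : CompN c a)
    (hb : CompN c b) : CompP c fun γ =>
      (c.hist γ).evalRel (TransGen (c.hist γ).soWr) ((v γ).rel (j γ)) (a γ) (b γ) := by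
  let e : Γ → Rel := fun γ => (v γ).rel (j γ)
  let n : Γ → ℕ := fun γ => (e γ).code.length
  let N : Γ → ℕ := fun γ => (c.hist γ).nT + (c.hist γ).nE
  let co : ∀ γ, Fin (c.hist γ).nT → Fin (c.hist γ).nT → Prop := fun γ => TransGen (c.hist γ).soWr
  let P : ∀ γ, ℕ → Fin (N γ) → Fin (N γ) → Prop := fun γ l x y =>
    (c.hist γ).evalRel (co γ) ((e γ).sub l) (finSumFinEquiv.symm x) (finSumFinEquiv.symm y)
  have hn : Comp c n := hv.relLength hj
  have hN : Comp c N := Comp.numNodes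
  refine (CompP.tab (P := P) hn hN hN ?_ (hn.sub (.const 1)) (j := fun γ => finSumFinEquiv (a γ))
    (k := fun γ => finSumFinEquiv (b γ)) ha hb).congr fun γ _ => ?_
  swap
  · have hpos : 0 < n γ := (e γ).code_length_pos
    have h1 : n γ - 1 < n γ := by omega
    have h2 : (e γ).sub (n γ - 1) = e γ := (e γ).sub_last (Nat.sub_add_cancel hpos)
    simp [P, h1, h2, e, co]
  let c' := c.tab n N N fun γ l x y => truth (P γ l x y)
  have hlast : Comp (c.ext n) fun p => (p.2 : ℕ) - 1 := (Comp.bound_var hn.bdd).sub (.const 1)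
  have htok : Comp c' fun p => (e p.1).code.getD p.2.1 0 :=
    ((hv.weak n).relToken (j := fun p => j p.1) (hj.weak _) (Comp.bound_var hn.bdd)).to_tab
  have hlen : Comp c' fun p => ((e p.1).sub (p.2.1 - 1)).code.length :=
    ((hv.weak n).relSubLength (j := fun p => j p.1) (hj.weak _) hlast
      fun p _ => lt_of_le_of_lt (Nat.sub_le _ _) p.2.2).to_tab
  have hi : Comp c' fun p => (p.2.1 : ℕ) - 1 := (Comp.tab_fst hn.bdd).sub (.const 1)
  have hi' := hi.sub hlen
  have hx : Comp c' fun p => (p.2.2.1 : ℕ) := Comp.tab_snd hN.bdd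
  have hy : Comp c' fun p => (p.2.2.2 : ℕ) := Comp.tab_thd hN.bdd
  have hX : CompN c' fun p => finSumFinEquiv.symm p.2.2.1 := CompN.of_fin (c := c') hx
  have hY : CompN c' fun p => finSumFinEquiv.symm p.2.2.2 := CompN.of_fin (c := c') hy
  have hN' : Comp c' fun p => N p.1 := hN.weak_tab
  have hl : Comp c' fun p => (p.2.1 : ℕ) := Comp.tab_fst hn.bdd
  have htg : CompP c' fun p => TransGen
      (fun x y => (p.2.1 : ℕ) - 1 < p.2.1 ∧ P p.1 (p.2.1 - 1) x y) p.2.2.1 p.2.2.2 := by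
    refine CompP.transGen hN' ?_ hx hy
    -- The table is read here under two further bound variables, the nodes of an edge, so it is
    -- accessed directly as the array `none` of the context.
    exact CompP.get (c := (c'.ext fun p => N p.1).ext fun q => N q.1.1) none
      (((hi.weak _).weak _).lt ((hl.weak _).weak _)) ((hi.weak _).weak _)
      ((Comp.bound_var (c := c') hN'.bdd).weak _)
      (Comp.bound_var (c := c'.ext fun p => N p.1) (hN'.weak _).bdd)
      fun _ _ _ hp hX => hX _ hp _ _
  have hcomp : CompP c' fun p => ∃ d : Fin (N p.1),
      ((p.2.1 : ℕ) - 1 - ((e p.1).sub (p.2.1 - 1)).code.length < p.2.1 ∧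
        P p.1 (p.2.1 - 1 - ((e p.1).sub (p.2.1 - 1)).code.length) p.2.2.1 d) ∧
      ((p.2.1 : ℕ) - 1 < p.2.1 ∧ P p.1 (p.2.1 - 1) d p.2.2.2) := by
    refine CompP.ex hN' (CompP.and ?_ ?_)
    · exact CompP.get (c := c'.ext fun p => N p.1) none ((hi'.weak _).lt (hl.weak _))
        (hi'.weak _) (hx.weak _) (Comp.bound_var (c := c') hN'.bdd)
        fun _ _ _ hp hX => hX _ hp _ _
    · exact CompP.get (c := c'.ext fun p => N p.1) none ((hi.weak _).lt (hl.weak _))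
        (hi.weak _) (Comp.bound_var (c := c') hN'.bdd) (hy.weak _)
        fun _ _ _ hp hX => hX _ hp _ _
  refine CompP.congr ?_ fun p _ => evalRel_sub_iff (c.hist p.1) (co p.1) (e p.1) p.2.1.2 _ _
  refine .or ((htok.eq (.const 0)).and (CompP.poN hX hY)) <|
    .or ((htok.eq (.const 1)).and (CompP.so hX.nodeTr hY.nodeTr)) <|
    .or ((htok.eq (.const 2)).and (CompP.wrN hX hY)) <|
    .or ((htok.eq (.const 3)).and (CompP.transGen_soWr hX.nodeTr hY.nodeTr)) <|
    .or ((htok.eq (.const 4)).and (.or ?_ ?_)) <|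
    .or ((htok.eq (.const 5)).and hcomp) <|
    .or ((htok.eq (.const 6)).and htg) ((htok.eq (.const 7)).and (.or ?_ htg))
  · exact CompP.tab_prev (P := P) hn.bdd hi' hx hy
  · exact CompP.tab_prev (P := P) hn.bdd hi hx hy
  · exact CompP.fin_eq hx hy

/-! ### Evaluation of constraints -/

/-- One step of the evaluation of a constraint. -/
def consStep (h : PreHistory.{u}) {n q : ℕ} (τ : Fin n → h.Node) (y : Fin q → Fin h.nK)
    (tok : ℕ × ℕ × ℕ) (Q₁ Q₂ : Prop) : Prop :=
  tok.1 = 0 ∨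
  (tok.1 = 1 ∧ ∃ (i : Fin n) (j : Fin q), (i : ℕ) = tok.2.1 ∧ (j : ℕ) = tok.2.2 ∧
    h.NodeWrites (τ i) (y j)) ∨
  (tok.1 = 2 ∧ ∃ (i : Fin n) (j : Fin q), (i : ℕ) = tok.2.1 ∧ (j : ℕ) = tok.2.2 ∧
    h.TransWrites (h.nodeTr (τ i)) (y j)) ∨
  (tok.1 = 3 ∧ ∃ i j : Fin q, (i : ℕ) = tok.2.1 ∧ (j : ℕ) = tok.2.2 ∧ y i = y j) ∨
  (tok.1 = 4 ∧ ¬ Q₁) ∨ (tok.1 = 5 ∧ Q₂ ∧ Q₁) ∨ (tok.1 = 6 ∧ (Q₂ ∨ Q₁))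

theorem evalCons_sub_iff (h : PreHistory.{u}) {n q : ℕ} (τ : Fin n → h.Node)
    (y : Fin q → Fin h.nK) (e : WrCons n q) {l : ℕ} (hl : l < e.code.length) :
    h.evalCons τ y (e.sub l) ↔ consStep h τ y (e.code.getD l (0, 0, 0))
      (l - 1 < l ∧ h.evalCons τ y (e.sub (l - 1)))
      (l - 1 - (e.sub (l - 1)).code.length < l ∧
        h.evalCons τ y (e.sub (l - 1 - (e.sub (l - 1)).code.length))) := by
  have hs := WrCons.sub_spec _ hl
  revert hs
  generalize e.sub l = s
  intro hs
  unfold consStep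
  cases s with
  | and a b =>
    obtain ⟨h1, h2, h3, h4⟩ := hs
    have := a.code_length_pos
    have h5 : l - 1 < l := by omega
    have h6 : l - 1 - b.code.length < l := by omega
    rw [h1]
    simp [h3, h4, h5, h6, PreHistory.evalCons]
  | or a b =>
    obtain ⟨h1, h2, h3, h4⟩ := hs
    have := a.code_length_pos
    have h5 : l - 1 < l := by omega
    have h6 : l - 1 - b.code.length < l := by omega
    rw [h1]
    simp [h3, h4, h5, h6, PreHistory.evalCons]
  | not a =>
    obtain ⟨h1, h2, h3⟩ := hs
    have := a.code_length_pos
    have h5 : l - 1 < l := by omega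
    rw [h1]
    simp [h3, h5, PreHistory.evalCons]
  | _ =>
    simp only [WrCons.SubSpec] at hs
    rw [hs]
    simp [PreHistory.evalCons, ← Fin.ext_iff]

/-- A bound variable can be moved past another one. -/
theorem Comp.ext_weak {b : Γ → ℕ} {f : ∀ γ, Fin (b γ) → ℕ} (hf : Comp (c.ext b) fun p => f p.1 p.2)
    (n : Γ → ℕ) : Comp ((c.ext n).ext fun p => b p.1) fun p => f p.1.1 p.2 :=
  comap (c := c.ext b) (c' := (c.ext n).ext fun p => b p.1) (fun p => ⟨p.1.1, p.2⟩) hf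
    (fun _ => rfl) (fun _ h => h) (fun i => i.elim none fun i => some (some i))
    (by rintro (_ | i) p _ <;> rfl) id fun _ _ _ _ h => h

/-- The points and keys are fixed during the evaluation, so the table needs only the position as an
index. For an atom, the indices into `τ` and `y` are found by searching for those equal to the
arguments of the token. -/
theorem CompP.evalCons (hc : c.Lawful) (hv : CompVis c v)
    {τ : ∀ γ, Fin ((v γ).m + 2) → (c.hist γ).Node} {y : ∀ γ, Fin ((v γ).q + 1) → Fin (c.hist γ).nK}
    (hτ : CompN (c.ext fun γ => (v γ).m + 2) fun p => τ p.1 p.2)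
    (hy : Comp (c.ext fun γ => (v γ).q + 1) fun p => (y p.1 p.2 : ℕ)) :
    CompP c fun γ => (c.hist γ).evalCons (τ γ) (y γ) (v γ).cons := by
  let n : Γ → ℕ := fun γ => (v γ).cons.code.length
  let P : ∀ γ, ℕ → Fin 1 → Fin 1 → Prop := fun γ l _ _ =>
    (c.hist γ).evalCons (τ γ) (y γ) ((v γ).cons.sub l)
  have hn : Comp c n := hv.consLength
  have hm : Comp c fun γ => (v γ).m + 2 := hv.numInter.add (.const 2)
  have hq : Comp c fun γ => (v γ).q + 1 := hv.numExtraKeys.add (.const 1)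
  have h0 : ∀ {Γ' : Type (u + 1)} {c' : Ctx Γ'}, Comp c' fun _ => ((0 : Fin 1) : ℕ) := Comp.const 0
  refine (CompP.tab (P := P) hn (.const 1) (.const 1) ?_ (hn.sub (.const 1)) (j := fun γ => 0)
    (k := fun γ => 0) h0 h0).congr fun γ _ => ?_
  swap
  · have hpos : 0 < n γ := (v γ).cons.code_length_pos
    have h1 : n γ - 1 < n γ := by omega
    have h2 : (v γ).cons.sub (n γ - 1) = (v γ).cons := (v γ).cons.sub_last (Nat.sub_add_cancel hpos)
    simp [P, h1, h2]
  let c' := c.tab n (fun _ => 1) (fun _ => 1) fun γ l x y => truth (P γ l x y)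
  have hlast : Comp (c.ext n) fun p => (p.2 : ℕ) - 1 := (Comp.bound_var hn.bdd).sub (.const 1)
  obtain ⟨hop, harg₁, harg₂⟩ := (hv.weak n).consToken (Comp.bound_var hn.bdd)
  have hlen : Comp c' fun p => ((v p.1).cons.sub (p.2.1 - 1)).code.length :=
    ((hv.weak n).consSubLength hlast fun p _ => lt_of_le_of_lt (Nat.sub_le _ _) p.2.2).to_tab
  have hi : Comp c' fun p => (p.2.1 : ℕ) - 1 := (Comp.tab_fst hn.bdd).sub (.const 1)
  have hi' := hi.sub hlen
  have hQ : CompP c' fun p => (p.2.1 : ℕ) - 1 < p.2.1 ∧ P p.1 (p.2.1 - 1) 0 0 :=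
    CompP.tab_prev (P := P) (j := fun _ => 0) (k := fun _ => 0) hn.bdd hi h0 h0
  have hQ' := CompP.tab_prev (P := P) (j := fun _ => 0) (k := fun _ => 0) hn.bdd hi' h0 h0
  refine CompP.congr ?_ fun p _ =>
    evalCons_sub_iff (c.hist p.1) (τ p.1) (y p.1) (v p.1).cons p.2.1.2
  have hi₁ : Comp (((c.ext n).ext fun p => (v p.1).m + 2).ext fun p => (v p.1.1).q + 1)
      fun p => (p.1.2 : ℕ) := (Comp.bound_var (hm.weak n).bdd).weak _
  have hτ₁ : CompN (((c.ext n).ext fun p => (v p.1).m + 2).ext fun p => (v p.1.1).q + 1)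
      fun p => τ p.1.1.1 p.1.2 :=
    (Comp.ext_weak (f := fun γ i => (c.hist γ).nodeVal (τ γ i)) hτ n).weak _
  have hj₁ : Comp (((c.ext n).ext fun p => (v p.1).m + 2).ext fun p => (v p.1.1).q + 1)
      fun p => (p.2 : ℕ) := Comp.bound_var ((hq.weak n).weak _).bdd
  have hy₁ : Comp (((c.ext n).ext fun p => (v p.1).m + 2).ext fun p => (v p.1.1).q + 1)
      fun p => (y p.1.1.1 p.2 : ℕ) :=
    Comp.ext_weak (c := c.ext n) (f := fun p j => (y p.1 j : ℕ))
      (Comp.ext_weak (f := fun γ j => (y γ j : ℕ)) hy n) _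
  have hi₂ : Comp (((c.ext n).ext fun p => (v p.1).q + 1).ext fun p => (v p.1.1).q + 1)
      fun p => (p.1.2 : ℕ) := (Comp.bound_var (hq.weak n).bdd).weak _
  have hy₂ : Comp (((c.ext n).ext fun p => (v p.1).q + 1).ext fun p => (v p.1.1).q + 1)
      fun p => (y p.1.1.1 p.1.2 : ℕ) :=
    (Comp.ext_weak (f := fun γ j => (y γ j : ℕ)) hy n).weak _
  have hj₃ : Comp (((c.ext n).ext fun p => (v p.1).q + 1).ext fun p => (v p.1.1).q + 1)
      fun p => (p.2 : ℕ) := Comp.bound_var ((hq.weak n).weak _).bdd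
  have hy₃ : Comp (((c.ext n).ext fun p => (v p.1).q + 1).ext fun p => (v p.1.1).q + 1)
      fun p => (y p.1.1.1 p.2 : ℕ) :=
    Comp.ext_weak (c := c.ext n) (f := fun p j => (y p.1 j : ℕ))
      (Comp.ext_weak (f := fun γ j => (y γ j : ℕ)) hy n) _
  have hwr : CompP (c.ext n) fun p => ∃ (i : Fin ((v p.1).m + 2)) (j : Fin ((v p.1).q + 1)),
      (i : ℕ) = ((v p.1).cons.code.getD p.2 (0, 0, 0)).2.1 ∧
      (j : ℕ) = ((v p.1).cons.code.getD p.2 (0, 0, 0)).2.2 ∧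
      (c.hist p.1).NodeWrites (τ p.1 i) (y p.1 j) := by
    refine CompP.ex (hm.weak n) (CompP.ex ((hq.weak n).weak _)
      (.and (hi₁.eq ((harg₁.weak _).weak _))
      (.and (hj₁.eq ((harg₂.weak _).weak _)) ?_)))
    exact CompP.nodeWrites (((hc.ext n).ext _).ext _) hτ₁ hy₁
  have htw : CompP (c.ext n) fun p => ∃ (i : Fin ((v p.1).m + 2)) (j : Fin ((v p.1).q + 1)),
      (i : ℕ) = ((v p.1).cons.code.getD p.2 (0, 0, 0)).2.1 ∧
      (j : ℕ) = ((v p.1).cons.code.getD p.2 (0, 0, 0)).2.2 ∧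
      (c.hist p.1).TransWrites ((c.hist p.1).nodeTr (τ p.1 i)) (y p.1 j) := by
    refine CompP.ex (hm.weak n) (CompP.ex ((hq.weak n).weak _)
      (.and (hi₁.eq ((harg₁.weak _).weak _))
      (.and (hj₁.eq ((harg₂.weak _).weak _)) ?_)))
    exact CompP.transWrites (((hc.ext n).ext _).ext _) hτ₁.nodeTr hy₁
  have hke : CompP (c.ext n) fun p => ∃ i j : Fin ((v p.1).q + 1),
      (i : ℕ) = ((v p.1).cons.code.getD p.2 (0, 0, 0)).2.1 ∧
      (j : ℕ) = ((v p.1).cons.code.getD p.2 (0, 0, 0)).2.2 ∧ y p.1 i = y p.1 j := by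
    refine CompP.ex (hq.weak n) (CompP.ex ((hq.weak n).weak _)
      (.and (hi₂.eq ((harg₁.weak _).weak _))
      (.and (hj₃.eq ((harg₂.weak _).weak _)) ?_)))
    exact CompP.fin_eq hy₂ hy₃
  have hop' : Comp c' fun p => ((v p.1).cons.code.getD p.2.1 (0, 0, 0)).1 := hop.to_tab
  exact .or (hop'.eq (.const 0)) <|
    .or ((hop'.eq (.const 1)).and (Comp.to_tab hwr)) <|
    .or ((hop'.eq (.const 2)).and (Comp.to_tab htw)) <|
    .or ((hop'.eq (.const 3)).and (Comp.to_tab hke)) <|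
    .or ((hop'.eq (.const 4)).and hQ.not) <|
    .or ((hop'.eq (.const 5)).and (hQ'.and hQ)) ((hop'.eq (.const 6)).and (hQ'.or hQ))

end

/-! ## The decision procedure -/

section

variable {Γ : Type (u + 1)} {c : Ctx Γ} {v : Γ → Vis}

/-- A function into `Fin N` is coded by a number in base `N`, and its value at `i` is the digit `d /
N ^ i % N`. -/
theorem Comp.finFunction {N k : Γ → ℕ} (hN : Comp c N)
    (hpow : PolyBdd c fun γ => (N γ + 1) ^ k γ) {d : ∀ γ, Fin (N γ ^ k γ)}
    (hd : Comp c fun γ => (d γ : ℕ)) {i : ∀ γ, Fin (k γ)} (hi : Comp c fun γ => (i γ : ℕ)) :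
    Comp c fun γ => (finFunctionFinEquiv.symm (d γ) (i γ) : ℕ) :=
  (hd.div (hN.pow hi (hpow.mono fun γ _ => Nat.pow_le_pow_right (Nat.succ_pos _)
    (i γ).2.le))).mod hN

/-- The number of quantifiers of an axiom is at most `K`, so the power is at most `(size + 1) ^ K`.
It is applied with the exponents `m + 2` and `q + 1`, neither of which exceeds `3 + m + q`. -/
theorem CompVis.polyBdd_pow (hv : CompVis c v) {N k : Γ → ℕ}
    (hN : ∀ γ, N γ ≤ (c.hist γ).size) (hk : ∀ γ, k γ ≤ (v γ).quantifiers) :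
    PolyBdd c fun γ => (N γ + 1) ^ k γ := fun K =>
  ⟨(Polynomial.X + 1) ^ K, fun γ h1 h2 => by
    have hkK := (hk γ).trans (hv.quantifiers_le h1 h2)
    simp only [Polynomial.eval_pow, Polynomial.eval_add, Polynomial.eval_X, Polynomial.eval_one]
    exact (Nat.pow_le_pow_right (Nat.succ_pos _) hkK).trans
      (Nat.pow_le_pow_left (Nat.succ_le_succ (hN γ)) _)⟩

/-- The path with a given number. -/
def PreHistory.path (h : PreHistory.{u}) {k : ℕ} (d : Fin ((h.nT + h.nE) ^ k)) (i : Fin k) :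
    h.Node :=
  finSumFinEquiv.symm (finFunctionFinEquiv.symm d i)

theorem PreHistory.path_surjective (h : PreHistory.{u}) (k : ℕ) :
    Function.Surjective (h.path (k := k)) :=
  (finFunctionFinEquiv.symm.trans ((Equiv.refl _).arrowCongr finSumFinEquiv.symm)).surjective

theorem CompN.path (hv : CompVis c v)
    {d : ∀ γ, Fin (((c.hist γ).nT + (c.hist γ).nE) ^ ((v γ).m + 2))}
    (hd : Comp c fun γ => (d γ : ℕ)) {i : ∀ γ, Fin ((v γ).m + 2)}
    (hi : Comp c fun γ => (i γ : ℕ)) : CompN c fun γ => (c.hist γ).path (d γ) (i γ) :=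
  CompN.of_fin (Comp.finFunction Comp.numNodes (hv.polyBdd_pow
    (fun γ => by unfold PreHistory.size; omega)
    fun γ => by unfold Vis.quantifiers; omega) hd hi)

theorem CompVis.polyBdd_path (hv : CompVis c v) :
    PolyBdd c fun γ => ((c.hist γ).nT + (c.hist γ).nE + 1) ^ ((v γ).m + 2) :=
  hv.polyBdd_pow (fun γ => by unfold PreHistory.size; omega)
    fun γ => by unfold Vis.quantifiers; omega

theorem CompVis.polyBdd_keys (hv : CompVis c v) :
    PolyBdd c fun γ => ((c.hist γ).nK + 1) ^ ((v γ).q + 1) :=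
  hv.polyBdd_pow (fun γ => (c.hist γ).nK_le_size) fun γ => by unfold Vis.quantifiers; omega

theorem CompP.path_evalRel (hv : CompVis c v)
    {d : ∀ γ, Fin (((c.hist γ).nT + (c.hist γ).nE) ^ ((v γ).m + 2))}
    (hd : Comp c fun γ => (d γ : ℕ)) :
    CompP c fun γ => ∀ i : Fin ((v γ).m + 1), (c.hist γ).evalRel (TransGen (c.hist γ).soWr)
      ((v γ).rel i) ((c.hist γ).path (d γ) i.castSucc) ((c.hist γ).path (d γ) i.succ) := by
  have hm : Comp c fun γ => (v γ).m + 1 := hv.numInter.add (.const 1)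
  have hi := Comp.bound_var (c := c) hm.bdd
  have ha : CompN (c.ext fun γ => (v γ).m + 1) fun p => (c.hist p.1).path (d p.1) p.2.castSucc :=
    CompN.path (c := c.ext fun γ => (v γ).m + 1) (hv.weak _) (hd.weak _)
      (i := fun p => p.2.castSucc) hi
  have hb : CompN (c.ext fun γ => (v γ).m + 1) fun p => (c.hist p.1).path (d p.1) p.2.succ :=
    CompN.path (c := c.ext fun γ => (v γ).m + 1) (hv.weak _) (hd.weak _)
      (i := fun p => p.2.succ) ((hi.add (.const 1)).congr fun p _ => rfl)
  exact CompP.all hm (CompP.evalRel (c := c.ext fun γ => (v γ).m + 1) (hv.weak _) hi ha hb)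

theorem CompP.path_evalCons (hc : c.Lawful) (hv : CompVis c v)
    {d : ∀ γ, Fin (((c.hist γ).nT + (c.hist γ).nE) ^ ((v γ).m + 2))}
    (hd : Comp c fun γ => (d γ : ℕ)) {d' : ∀ γ, Fin ((c.hist γ).nK ^ ((v γ).q + 1))}
    (hd' : Comp c fun γ => (d' γ : ℕ)) :
    CompP c fun γ => (c.hist γ).evalCons ((c.hist γ).path (d γ))
      (finFunctionFinEquiv.symm (d' γ)) (v γ).cons := by
  refine CompP.evalCons hc hv ?_ ?_
  · exact CompN.path (c := c.ext _) (hv.weak _) (hd.weak _)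
      (Comp.bound_var (hv.numInter.add (.const 2)).bdd)
  · exact Comp.finFunction (c := c.ext _) (Comp.nK.weak _)
      (hv.polyBdd_keys.weak (fun _ => rfl) fun _ h => h) (hd'.weak _)
      (Comp.bound_var (hv.numExtraKeys.add (.const 1)).bdd)

/-- The path with number `d` and the keys with number `d'` show that `t` is visible to `r`
at `x`. -/
def PreHistory.VisibleBy (h : PreHistory.{u}) (co : Fin h.nT → Fin h.nT → Prop) (v : Vis)
    (t : Fin h.nT) (r : Fin h.nE) (x : Fin h.nK) (d : Fin ((h.nT + h.nE) ^ (v.m + 2)))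
    (d' : Fin (h.nK ^ (v.q + 1))) : Prop :=
  h.path d 0 = Sum.inl t ∧
  h.path d (Fin.last (v.m + 1)) = (if v.toTrans then Sum.inl (h.tr r) else Sum.inr r) ∧
  (finFunctionFinEquiv.symm d' : Fin (v.q + 1) → Fin h.nK) 0 = x ∧
  (∀ i : Fin (v.m + 1), h.evalRel co (v.rel i) (h.path d i.castSucc) (h.path d i.succ)) ∧
  h.evalCons (h.path d) (finFunctionFinEquiv.symm d') v.cons

theorem PreHistory.visible_iff (h : PreHistory.{u}) (co : Fin h.nT → Fin h.nT → Prop) (v : Vis)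
    (t : Fin h.nT) (r : Fin h.nE) (x : Fin h.nK) :
    h.Visible co v t r x ↔ ∃ d d', h.VisibleBy co v t r x d d' :=
  (h.path_surjective _).exists.trans (exists_congr fun _ =>
    finFunctionFinEquiv.symm.surjective.exists)

variable {t : ∀ γ, Fin (c.hist γ).nT} {r : ∀ γ, Fin (c.hist γ).nE} {x : ∀ γ, Fin (c.hist γ).nK}

theorem CompP.visibleBy (hc : c.Lawful) (hv : CompVis c v) (ht : Comp c fun γ => (t γ : ℕ))
    (hr : Comp c fun γ => (r γ : ℕ)) (hx : Comp c fun γ => (x γ : ℕ))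
    {d : ∀ γ, Fin (((c.hist γ).nT + (c.hist γ).nE) ^ ((v γ).m + 2))}
    (hd : Comp c fun γ => (d γ : ℕ)) {d' : ∀ γ, Fin ((c.hist γ).nK ^ ((v γ).q + 1))}
    (hd' : Comp c fun γ => (d' γ : ℕ)) :
    CompP c fun γ => (c.hist γ).VisibleBy (TransGen (c.hist γ).soWr) (v γ) (t γ) (r γ) (x γ)
      (d γ) (d' γ) := by
  refine (CompN.eq (CompN.path hv hd (.const 0)) (CompN.inl ht)).and (.and ?_ (.and ?_
    ((CompP.path_evalRel hv hd).and (CompP.path_evalCons hc hv hd hd'))))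
  · refine CompN.eq (CompN.path hv hd ((hv.numInter.add (.const 1)).congr fun p _ => rfl)) ?_
    refine (Comp.ite hv.toTrans (CompN.inl (Comp.tr hr)) (CompN.inr hr)).congr fun γ _ => ?_
    exact apply_ite _ _ _ _
  · exact CompP.fin_eq (Comp.finFunction Comp.nK hv.polyBdd_keys hd' (.const 0)) hx

/-- Exhaustive search: the existential quantifiers over paths and key tuples become bounded
quantifiers over their numbers. -/
theorem CompP.visible (hc : c.Lawful) (hv : CompVis c v) (ht : Comp c fun γ => (t γ : ℕ))
    (hr : Comp c fun γ => (r γ : ℕ)) (hx : Comp c fun γ => (x γ : ℕ)) :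
    CompP c fun γ => (c.hist γ).Visible (TransGen (c.hist γ).soWr) (v γ) (t γ) (r γ) (x γ) := by
  let D : Γ → ℕ := fun γ => ((c.hist γ).nT + (c.hist γ).nE) ^ ((v γ).m + 2)
  let D' : Γ → ℕ := fun γ => (c.hist γ).nK ^ ((v γ).q + 1)
  have hD : Comp c D := Comp.numNodes.pow (hv.numInter.add (.const 2)) hv.polyBdd_path
  have hD' : Comp c D' := Comp.nK.pow (hv.numExtraKeys.add (.const 1)) hv.polyBdd_keys
  refine CompP.congr (CompP.ex hD (CompP.ex (hD'.weak D) ?_))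
    fun γ _ => PreHistory.visible_iff _ _ _ _ _ _
  exact CompP.visibleBy (c := (c.ext D).ext fun p => D' p.1) ((hc.ext _).ext _)
    ((hv.weak D).weak _) ((ht.weak D).weak _) ((hr.weak D).weak _) ((hx.weak D).weak _)
    ((Comp.bound_var hD.bdd).weak _) (Comp.bound_var (hD'.weak D).bdd)

/-! ### Saturation and the acyclicity check -/

theorem CompVis.of_iso {r : ∀ γ, Fin (c.hist γ).nT} (hr : Comp c fun γ => (r γ : ℕ))
    {i : ∀ γ, Fin ((c.hist γ).iso (r γ)).length} (hi : Comp c fun γ => (i γ : ℕ)) :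
    CompVis c fun γ => ((c.hist γ).iso (r γ)).get (i γ) :=
  ⟨_, _, hr, hi, fun γ _ => by simp [PreHistory.visAt]⟩

theorem Comp.numAxioms {t : ∀ γ, Fin (c.hist γ).nT} (ht : Comp c fun γ => (t γ : ℕ)) :
    Comp c fun γ => ((c.hist γ).iso (t γ)).length :=
  (Comp.query .numAxioms ht (.const 0) (.const 0) (.const 0) (.of_le fun γ _ => by
    simpa [PreHistory.query] using (c.hist γ).iso_length_le _)).congr fun γ _ => by
      simp [PreHistory.query]

theorem CompP.saturate (hc : c.Lawful) {s t : ∀ γ, Fin (c.hist γ).nT}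
    (hs : Comp c fun γ => (s γ : ℕ)) (ht : Comp c fun γ => (t γ : ℕ)) :
    CompP c fun γ => (c.hist γ).saturate (TransGen (c.hist γ).soWr) (s γ) (t γ) := by
  refine (CompP.transGen_soWr hs ht).or (CompP.ex Comp.nK (CompP.ex Comp.nE ?_))
  let c₂ := (c.ext fun γ => (c.hist γ).nK).ext fun q => (c.hist q.1).nE
  have hx : Comp c₂ fun p => (p.1.2 : ℕ) := (Comp.bound_var Comp.nK.bdd).weak _
  have hr : Comp c₂ fun p => (p.2 : ℕ) :=
    Comp.bound_var (c := c.ext fun γ => (c.hist γ).nK) Comp.nE.bdd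
  have hs₂ : Comp c₂ fun p => (s p.1.1 : ℕ) := (hs.weak _).weak _
  have ht₂ : Comp c₂ fun p => (t p.1.1 : ℕ) := (ht.weak _).weak _
  have hc₂ : c₂.Lawful := (hc.ext _).ext _
  have hn := Comp.numAxioms (Comp.tr (c := c₂) hr)
  refine (CompP.isRead (c := c₂) hr).and ((CompP.fin_eq hs₂ ht₂).not.and
    ((CompP.wrTE (c := c₂) hx ht₂ hr).and ((CompP.transWrites hc₂ hs₂ hx).and ?_)))
  refine CompP.congr (CompP.ex hn ?_) fun p _ => List.exists_mem_iff_get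
  exact CompP.visible (hc₂.ext _) (CompVis.of_iso (Comp.tr (c := c₂.ext _) (hr.weak _))
    (Comp.bound_var hn.bdd)) (hs₂.weak _) (hr.weak _) (hx.weak _)

theorem CompP.acyclic {R : ∀ γ, Fin (c.hist γ).nT → Fin (c.hist γ).nT → Prop}
    (hR : CompP ((c.ext fun γ => (c.hist γ).nT).ext fun p => (c.hist p.1).nT)
      fun p => R p.1.1 p.1.2 p.2) : CompP c fun γ => Acyclic (R γ) := by
  have ha := Comp.bound_var (c := c) Comp.nT.bdd
  refine CompP.all Comp.nT (CompP.not (CompP.transGen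
    (c := c.ext fun γ => (c.hist γ).nT) (N := fun p => (c.hist p.1).nT)
    (R := fun p => R p.1) Comp.nT ?_ ha ha))
  -- The relation does not depend on the point through which a cycle is sought, so that variable is
  -- dropped from the context.
  exact Comp.comap (c := (c.ext fun γ => (c.hist γ).nT).ext fun p => (c.hist p.1).nT)
    (c' := ((c.ext fun γ => (c.hist γ).nT).ext fun p => (c.hist p.1).nT).ext
      fun p => (c.hist p.1.1).nT)
    (fun p => ⟨⟨p.1.1.1, p.1.2⟩, p.2⟩) hR (fun _ => rfl) (fun _ h => h)
    (fun i => i.elim none fun i => i.elim (some none) fun i => some (some (some i)))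
    (by rintro (_ | _ | i) p _ <;> rfl) id fun _ _ _ _ h => h

theorem CompP.checkSaturable (hc : c.Lawful) : CompP c fun γ => (c.hist γ).CheckSaturable := by
  let c₂ := (c.ext fun γ => (c.hist γ).nT).ext fun p => (c.hist p.1).nT
  have hs : Comp c₂ fun p => (p.1.2 : ℕ) := (Comp.bound_var Comp.nT.bdd).weak _
  have ht : Comp c₂ fun p => (p.2 : ℕ) :=
    Comp.bound_var (c := c.ext fun γ => (c.hist γ).nT) Comp.nT.bdd
  exact (CompP.acyclic (CompP.soWr (c := c₂) hs ht)).and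
    (CompP.acyclic (CompP.saturate (c := c₂) ((hc.ext _).ext _) hs ht))

end

/-- The context in which nothing is given but the input history. -/
def Ctx.input : Ctx PreHistory.{u} where
  hist h := h
  ok h := h.IsHistory
  ι := Empty
  var i := i.elim
  κ := Empty
  arr a := a.elim

end SqlIso

/-- For a full history with a saturable isolation configuration, consistency is equivalent to the
acyclicity of the saturation of `(so ∪ wr)⁺`; and one program decides consistency (answer in register
`0`), for every `k` in a number of steps polynomial in the size of the history if the isolation
configuration is moreover bounded by `k`. -/
theorem theorem2 :
    (∀ h : SqlIso.PreHistory.{u}, h.IsHistory → h.IsFull → h.Saturable →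
      (h.Consistent ↔ h.CheckSaturable)) ∧
    ∃ P : SqlIso.Prog, ∀ k : ℕ, ∃ p : Polynomial ℕ,
      ∀ h : SqlIso.PreHistory.{u}, h.IsHistory → h.IsFull → h.Saturable → h.Bounded k →
        ∃ (n : ℕ) (s : SqlIso.Store),
          SqlIso.Exec h.query P SqlIso.Store.zero n s ∧
          n ≤ p.eval h.size ∧
          (h.Consistent → s.reg 0 = 1) ∧ (¬ h.Consistent → s.reg 0 = 0) := by
  refine ⟨fun h _ _ hs => SqlIso.consistent_iff_checkSaturable h hs, ?_⟩
  have hcomp : SqlIso.CompP SqlIso.Ctx.input fun h => h.CheckSaturable :=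
    SqlIso.CompP.checkSaturable (c := SqlIso.Ctx.input) fun _ h => h
  -- Nothing is held in memory at the start, so the first free register is 0, and the answer is left
  -- there. The program is obtained before `k` is given.
  obtain ⟨P, t, ht, hP⟩ := hcomp.prog 0 0 Empty.elim Empty.elim nofun nofun
  refine ⟨P, fun k => ?_⟩
  obtain ⟨p, hp⟩ := ht k
  refine ⟨p, fun h hh _ hs hb => ?_⟩
  obtain ⟨n, s, he, hn, hreg, -⟩ := hP h SqlIso.Store.zero hh ⟨nofun, nofun⟩
  refine ⟨n, s, he, hn.trans (hp h hh hb), fun hcons => ?_, fun hcons => ?_⟩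
  · rw [hreg, SqlIso.truth, if_pos ((SqlIso.consistent_iff_checkSaturable h hs).1 hcons)]
  · rw [hreg, SqlIso.truth, if_neg (mt (SqlIso.consistent_iff_checkSaturable h hs).2 hcons)]
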